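/- Let $n\ge 1$ be an integer, let $a>1$ and $\alpha>1$ be real numbers, and write $\mathbb R^{n+1}_+=\{(x,y): x\in\mathbb R^n,\ y>0\}$. Let $u\ge 0$ be a function on $\overline{\mathbb R^{n+1}_+}$, of class $C^2$ up to the boundary (i.e. $u\in C^2(\overline{\mathbb R^{n+1}_+})$), which satisfies $$y\,u_{yy}+a\,u_y+\Delta_x u+u^\alpha=0\quad\text{in } \mathbb R^{n+1}_+,$$ where $\Delta_x=\sum_{i=1}^n\partial_{x_i}^2$; no boundary condition is imposed on $\{y=0\}$. 1. If $1<\alpha<\frac{n+2a+2}{n+2a-2}$, then $u\equiv 0$ on $\overline{\mathbb R^{n+1}_+}$. 2. If $\alpha=\frac{n+2a+2}{n+2a-2}$, then either $u\equiv 0$, or there are $t>0$ and $x_0\in\mathbb R^n$ such that $$u(x,y)=\left(\frac{t\sqrt{(n+2a)(n+2a-2)}}{t^2+4y+|x-x_0|^2}\right)^{\frac{n+2a-2}{2}}\qquad\text{for all } (x,y)\in\overline{\mathbb R^{n+1}_+}.$$ -/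

import Mathlib

noncomputable section

namespace DegenerateLiouville

/-- The closed upper half-space `{(x, y) : x ∈ ℝⁿ, y ≥ 0}`, written with the variables split
as a pair. -/
def closedHalfSpace (n : ℕ) : Set (EuclideanSpace ℝ (Fin n) × ℝ) :=
  {p | 0 ≤ p.2}

/-- `u` is a nonnegative `C²` (up to the boundary) solution of
`y u_yy + a u_y + Δ_x u + u ^ α = 0` in the open half-space `{y > 0}`.
No condition is imposed on the boundary `{y = 0}`, and only the values of `u` on the closed
half-space matter. -/
structure IsSolution (n : ℕ) (a α : ℝ) (u : EuclideanSpace ℝ (Fin n) × ℝ → ℝ) : Prop where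
  nonneg : ∀ p ∈ closedHalfSpace n, 0 ≤ u p
  contDiffOn : ContDiffOn ℝ 2 u (closedHalfSpace n)
  equation : ∀ (x : EuclideanSpace ℝ (Fin n)) (y : ℝ), 0 < y →
    y * iteratedDeriv 2 (fun s : ℝ => u (x, s)) y
      + a * deriv (fun s : ℝ => u (x, s)) y
      + Laplacian.laplacian (fun z : EuclideanSpace ℝ (Fin n) => u (z, y)) x
      + u (x, y) ^ α = 0

/-- The critical exponent `(n + 2a + 2) / (n + 2a - 2)`. -/
def criticalExponent (n : ℕ) (a : ℝ) : ℝ :=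
  (n + 2 * a + 2) / (n + 2 * a - 2)

/-- The explicit solution
`(t √((n + 2a)(n + 2a - 2)) / (t² + 4y + |x - x₀|²)) ^ ((n + 2a - 2) / 2)`. -/
def bubble (n : ℕ) (a t : ℝ) (x₀ : EuclideanSpace ℝ (Fin n)) :
    EuclideanSpace ℝ (Fin n) × ℝ → ℝ :=
  fun p => (t * √((n + 2 * a) * (n + 2 * a - 2)) / (t ^ 2 + 4 * p.2 + ‖p.1 - x₀‖ ^ 2))
    ^ ((n + 2 * a - 2) / 2)

end DegenerateLiouville

end

noncomputable section

namespace DegenerateLiouville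

open Filter Topology Set Module InnerProductSpace

set_option linter.unusedSectionVars false

/-! ### Second derivatives along lines, and the second-order test at a minimum. -/

section Calculus

variable {V : Type*} [NormedAddCommGroup V] [InnerProductSpace ℝ V]

/-! Put `y = s²/4` and `U(x, s) = u(x, s²/4)`. Since `u` is `C²` up to the boundary, `U` is `C²` on
all of `ℝⁿ⁺¹` and even in `s`, and for `s > 0` it solves `ΔU + (b/s) ∂ₛU + U^α = 0` with `b = 2a - 1
> 1` (`IsSolution.wlap_lift`). This operator behaves like a Laplacian in dimension `N = n + 1 + b =
n + 2a`. With `m = (N - 2)/2` the critical exponent is `(m + 2)/m`, and the Kelvin transform of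
weight `m` in spheres centred on `{s = 0}` intertwines the operator with itself (`wlap_kelvin`). No
boundary condition is needed because `s^(1-b)` solves the linear equation and blows up at `s = 0`:
the hyperplane is removable in the maximum principle (`nonneg_of_wlap_nonpos`). The strong principle
then makes `U` either zero or everywhere positive.

For positive `U`, moving spheres about each boundary point gives an alternative
(`below_forall_or_kelvin_eq`): either `U` dominates all its Kelvin transforms outside their spheres,
or it equals one of them. In the first case `r^m U` is nondecreasing along rays, hence `U ≥ c
|z|^(-m)` far out. Subcritically, equality contradicts the equation, while in a large ball of radius
comparable to `R` the lower bound makes `U^(α-1)` much larger than `R^(-2)`, which a test function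
excludes (`not_isPosSolution_of_subcritical`).

In the critical case equality occurs at every centre (`exists_kelvin_eq`). If it occurred nowhere,
monotonicity about all centres would make `U` a function of `s` alone, which solves a subcritical
problem in dimension `1 + b`; if it occurred at only some centres, the decay at infinity would be
contradictory. The profile `Ψ = U^(-1/m)` is then invariant, with a conformal weight, under an
inversion about each boundary point. Comparing expansions at infinity shows that the squared radii
are `|x₀ - x|² + d` (`exists_center`). After translating `x` to the origin, all these spheres pass
through `√d e`; in hyperbolic terms they are the hyperplanes through that point, so `Ψ` is
determined by its values on the axis `ℝe`. On the axis the equation becomes an ODE, and an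
Obata-type identity, whose derivative is a weighted sum of squares of trace-free second derivatives,
forces `Ψ = c (d + s²)` (`axis_rigidity`). The inversions carry this to the whole half-space, which
gives the bubble. -/

theorem hasDerivAt_fderiv_comp {f : V → ℝ} {γ γ' : ℝ → V} {γ'' : V} {t : ℝ}
    (hf : ContDiffAt ℝ 2 f (γ t)) (h1 : HasDerivAt γ (γ' t) t) (h2 : HasDerivAt γ' γ'' t) :
    HasDerivAt (fun τ => fderiv ℝ f (γ τ) (γ' τ))
      (fderiv ℝ (fderiv ℝ f) (γ t) (γ' t) (γ' t) + fderiv ℝ f (γ t) γ'') t := by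
  have hd : DifferentiableAt ℝ (fderiv ℝ f) (γ t) :=
    (hf.fderiv_right (m := 1) (by norm_num)).differentiableAt (by norm_num)
  have h3 : HasDerivAt (fun τ => fderiv ℝ f (γ τ)) (fderiv ℝ (fderiv ℝ f) (γ t) (γ' t)) t :=
    hd.hasFDerivAt.comp_hasDerivAt t h1
  exact h3.clm_apply h2

theorem eventually_hasDerivAt_comp {f : V → ℝ} {γ γ' : ℝ → V} {t : ℝ}
    (hf : ContDiffAt ℝ 2 f (γ t)) (h1 : ∀ᶠ τ in 𝓝 t, HasDerivAt γ (γ' τ) τ) :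
    ∀ᶠ τ in 𝓝 t, HasDerivAt (fun τ => f (γ τ)) (fderiv ℝ f (γ τ) (γ' τ)) τ := by
  have h2 : ∀ᶠ z in 𝓝 (γ t), ContDiffAt ℝ 2 f z := hf.eventually (by simp)
  have hc : ContinuousAt γ t := h1.self_of_nhds.continuousAt
  filter_upwards [h1, hc.eventually h2] with τ h3 h4
  exact (h4.differentiableAt (by norm_num)).hasFDerivAt.comp_hasDerivAt τ h3

theorem hasDerivAt_line (z v : V) (t : ℝ) : HasDerivAt (fun τ : ℝ => z + τ • v) v t := by
  simpa using ((hasDerivAt_id t).smul_const v).const_add z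

/-- Reduces the diagonal of the Hessian to one-variable calculus; all later Hessian computations
pass through this restriction to lines. -/
theorem fderiv_fderiv_eq_of_line {f : V → ℝ} {z v : V} (hf : ContDiffAt ℝ 2 f z) {φ' : ℝ → ℝ}
    {φ'' : ℝ} (h1 : ∀ᶠ t in 𝓝 (0 : ℝ), HasDerivAt (fun t : ℝ => f (z + t • v)) (φ' t) t)
    (h2 : HasDerivAt φ' φ'' 0) : fderiv ℝ (fderiv ℝ f) z v v = φ'' := by
  have hz : z + (0 : ℝ) • v = z := by simp
  have e1 := eventually_hasDerivAt_comp (γ := fun t : ℝ => z + t • v) (γ' := fun _ => v) (t := 0)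
    (by simpa [hz] using hf) (Eventually.of_forall (hasDerivAt_line z v))
  have e2 := hasDerivAt_fderiv_comp (γ := fun t : ℝ => z + t • v) (γ' := fun _ => v) (γ'' := 0)
    (t := 0) (by simpa [hz] using hf) (hasDerivAt_line z v 0) (hasDerivAt_const 0 v)
  simp only [hz, map_zero, add_zero] at e2
  have e3 : (fun τ : ℝ => fderiv ℝ f (z + τ • v) v) =ᶠ[𝓝 0] φ' := by
    filter_upwards [e1, h1] with t a b using a.unique b
  exact e2.unique (h2.congr_of_eventuallyEq e3)

theorem fderiv_eq_of_line {f : V → ℝ} {z v : V} (hf : ContDiffAt ℝ 2 f z) {c : ℝ}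
    (h1 : HasDerivAt (fun t : ℝ => f (z + t • v)) c 0) : fderiv ℝ f z v = c := by
  have hz : z + (0 : ℝ) • v = z := by simp
  have e1 := eventually_hasDerivAt_comp (γ := fun t : ℝ => z + t • v) (γ' := fun _ => v) (t := 0)
    (by simpa [hz] using hf) (Eventually.of_forall (hasDerivAt_line z v))
  have := e1.self_of_nhds.unique h1
  simpa [hz] using this

/-- If the second derivative along a line were negative, the point would also be a local maximum on
that line. The restriction would then be locally constant and its second derivative zero. -/
theorem fderiv_fderiv_nonneg_of_isLocalMin {f : V → ℝ} {z : V} (hf : ContDiffAt ℝ 2 f z)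
    (hm : IsLocalMin f z) (v : V) : 0 ≤ fderiv ℝ (fderiv ℝ f) z v v := by
  have hz : z + (0 : ℝ) • v = z := by simp
  have e1 := eventually_hasDerivAt_comp (γ := fun t : ℝ => z + t • v) (γ' := fun _ => v) (t := 0)
    (by simpa [hz] using hf) (Eventually.of_forall (hasDerivAt_line z v))
  have e2 := hasDerivAt_fderiv_comp (γ := fun t : ℝ => z + t • v) (γ' := fun _ => v) (γ'' := 0)
    (t := 0) (by simpa [hz] using hf) (hasDerivAt_line z v 0) (hasDerivAt_const 0 v)
  simp only [hz, map_zero, add_zero] at e2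
  by_contra! hneg
  set φ : ℝ → ℝ := fun t => f (z + t • v) with hφ
  have hcγ : ContinuousAt (fun t : ℝ => z + t • v) 0 := (hasDerivAt_line z v 0).continuousAt
  have hlm : IsLocalMin φ 0 := by
    have := hcγ.eventually (p := fun w => f z ≤ f w) (by simp only [hz]; exact hm)
    filter_upwards [this] with t ht
    simpa [hφ] using ht
  have hd : deriv φ =ᶠ[𝓝 0] fun τ => fderiv ℝ f (z + τ • v) v := by
    filter_upwards [e1] with t ht using ht.deriv
  have hdd : deriv (deriv φ) 0 = fderiv ℝ (fderiv ℝ f) z v v := by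
    rw [hd.deriv_eq]; exact e2.deriv
  have hd0 : deriv φ 0 = 0 := hlm.deriv_eq_zero
  have hlM : IsLocalMax φ 0 := isLocalMax_of_deriv_deriv_neg (by rw [hdd]; exact hneg) hd0
    e1.self_of_nhds.continuousAt
  have hconst : φ =ᶠ[𝓝 0] fun _ => φ 0 := by
    filter_upwards [hlm, hlM] with t a b using le_antisymm b a
  have : deriv φ =ᶠ[𝓝 0] fun _ => (0 : ℝ) := by
    have := hconst.deriv
    simpa using this
  have h0 : deriv (deriv φ) 0 = 0 := by rw [this.deriv_eq]; simp
  rw [hdd] at h0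
  exact hneg.ne h0

theorem normSq_line (z v : V) (t : ℝ) :
    ‖z + t • v‖ ^ 2 = ‖z‖ ^ 2 + 2 * t * inner ℝ z v + t ^ 2 * ‖v‖ ^ 2 := by
  rw [norm_add_sq_real, inner_smul_right, norm_smul, mul_pow, Real.norm_eq_abs, sq_abs]
  ring

theorem hasDerivAt_normSq_line (z v : V) (t : ℝ) :
    HasDerivAt (fun τ : ℝ => ‖z + τ • v‖ ^ 2) (2 * inner ℝ z v + 2 * t * ‖v‖ ^ 2) t := by
  have : (fun τ : ℝ => ‖z + τ • v‖ ^ 2) =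
      fun τ : ℝ => ‖z‖ ^ 2 + 2 * τ * inner ℝ z v + τ ^ 2 * ‖v‖ ^ 2 := by
    ext τ; exact normSq_line z v τ
  rw [this]
  have h := ((((hasDerivAt_id t).const_mul 2).mul_const (inner ℝ z v)).const_add
    (‖z‖ ^ 2)).add (((hasDerivAt_id t).pow 2).mul_const (‖v‖ ^ 2))
  refine HasDerivAt.congr_deriv h ?_
  simp

theorem radial_contDiffAt {g : ℝ → ℝ} {p z : V} (hg : ContDiffAt ℝ 2 g (‖z - p‖ ^ 2)) :
    ContDiffAt ℝ 2 (fun w => g (‖w - p‖ ^ 2)) z :=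
  hg.comp z (contDiffAt_id.sub contDiffAt_const |>.norm_sq ℝ)

end Calculus

/-! ### The operator `Δ + (b/s) ∂ₛ` on radial functions and on functions of the height. -/

section Operator

variable {V : Type*} [NormedAddCommGroup V] [InnerProductSpace ℝ V] [FiniteDimensional ℝ V]

/-- The Laplacian as the trace of the second derivative. -/
def lap (f : V → ℝ) (z : V) : ℝ :=
  ∑ i, fderiv ℝ (fderiv ℝ f) z (stdOrthonormalBasis ℝ V i) (stdOrthonormalBasis ℝ V i)

theorem laplacian_eq_sum {ι : Type*} [Fintype ι] (v : OrthonormalBasis ι ℝ V) (f : V → ℝ) (z : V) :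
    Laplacian.laplacian f z = ∑ i, fderiv ℝ (fderiv ℝ f) z (v i) (v i) := by
  rw [laplacian_eq_iteratedFDeriv_orthonormalBasis f v]
  simp [iteratedFDeriv_two_apply]

theorem laplacian_eq_lap (f : V → ℝ) (z : V) : Laplacian.laplacian f z = lap f z :=
  laplacian_eq_sum _ f z

theorem lap_eq_sum {ι : Type*} [Fintype ι] (v : OrthonormalBasis ι ℝ V) (f : V → ℝ) (z : V) :
    lap f z = ∑ i, fderiv ℝ (fderiv ℝ f) z (v i) (v i) := by
  rw [← laplacian_eq_lap, laplacian_eq_sum v]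

/-- The operator `Δ + (b / s) ∂_s`, where `s = ⟪e, z⟫` and `e` is a unit vector. -/
def wlap (e : V) (b : ℝ) (f : V → ℝ) (z : V) : ℝ :=
  lap f z + b / inner ℝ e z * fderiv ℝ f z e

theorem wlap_nonneg_of_isLocalMin {e : V} {b : ℝ} {f : V → ℝ} {z : V} (hf : ContDiffAt ℝ 2 f z)
    (hm : IsLocalMin f z) : 0 ≤ wlap e b f z := by
  have h : fderiv ℝ f z = 0 := hm.fderiv_eq_zero
  simp only [wlap, h, zero_apply, mul_zero, add_zero, lap]
  exact Finset.sum_nonneg fun i _ => fderiv_fderiv_nonneg_of_isLocalMin hf hm _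

theorem wlap_add {e : V} {b : ℝ} {f g : V → ℝ} {z : V} (hf : ContDiffAt ℝ 2 f z)
    (hg : ContDiffAt ℝ 2 g z) :
    wlap e b (fun w => f w + g w) z = wlap e b f z + wlap e b g z := by
  have h1 : fderiv ℝ (fun w => f w + g w) z = fderiv ℝ f z + fderiv ℝ g z :=
    fderiv_fun_add (hf.differentiableAt (by norm_num)) (hg.differentiableAt (by norm_num))
  have h2 : lap (fun w => f w + g w) z = lap f z + lap g z := by
    rw [← laplacian_eq_lap, ← laplacian_eq_lap, ← laplacian_eq_lap]
    exact hf.laplacian_add hg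
  simp only [wlap, h1, h2, add_apply]
  ring

theorem wlap_const_mul {e : V} {b : ℝ} {f : V → ℝ} {z : V} (c : ℝ) (hf : ContDiffAt ℝ 2 f z) :
    wlap e b (fun w => c * f w) z = c * wlap e b f z := by
  have h1 : fderiv ℝ (fun w => c * f w) z = c • fderiv ℝ f z :=
    fderiv_const_mul (hf.differentiableAt (by norm_num)) c
  have h2 : lap (fun w => c * f w) z = c * lap f z := by
    rw [← laplacian_eq_lap, ← laplacian_eq_lap]
    exact laplacian_smul c hf
  simp only [wlap, h1, h2, smul_apply, smul_eq_mul]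
  ring

theorem wlap_sub {e : V} {b : ℝ} {f g : V → ℝ} {z : V} (hf : ContDiffAt ℝ 2 f z)
    (hg : ContDiffAt ℝ 2 g z) :
    wlap e b (fun w => f w - g w) z = wlap e b f z - wlap e b g z := by
  have h := wlap_add (e := e) (b := b) hf (contDiffAt_const (c := (-1 : ℝ)) |>.mul hg)
  rw [wlap_const_mul (-1) hg] at h
  simpa [sub_eq_add_neg] using h

theorem wlap_const (e : V) (b c : ℝ) (z : V) : wlap e b (fun _ => c) z = 0 := by
  simp [wlap, lap]

theorem wlap_congr {e : V} {b : ℝ} {f g : V → ℝ} {z : V} (h : f =ᶠ[𝓝 z] g) :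
    wlap e b f z = wlap e b g z := by
  simp only [wlap, lap, h.fderiv_eq, h.fderiv.fderiv_eq]

theorem sum_inner_sq (z : V) :
    ∑ i, inner ℝ z (stdOrthonormalBasis ℝ V i) ^ 2 = ‖z‖ ^ 2 := by
  have := (stdOrthonormalBasis ℝ V).sum_sq_norm_inner_left z
  simpa [Real.norm_eq_abs, sq_abs] using this

theorem wlap_radial {e : V} {b : ℝ} {g g' : ℝ → ℝ} {g'' : ℝ} {p z : V}
    (hg : ContDiffAt ℝ 2 g (‖z - p‖ ^ 2))
    (h1 : ∀ᶠ q in 𝓝 (‖z - p‖ ^ 2), HasDerivAt g (g' q) q)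
    (h2 : HasDerivAt g' g'' (‖z - p‖ ^ 2)) :
    wlap e b (fun w => g (‖w - p‖ ^ 2)) z
      = 4 * ‖z - p‖ ^ 2 * g'' + 2 * finrank ℝ V * g' (‖z - p‖ ^ 2)
        + b / inner ℝ e z * (2 * g' (‖z - p‖ ^ 2) * inner ℝ (z - p) e) := by
  have hc := radial_contDiffAt hg
  have key : ∀ v : V, ∀ᶠ t in 𝓝 (0 : ℝ), HasDerivAt (fun t : ℝ => g (‖z + t • v - p‖ ^ 2))
      (g' (‖(z - p) + t • v‖ ^ 2) * (2 * inner ℝ (z - p) v + 2 * t * ‖v‖ ^ 2)) t := by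
    intro v
    have hct : Tendsto (fun t : ℝ => ‖(z - p) + t • v‖ ^ 2) (𝓝 0) (𝓝 (‖z - p‖ ^ 2)) := by
      have := (hasDerivAt_normSq_line (z - p) v 0).continuousAt.tendsto
      simpa using this
    filter_upwards [hct.eventually h1] with t ht
    have := ht.comp t (hasDerivAt_normSq_line (z - p) v t)
    refine this.congr_of_eventuallyEq (Eventually.of_forall fun τ => ?_)
    simp only [Function.comp]
    congr 3
    abel
  have d1 : fderiv ℝ (fun w => g (‖w - p‖ ^ 2)) z e
      = 2 * g' (‖z - p‖ ^ 2) * inner ℝ (z - p) e := by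
    rw [fderiv_eq_of_line hc (key e).self_of_nhds]
    simp; ring
  have d2 : ∀ v : V, fderiv ℝ (fderiv ℝ (fun w => g (‖w - p‖ ^ 2))) z v v
      = 4 * g'' * inner ℝ (z - p) v ^ 2 + 2 * g' (‖z - p‖ ^ 2) * ‖v‖ ^ 2 := by
    intro v
    apply fderiv_fderiv_eq_of_line hc (key v)
    have a1 : HasDerivAt (fun t : ℝ => g' (‖(z - p) + t • v‖ ^ 2))
        (g'' * (2 * inner ℝ (z - p) v + 2 * 0 * ‖v‖ ^ 2)) 0 := by
      have h2' : HasDerivAt g' g'' (‖(z - p) + (0 : ℝ) • v‖ ^ 2) := by simpa using h2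
      exact h2'.comp 0 (hasDerivAt_normSq_line (z - p) v 0)
    have a2 : HasDerivAt (fun t : ℝ => 2 * inner ℝ (z - p) v + 2 * t * ‖v‖ ^ 2) (2 * ‖v‖ ^ 2) 0 := by
      have := (((hasDerivAt_id (0 : ℝ)).const_mul 2).mul_const (‖v‖ ^ 2)).const_add
        (2 * inner ℝ (z - p) v)
      simpa using this
    have := a1.mul a2
    refine this.congr_deriv ?_
    simp; ring
  simp only [wlap, lap, d1, d2, Finset.sum_add_distrib, ← Finset.mul_sum, sum_inner_sq]
  simp
  ring

theorem wlap_height {e : V} (he : ‖e‖ = 1) {b : ℝ} {g g' : ℝ → ℝ} {g'' : ℝ} {z : V}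
    (hg : ContDiffAt ℝ 2 g (inner ℝ e z))
    (h1 : ∀ᶠ q in 𝓝 (inner ℝ e z), HasDerivAt g (g' q) q)
    (h2 : HasDerivAt g' g'' (inner ℝ e z)) :
    wlap e b (fun w => g (inner ℝ e w)) z = g'' + b / inner ℝ e z * g' (inner ℝ e z) := by
  have hc : ContDiffAt ℝ 2 (fun w => g (inner ℝ e w)) z :=
    hg.comp z (contDiffAt_const.inner ℝ contDiffAt_id)
  have hl : ∀ (v : V) (t : ℝ),
      HasDerivAt (fun τ : ℝ => inner ℝ e (z + τ • v)) (inner ℝ e v) t := by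
    intro v t
    have := ((hasDerivAt_id t).mul_const (inner ℝ e v)).const_add (inner ℝ e z)
    simpa [inner_add_right, inner_smul_right] using this
  have key : ∀ v : V, ∀ᶠ t in 𝓝 (0 : ℝ), HasDerivAt (fun t : ℝ => g (inner ℝ e (z + t • v)))
      (g' (inner ℝ e (z + t • v)) * inner ℝ e v) t := by
    intro v
    have hct : Tendsto (fun t : ℝ => inner ℝ e (z + t • v)) (𝓝 0) (𝓝 (inner ℝ e z)) := by
      have := (hl v 0).continuousAt.tendsto
      simpa using this
    filter_upwards [hct.eventually h1] with t ht
    exact ht.comp t (hl v t)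
  have d1 : fderiv ℝ (fun w => g (inner ℝ e w)) z e = g' (inner ℝ e z) := by
    rw [fderiv_eq_of_line hc (key e).self_of_nhds]
    simp [he]
  have d2 : ∀ v : V, fderiv ℝ (fderiv ℝ (fun w => g (inner ℝ e w))) z v v
      = g'' * inner ℝ e v ^ 2 := by
    intro v
    apply fderiv_fderiv_eq_of_line hc (key v)
    have h2' : HasDerivAt g' g'' (inner ℝ e (z + (0 : ℝ) • v)) := by simpa using h2
    have := (h2'.comp 0 (hl v 0)).mul_const (inner ℝ e v)
    refine this.congr_deriv ?_
    ring
  simp only [wlap, lap, d1, d2, ← Finset.mul_sum, sum_inner_sq, he]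
  ring

end Operator

/-! ### Inversion and the derivatives of the Kelvin transform. -/

section Kelvin

variable {V : Type*} [NormedAddCommGroup V] [InnerProductSpace ℝ V]

/-- Inversion in the sphere of radius `ρ` centred at the origin. -/
def sphereInv (ρ : ℝ) (z : V) : V := (ρ ^ 2 / ‖z‖ ^ 2) • z

/-- The Kelvin transform with weight exponent `m`. -/
def kelvin (m ρ : ℝ) (u : V → ℝ) (z : V) : ℝ := (ρ ^ 2 / ‖z‖ ^ 2) ^ m * u (sphereInv ρ z)

theorem norm_sphereInv_sq {ρ : ℝ} {z : V} (hz : z ≠ 0) :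
    ‖sphereInv ρ z‖ ^ 2 = (ρ ^ 2) ^ 2 / ‖z‖ ^ 2 := by
  have : ‖z‖ ≠ 0 := norm_ne_zero_iff.2 hz
  rw [sphereInv, norm_smul, mul_pow, Real.norm_eq_abs, sq_abs]
  field_simp

theorem norm_sphereInv {ρ : ℝ} {z : V} (hz : z ≠ 0) : ‖sphereInv ρ z‖ = ρ ^ 2 / ‖z‖ := by
  have h0 : ‖z‖ ≠ 0 := norm_ne_zero_iff.2 hz
  rw [sphereInv, norm_smul, Real.norm_eq_abs, abs_of_nonneg (by positivity)]
  field_simp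

theorem inner_sphereInv (e : V) (ρ : ℝ) (z : V) :
    inner ℝ e (sphereInv ρ z) = ρ ^ 2 / ‖z‖ ^ 2 * inner ℝ e z := by
  rw [sphereInv, inner_smul_right]

theorem sphereInv_sphereInv {ρ : ℝ} (hρ : 0 < ρ) {z : V} (hz : z ≠ 0) :
    sphereInv ρ (sphereInv ρ z) = z := by
  have : ‖z‖ ≠ 0 := norm_ne_zero_iff.2 hz
  have h := norm_sphereInv_sq (ρ := ρ) hz
  rw [sphereInv, h, sphereInv, smul_smul]
  rw [show ρ ^ 2 / ((ρ ^ 2) ^ 2 / ‖z‖ ^ 2) * (ρ ^ 2 / ‖z‖ ^ 2) = 1 by field_simp, one_smul]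

theorem sphereInv_contDiffAt {ρ : ℝ} {z : V} (hz : z ≠ 0) : ContDiffAt ℝ 2 (sphereInv ρ : V → V) z := by
  have h0 : ‖z‖ ^ 2 ≠ 0 := pow_ne_zero _ (norm_ne_zero_iff.2 hz)
  exact (contDiffAt_const.div (contDiffAt_id.norm_sq ℝ) h0).smul contDiffAt_id

theorem sphereInv_continuousOn (ρ : ℝ) : ContinuousOn (sphereInv ρ : V → V) {0}ᶜ :=
  fun _ hz => (sphereInv_contDiffAt hz).continuousAt.continuousWithinAt

theorem kelvin_contDiffAt {m ρ : ℝ} (hρ : 0 < ρ) {u : V → ℝ} {z : V} (hz : z ≠ 0)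
    (hu : ContDiffAt ℝ 2 u (sphereInv ρ z)) : ContDiffAt ℝ 2 (kelvin m ρ u) z := by
  have h0 : ‖z‖ ^ 2 ≠ 0 := pow_ne_zero _ (norm_ne_zero_iff.2 hz)
  refine ContDiffAt.mul ?_ (hu.comp z (sphereInv_contDiffAt hz))
  exact (contDiffAt_const.div (contDiffAt_id.norm_sq ℝ) h0).rpow_const_of_ne
    (show ρ ^ 2 / ‖z‖ ^ 2 ≠ 0 by positivity)

/-- Along `t ↦ z + t v` the transform is `κ(t)^m u(κ(t)(z + t v))` with `κ(t) = ρ²/‖z + t v‖²`,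
which is differentiated twice at `t = 0`. The explicit form is what gets summed over an orthonormal
basis. -/
theorem kelvin_line {m ρ : ℝ} (hρ : 0 < ρ) {u : V → ℝ} {z : V} (hz : z ≠ 0)
    (hu : ContDiffAt ℝ 2 u (sphereInv ρ z)) (v : V) :
    fderiv ℝ (kelvin m ρ u) z v = (ρ ^ 2 / ‖z‖ ^ 2) ^ m *
      (-2 * m * inner ℝ z v / ‖z‖ ^ 2 * u (sphereInv ρ z)
        + fderiv ℝ u (sphereInv ρ z) ((ρ ^ 2 / ‖z‖ ^ 2) • v
          - (2 * (ρ ^ 2 / ‖z‖ ^ 2) * inner ℝ z v / ‖z‖ ^ 2) • z)) ∧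
    fderiv ℝ (fderiv ℝ (kelvin m ρ u)) z v v = (ρ ^ 2 / ‖z‖ ^ 2) ^ m *
      ((4 * m * (m + 1) * inner ℝ z v ^ 2 / (‖z‖ ^ 2) ^ 2 - 2 * m * ‖v‖ ^ 2 / ‖z‖ ^ 2)
          * u (sphereInv ρ z)
        - 4 * m * inner ℝ z v / ‖z‖ ^ 2 * fderiv ℝ u (sphereInv ρ z) ((ρ ^ 2 / ‖z‖ ^ 2) • v
          - (2 * (ρ ^ 2 / ‖z‖ ^ 2) * inner ℝ z v / ‖z‖ ^ 2) • z)
        + fderiv ℝ (fderiv ℝ u) (sphereInv ρ z) ((ρ ^ 2 / ‖z‖ ^ 2) • v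
          - (2 * (ρ ^ 2 / ‖z‖ ^ 2) * inner ℝ z v / ‖z‖ ^ 2) • z) ((ρ ^ 2 / ‖z‖ ^ 2) • v
          - (2 * (ρ ^ 2 / ‖z‖ ^ 2) * inner ℝ z v / ‖z‖ ^ 2) • z)
        + fderiv ℝ u (sphereInv ρ z)
          ((ρ ^ 2 / ‖z‖ ^ 2 * (8 * inner ℝ z v ^ 2 / (‖z‖ ^ 2) ^ 2 - 2 * ‖v‖ ^ 2 / ‖z‖ ^ 2)) • z
            - (4 * (ρ ^ 2 / ‖z‖ ^ 2) * inner ℝ z v / ‖z‖ ^ 2) • v)) := by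
  have hc := kelvin_contDiffAt (m := m) hρ hz hu
  have hz0 : ‖z‖ ≠ 0 := norm_ne_zero_iff.2 hz
  set q : ℝ → ℝ := fun t => ‖z + t • v‖ ^ 2 with hq
  set q' : ℝ → ℝ := fun t => 2 * inner ℝ z v + 2 * t * ‖v‖ ^ 2 with hq'
  have dq : ∀ t, HasDerivAt q (q' t) t := hasDerivAt_normSq_line z v
  have dq' : HasDerivAt q' (2 * ‖v‖ ^ 2) 0 := by
    have := (((hasDerivAt_id (0 : ℝ)).const_mul 2).mul_const (‖v‖ ^ 2)).const_add
      (2 * inner ℝ z v)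
    exact this.congr_deriv (by simp)
  have q0 : q 0 = ‖z‖ ^ 2 := by simp [hq]
  have q'0 : q' 0 = 2 * inner ℝ z v := by simp [hq']
  have hqne : ∀ᶠ t in 𝓝 (0 : ℝ), q t ≠ 0 :=
    (dq 0).continuousAt.eventually_ne (by rw [q0]; positivity)
  set κ : ℝ → ℝ := fun t => ρ ^ 2 / q t with hκ
  set κ' : ℝ → ℝ := fun t => -(ρ ^ 2 * q' t) / q t ^ 2 with hκ'
  have dκ : ∀ᶠ t in 𝓝 (0 : ℝ), HasDerivAt κ (κ' t) t := by
    filter_upwards [hqne] with t ht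
    have := (hasDerivAt_const t (ρ ^ 2)).div (dq t) ht
    refine this.congr_deriv ?_
    simp [hκ']
  have κ0 : κ 0 = ρ ^ 2 / ‖z‖ ^ 2 := by simp [hκ, q0]
  have κ'0 : κ' 0 = -(2 * (ρ ^ 2 / ‖z‖ ^ 2) * inner ℝ z v / ‖z‖ ^ 2) := by
    simp only [hκ', q0, q'0]; field_simp
  have κpos : 0 < κ 0 := by rw [κ0]; positivity
  set κ'' : ℝ := ρ ^ 2 / ‖z‖ ^ 2 * (8 * inner ℝ z v ^ 2 / (‖z‖ ^ 2) ^ 2 - 2 * ‖v‖ ^ 2 / ‖z‖ ^ 2)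
    with hκ''
  have dκ' : HasDerivAt κ' κ'' 0 := by
    have := ((dq'.const_mul (ρ ^ 2)).neg).div ((dq 0).pow 2) (pow_ne_zero 2 hqne.self_of_nhds)
    refine this.congr_deriv ?_
    simp only [hκ'', q0, q'0, Pi.pow_apply, Pi.neg_apply]
    field_simp
    ring
  have hκne : ∀ᶠ t in 𝓝 (0 : ℝ), κ t ≠ 0 := dκ.self_of_nhds.continuousAt.eventually_ne κpos.ne'
  set γ : ℝ → V := fun t => κ t • (z + t • v) with hγ
  set γ' : ℝ → V := fun t => κ t • v + κ' t • (z + t • v) with hγ'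
  have dγ : ∀ᶠ t in 𝓝 (0 : ℝ), HasDerivAt γ (γ' t) t := by
    filter_upwards [dκ] with t ht using ht.smul (hasDerivAt_line z v t)
  have dγ' : HasDerivAt γ' (κ'' • z + (2 * κ' 0) • v) 0 := by
    have := (dκ.self_of_nhds.smul_const v).add (dκ'.smul (hasDerivAt_line z v 0))
    refine this.congr_deriv ?_
    simp only [zero_smul, add_zero, two_mul, add_smul]
    abel
  have γ0 : γ 0 = sphereInv ρ z := by simp [hγ, κ0, sphereInv]
  have γ'0 : γ' 0 = (ρ ^ 2 / ‖z‖ ^ 2) • v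
      - (2 * (ρ ^ 2 / ‖z‖ ^ 2) * inner ℝ z v / ‖z‖ ^ 2) • z := by
    simp only [hγ', κ0, κ'0, zero_smul, add_zero, neg_smul, sub_eq_add_neg]
  have hu' : ContDiffAt ℝ 2 u (γ 0) := by rwa [γ0]
  have du := eventually_hasDerivAt_comp hu' dγ
  have ddu := hasDerivAt_fderiv_comp hu' dγ.self_of_nhds dγ'
  set k : ℝ → ℝ := fun t => κ t ^ m with hk
  set k' : ℝ → ℝ := fun t => κ' t * m * κ t ^ (m - 1) with hk'
  have dk : ∀ᶠ t in 𝓝 (0 : ℝ), HasDerivAt k (k' t) t := by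
    filter_upwards [dκ, hκne] with t h1 h2 using h1.rpow_const (Or.inl h2)
  have dk' : HasDerivAt k' (κ'' * m * κ 0 ^ (m - 1)
      + κ' 0 * m * (κ' 0 * (m - 1) * κ 0 ^ (m - 1 - 1))) 0 := by
    exact (dκ'.mul_const m).mul (dκ.self_of_nhds.rpow_const (Or.inl κpos.ne'))
  have e1 : κ 0 ^ (m - 1) = κ 0 ^ m / κ 0 := Real.rpow_sub_one κpos.ne' m
  have e2 : κ 0 ^ (m - 1 - 1) = κ 0 ^ m / κ 0 / κ 0 := by
    rw [Real.rpow_sub_one κpos.ne', e1]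
  have key : ∀ᶠ t in 𝓝 (0 : ℝ), HasDerivAt (fun t : ℝ => kelvin m ρ u (z + t • v))
      (k' t * u (γ t) + k t * fderiv ℝ u (γ t) (γ' t)) t := by
    filter_upwards [dk, du] with t h1 h2 using h1.mul h2
  have key2 := (dk'.mul du.self_of_nhds).add (dk.self_of_nhds.mul ddu)
  constructor
  · rw [fderiv_eq_of_line hc key.self_of_nhds]
    simp only [hk, hk', e1, γ0, γ'0, κ'0]
    rw [κ0]
    generalize fderiv ℝ u (sphereInv ρ z) _ = Z
    field_simp
  · rw [fderiv_fderiv_eq_of_line hc key key2]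
    simp only [hk, hk', e1, e2, γ0, γ'0, κ'0]
    have e3 : (2 * -(2 * (ρ ^ 2 / ‖z‖ ^ 2) * inner ℝ z v / ‖z‖ ^ 2)) • v
      = -((4 * (ρ ^ 2 / ‖z‖ ^ 2) * inner ℝ z v / ‖z‖ ^ 2) • v) := by
      rw [← neg_smul]; congr 1; ring
    rw [e3, ← sub_eq_add_neg, κ0]
    generalize fderiv ℝ (fderiv ℝ u) (sphereInv ρ z) _ _ = X
    generalize fderiv ℝ u (sphereInv ρ z) (κ'' • z - _) = Y
    generalize fderiv ℝ u (sphereInv ρ z) _ = Z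
    rw [hκ'']
    field_simp
    ring

end Kelvin

/-! ### Conformal covariance of the operator. -/

section KelvinOperator

variable {V : Type*} [NormedAddCommGroup V] [InnerProductSpace ℝ V] [FiniteDimensional ℝ V]

theorem sum_inner_mul_apply (z : V) (l : V →L[ℝ] ℝ) :
    ∑ i, inner ℝ z (stdOrthonormalBasis ℝ V i) * l (stdOrthonormalBasis ℝ V i) = l z := by
  conv_rhs => rw [← (stdOrthonormalBasis ℝ V).sum_repr' z]
  simp [map_sum, real_inner_comm]

/-- The terms in `u` and in `∇u · z` arising from the Laplacian and from the drift all carry the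
factor `2m + 2 - (dim V + b)`, so this choice of `m` cancels them. The drift survives with the right
weight because inversion multiplies the height by `ρ²/‖z‖²`. -/
theorem wlap_kelvin {e : V} {b m ρ : ℝ} (hm : (finrank ℝ V : ℝ) + b = 2 * m + 2)
    (hρ : 0 < ρ) {u : V → ℝ} {z : V} (hs : inner ℝ e z ≠ 0)
    (hu : ContDiffAt ℝ 2 u (sphereInv ρ z)) :
    wlap e b (kelvin m ρ u) z = (ρ ^ 2 / ‖z‖ ^ 2) ^ (m + 2) * wlap e b u (sphereInv ρ z) := by
  have hz : z ≠ 0 := by rintro rfl; simp at hs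
  have hz0 : ‖z‖ ≠ 0 := norm_ne_zero_iff.2 hz
  have hk := kelvin_line (m := m) hρ hz hu
  have hK : 0 < ρ ^ 2 / ‖z‖ ^ 2 := by positivity
  have hL : lap (kelvin m ρ u) z = (ρ ^ 2 / ‖z‖ ^ 2) ^ m *
      ((4 * m * (m + 1) / ‖z‖ ^ 2 - 2 * m * finrank ℝ V / ‖z‖ ^ 2) * u (sphereInv ρ z)
      + (4 * m + 4 - 2 * finrank ℝ V) * (ρ ^ 2 / ‖z‖ ^ 2) / ‖z‖ ^ 2 * fderiv ℝ u (sphereInv ρ z) z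
      + (ρ ^ 2 / ‖z‖ ^ 2) ^ 2 * lap u (sphereInv ρ z)) := by
    have t1 := sum_inner_sq z
    have t2 := sum_inner_mul_apply z (fderiv ℝ u (sphereInv ρ z))
    have t3 := sum_inner_mul_apply z (fderiv ℝ (fderiv ℝ u) (sphereInv ρ z) z)
    have t4 := sum_inner_mul_apply z ((fderiv ℝ (fderiv ℝ u) (sphereInv ρ z)).flip z)
    have t5 : ∑ i : Fin (finrank ℝ V), (1 : ℝ) = finrank ℝ V := by simp
    simp only [lap, (hk _).2, map_sub, map_smul, smul_eq_mul, sub_apply, smul_apply,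
      OrthonormalBasis.norm_eq_one, one_pow, mul_one] at *
    simp only [ContinuousLinearMap.flip_apply] at t4
    rw [← Finset.mul_sum]
    congr 1
    generalize hKK : ρ ^ 2 / ‖z‖ ^ 2 = K at *
    generalize hD : fderiv ℝ u (sphereInv ρ z) = D at *
    generalize hH : fderiv ℝ (fderiv ℝ u) (sphereInv ρ z) = H at *
    generalize hU : u (sphereInv ρ z) = U at *
    have expand : ∀ i : Fin (finrank ℝ V), ∀ v, v = stdOrthonormalBasis ℝ V i →
      (4 * m * (m + 1) * inner ℝ z v ^ 2 / (‖z‖ ^ 2) ^ 2 - 2 * m / ‖z‖ ^ 2) * U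
        - 4 * m * inner ℝ z v / ‖z‖ ^ 2 * (K * D v - 2 * K * inner ℝ z v / ‖z‖ ^ 2 * D z)
        + (K * (K * H v v - 2 * K * inner ℝ z v / ‖z‖ ^ 2 * H z v)
           - 2 * K * inner ℝ z v / ‖z‖ ^ 2 * (K * H v z - 2 * K * inner ℝ z v / ‖z‖ ^ 2 * H z z))
        + (K * (8 * inner ℝ z v ^ 2 / (‖z‖ ^ 2) ^ 2 - 2 / ‖z‖ ^ 2) * D z
          - 4 * K * inner ℝ z v / ‖z‖ ^ 2 * D v)
      = (4 * m * (m + 1) / (‖z‖ ^ 2) ^ 2 * U + 8 * m * K / (‖z‖ ^ 2) ^ 2 * D z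
          + 4 * K ^ 2 / (‖z‖ ^ 2) ^ 2 * H z z + 8 * K / (‖z‖ ^ 2) ^ 2 * D z) * inner ℝ z v ^ 2
        + (- 2 * m / ‖z‖ ^ 2 * U - 2 * K / ‖z‖ ^ 2 * D z) * 1
        + (- (4 * m * K + 4 * K) / ‖z‖ ^ 2) * (inner ℝ z v * D v)
        + K ^ 2 * H v v
        + (- 2 * K ^ 2 / ‖z‖ ^ 2) * (inner ℝ z v * H z v)
        + (- 2 * K ^ 2 / ‖z‖ ^ 2) * (inner ℝ z v * H v z) := by
      intro i v _
      field_simp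
      ring
    rw [Finset.sum_congr rfl fun i _ => expand i _ rfl]
    simp only [Finset.sum_add_distrib, ← Finset.mul_sum, t1, t2, t3, t4, t5]
    field_simp
    ring
  have h2 : (ρ ^ 2 / ‖z‖ ^ 2) ^ (m + 2) = (ρ ^ 2 / ‖z‖ ^ 2) ^ m * (ρ ^ 2 / ‖z‖ ^ 2) ^ 2 := by
    rw [Real.rpow_add hK, Real.rpow_two]
  simp only [wlap]
  rw [hL, (hk e).1, h2, inner_sphereInv]
  simp only [map_sub, map_smul, smul_eq_mul]
  rw [real_inner_comm e z] at *
  have hb : b = 2 * m + 2 - finrank ℝ V := by linarith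
  rw [hb]
  field_simp
  ring

end KelvinOperator

/-! ### A weak maximum principle blind to the hyperplane `{s = 0}`. -/

section MaximumPrinciple

variable {V : Type*} [NormedAddCommGroup V] [InnerProductSpace ℝ V] [FiniteDimensional ℝ V]
variable {e : V} {b m : ℝ}

theorem continuous_height (e : V) : Continuous fun z : V => inner ℝ e z := by fun_prop

theorem finrank_add_pos (hb : 1 < b) : 0 < (finrank ℝ V : ℝ) + b := by positivity

theorem normSq_contDiffAt (p z : V) : ContDiffAt ℝ 2 (fun w : V => ‖w - p‖ ^ 2) z :=
  (contDiffAt_id.sub contDiffAt_const).norm_sq ℝ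

theorem wlap_normSq_sub (p : V) {z : V} (hs : 0 < inner ℝ e z) :
    wlap e b (fun w => ‖w - p‖ ^ 2) z
      = 2 * finrank ℝ V + 2 * b * inner ℝ (z - p) e / inner ℝ e z := by
  have := wlap_radial (e := e) (b := b) (g := fun q => q) (g' := fun _ => 1) (g'' := 0) (p := p)
    (z := z) contDiffAt_id (Eventually.of_forall fun q => hasDerivAt_id q) (hasDerivAt_const _ _)
  rw [this]
  field_simp
  ring

theorem wlap_normSq {z : V} (hs : 0 < inner ℝ e z) :
    wlap e b (fun w => ‖w‖ ^ 2) z = 2 * (finrank ℝ V + b) := by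
  have := wlap_normSq_sub (b := b) (0 : V) hs
  simp only [sub_zero, real_inner_comm e z] at this
  rw [this]
  field_simp

theorem height_rpow_contDiffAt {z : V} (hs : 0 < inner ℝ e z) (c : ℝ) :
    ContDiffAt ℝ 2 (fun w => (inner ℝ e w) ^ c) z :=
  (contDiffAt_const.inner ℝ contDiffAt_id).rpow_const_of_ne hs.ne'

/-- The singular solution: for `b > 1` it tends to infinity at `{s = 0}`, and this is the barrier
that replaces a boundary condition. -/
theorem wlap_height_rpow (he : ‖e‖ = 1) {z : V} (hs : 0 < inner ℝ e z) :
    wlap e b (fun w => (inner ℝ e w) ^ (1 - b)) z = 0 := by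
  rw [wlap_height he (g := fun q => q ^ (1 - b)) (g' := fun q => (1 - b) * q ^ (1 - b - 1))
    (g'' := (1 - b) * ((1 - b - 1) * (inner ℝ e z) ^ (1 - b - 1 - 1)))
    (Real.contDiffAt_rpow_const_of_ne hs.ne') ?_
    ((Real.hasDerivAt_rpow_const (Or.inl hs.ne')).const_mul _)]
  · rw [Real.rpow_sub_one hs.ne' (1 - b - 1)]
    field_simp
    ring
  · filter_upwards [eventually_ne_nhds hs.ne'] with q hq
    exact Real.hasDerivAt_rpow_const (Or.inl hq)

theorem mem_closure_of_line {S : Set V} {z : V} (h : ∀ᶠ t in 𝓝[>] (0 : ℝ), z + t • e ∈ S) :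
    z ∈ closure S := by
  have : Tendsto (fun t : ℝ => z + t • e) (𝓝[>] 0) (𝓝 z) := by
    have h1 := (hasDerivAt_line z e 0).continuousAt.tendsto
    simp only [zero_smul, add_zero] at h1
    exact h1.mono_left nhdsWithin_le_nhds
  exact mem_closure_of_tendsto this h

theorem inner_line (he : ‖e‖ = 1) (z : V) (t : ℝ) :
    inner ℝ e (z + t • e) = inner ℝ e z + t := by
  simp [inner_add_right, inner_smul_right, he]

/-- Weak maximum principle. The set `{s = 0}` is removable for bounded supersolutions,
so no information is required there. -/
theorem nonneg_of_wlap_nonpos (he : ‖e‖ = 1) (hb : 1 < b) {K A : Set V} (hK : IsCompact K)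
    {w : V → ℝ} (hw : ContinuousOn w K)
    (hA : ∀ z ∈ A, 0 < inner ℝ e z → z ∈ interior K ∧ ContDiffAt ℝ 2 w z ∧ wlap e b w z ≤ 0)
    (hB : ∀ z ∈ K, 0 < inner ℝ e z → z ∉ A → 0 ≤ w z) {z : V} (hz : z ∈ K)
    (hcl : z ∈ closure (K ∩ {z | 0 < inner ℝ e z})) : 0 ≤ w z := by
  suffices H : ∀ z ∈ K ∩ {z | 0 < inner ℝ e z}, 0 ≤ w z by
    have h1 : ContinuousWithinAt w (K ∩ {z | 0 < inner ℝ e z}) z :=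
      (hw z hz).mono inter_subset_left
    have := h1.mem_closure_image hcl
    exact closure_minimal (t := Ici 0) (by rintro _ ⟨y, hy, rfl⟩; exact H y hy) isClosed_Ici this
  rintro z₀ ⟨hz0, hs0⟩
  simp only [mem_ofPred_eq] at hs0
  by_contra! hneg
  obtain ⟨C, hC⟩ : ∃ C, ∀ z ∈ K, ‖z‖ ^ 2 ≤ C := by
    obtain ⟨C, hC⟩ := hK.bddAbove_image (f := fun z : V => ‖z‖ ^ 2) (by fun_prop)
    exact ⟨C, fun z hz => hC (mem_image_of_mem _ hz)⟩
  obtain ⟨M, hM⟩ : ∃ M, ∀ z ∈ K, M ≤ w z := by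
    obtain ⟨C, hC⟩ := hK.bddBelow_image hw
    exact ⟨C, fun z hz => hC (mem_image_of_mem _ hz)⟩
  set D := C - ‖z₀‖ ^ 2 + (inner ℝ e z₀) ^ (1 - b) with hD
  have hDpos : 0 < D := by
    have := Real.rpow_pos_of_pos hs0 (1 - b)
    have := hC z₀ hz0
    linarith
  -- With this `ε` the barrier equals `-w z₀ / 2` at `z₀`, so adding it leaves a negative value
  -- there.
  set ε := -w z₀ / (2 * D) with hε
  have hεpos : 0 < ε := by have := neg_pos.2 hneg; positivity
  -- The singular part of the barrier exceeds `-M` at height `δ`, so the perturbed function is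
  -- positive there and its negative minimum lies strictly above.
  obtain ⟨δ, hδ0, hδ1, hδ2⟩ : ∃ δ : ℝ, 0 < δ ∧ δ < inner ℝ e z₀ ∧ -M / ε < δ ^ (1 - b) := by
    have h1 := (tendsto_rpow_neg_nhdsGT_zero (y := 1 - b) (by linarith)).eventually_gt_atTop (-M / ε)
    have h2 : ∀ᶠ δ in 𝓝[>] (0 : ℝ), δ < inner ℝ e z₀ := by
      filter_upwards [Ioo_mem_nhdsGT hs0] with δ hδ using hδ.2
    obtain ⟨δ, h3, h4, h5⟩ := (h1.and (h2.and self_mem_nhdsWithin)).exists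
    exact ⟨δ, h5, h4, h3⟩
  -- The quadratic part makes the operator strictly negative, contradicting an interior minimum; the
  -- power of the height adds nothing to the operator and keeps the minimum off `{s = 0}`.
  set B : V → ℝ := fun z => ε * (C - ‖z‖ ^ 2) + ε * (inner ℝ e z) ^ (1 - b) with hBdef
  set W : V → ℝ := fun z => w z + B z with hW
  set K' := K ∩ {z | δ ≤ inner ℝ e z} with hK'
  have hK'c : IsCompact K' := hK.inter_right (isClosed_le continuous_const (continuous_height e))
  have hWc : ContinuousOn W K' := by
    refine (hw.mono inter_subset_left).add ?_
    refine ContinuousOn.add (by fun_prop) (continuousOn_const.mul ?_)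
    exact (continuous_height e).continuousOn.rpow_const
      fun z hz => Or.inl (lt_of_lt_of_le hδ0 hz.2).ne'
  obtain ⟨z₁, hz1, hmin⟩ := hK'c.exists_isMinOn ⟨z₀, hz0, hδ1.le⟩ hWc
  have hW0 : W z₀ < 0 := by
    have : B z₀ = ε * D := by simp only [hBdef, hD]; ring
    have h2 : ε * D = -w z₀ / 2 := by rw [hε]; field_simp
    simp only [hW, this, h2]
    linarith
  have hW1 : W z₁ < 0 := lt_of_le_of_lt (hmin ⟨hz0, hδ1.le⟩) hW0
  have hC1 := hC z₁ hz1.1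
  have hs1 : 0 < inner ℝ e z₁ := lt_of_lt_of_le hδ0 hz1.2
  have hBpos : 0 ≤ ε * (C - ‖z₁‖ ^ 2) := mul_nonneg hεpos.le (by linarith)
  have hs1' : δ < inner ℝ e z₁ := by
    rcases lt_or_eq_of_le (show δ ≤ inner ℝ e z₁ from hz1.2) with h | h
    · exact h
    · exfalso
      have h3 := hM z₁ hz1.1
      have h4 : -M < ε * δ ^ (1 - b) := by
        rw [div_lt_iff₀ hεpos] at hδ2; linarith
      have : W z₁ = w z₁ + (ε * (C - ‖z₁‖ ^ 2) + ε * δ ^ (1 - b)) := by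
        simp only [hW, hBdef, ← h]
      linarith
  have hrp := Real.rpow_pos_of_pos hs1 (1 - b)
  by_cases hzA : z₁ ∈ A
  · obtain ⟨hint, hcd, hL⟩ := hA z₁ hzA hs1
    have hloc : IsLocalMin W z₁ := by
      have h1 : K' ∈ 𝓝 z₁ := by
        refine inter_mem (mem_interior_iff_mem_nhds.1 hint) ?_
        have : {z | δ < inner ℝ e z} ∈ 𝓝 z₁ :=
          (isOpen_lt continuous_const (continuous_height e)).mem_nhds hs1'
        refine mem_of_superset this fun z hz => ?_
        simp only [mem_ofPred_eq] at hz ⊢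
        exact hz.le
      exact hmin.isLocalMin h1
    have c0 : ContDiffAt ℝ 2 (fun z : V => ‖z‖ ^ 2) z₁ := contDiffAt_id.norm_sq ℝ
    have c1 : ContDiffAt ℝ 2 (fun z : V => C - ‖z‖ ^ 2) z₁ := contDiffAt_const.sub c0
    have c2 := height_rpow_contDiffAt (e := e) hs1 (1 - b)
    have c3 : ContDiffAt ℝ 2 (fun z => ε * (C - ‖z‖ ^ 2)) z₁ := contDiffAt_const.mul c1
    have c4 : ContDiffAt ℝ 2 (fun z => ε * (inner ℝ e z) ^ (1 - b)) z₁ := contDiffAt_const.mul c2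
    have h5 : wlap e b W z₁ = wlap e b w z₁ + (ε * (0 - 2 * (finrank ℝ V + b)) + ε * 0) := by
      rw [hW, wlap_add hcd (c3.add c4), wlap_add c3 c4, wlap_const_mul ε c1,
        wlap_const_mul ε c2, wlap_height_rpow he hs1,
        wlap_sub contDiffAt_const c0, wlap_const, wlap_normSq hs1]
    have h6 := wlap_nonneg_of_isLocalMin (e := e) (b := b) (hcd.add (c3.add c4)) hloc
    have h8 := mul_pos hεpos (finrank_add_pos (V := V) hb)
    change 0 ≤ wlap e b W z₁ at h6
    rw [h5] at h6
    linarith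
  · have := hB z₁ hz1.1 hs1 hzA
    have : W z₁ = w z₁ + (ε * (C - ‖z₁‖ ^ 2) + ε * (inner ℝ e z₁) ^ (1 - b)) := rfl
    have := mul_pos hεpos hrp
    linarith

end MaximumPrinciple

/-! ### Radial barriers, the strong maximum principle and positivity up to the boundary. -/

section Comparison

variable {V : Type*} [NormedAddCommGroup V] [InnerProductSpace ℝ V] [FiniteDimensional ℝ V]
variable {e : V} {b m : ℝ}

theorem isClosed_halfSpace (e : V) : IsClosed {z : V | 0 ≤ inner ℝ e z} :=
  isClosed_le continuous_const (continuous_height e)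

theorem isOpen_halfSpace (e : V) : IsOpen {z : V | 0 < inner ℝ e z} :=
  isOpen_lt continuous_const (continuous_height e)

theorem radial_power_wlap (hm : (finrank ℝ V : ℝ) + b = 2 * m + 2) {r : ℝ} (hr : 0 < r) {z : V}
    (hs : 0 < inner ℝ e z) :
    ContDiffAt ℝ 2 (fun z : V => (r ^ 2 / ‖z‖ ^ 2) ^ m) z ∧
      wlap e b (fun z : V => (r ^ 2 / ‖z‖ ^ 2) ^ m) z = 0 := by
  have hz : z ≠ 0 := by rintro rfl; simp at hs
  have h1 : (fun z : V => (r ^ 2 / ‖z‖ ^ 2) ^ m) = kelvin m r (fun _ => 1) := by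
    ext z; simp [kelvin]
  rw [h1]
  refine ⟨kelvin_contDiffAt hr hz contDiffAt_const, ?_⟩
  rw [wlap_kelvin hm hr hs.ne' contDiffAt_const, wlap_const, mul_zero]

theorem eventually_line_mem {U : Set V} (hU : IsOpen U) {z : V} (hz : z ∈ U) :
    ∀ᶠ t in 𝓝[>] (0 : ℝ), z + t • e ∈ U := by
  have h1 := (hasDerivAt_line z e 0).continuousAt
  have h2 : ∀ᶠ t in 𝓝 (0 : ℝ), z + t • e ∈ U :=
    h1.eventually_mem (hU.mem_nhds (by simpa using hz))
  exact h2.filter_mono nhdsWithin_le_nhds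

theorem norm_le_norm_line (he : ‖e‖ = 1) {z : V} (hs : 0 ≤ inner ℝ e z) {t : ℝ} (ht : 0 ≤ t) :
    ‖z‖ ≤ ‖z + t • e‖ := by
  have := normSq_line z e t
  rw [real_inner_comm, he] at this
  have h2 : ‖z‖ ^ 2 ≤ ‖z + t • e‖ ^ 2 := by
    rw [this]
    have := mul_nonneg ht hs
    nlinarith [sq_nonneg t]
  exact le_of_sq_le_sq h2 (norm_nonneg _)

/-- Comparison with the radial solutions `p (r / |z|) ^ (2 m) + q` on a half annulus. -/
theorem annulus_comparison (he : ‖e‖ = 1) (hb : 1 < b) (hm : (finrank ℝ V : ℝ) + b = 2 * m + 2)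
    {r R : ℝ} (hr : 0 < r) {w : V → ℝ}
    (hw : ContinuousOn w {z | (r ≤ ‖z‖ ∧ ‖z‖ ≤ R) ∧ 0 ≤ inner ℝ e z})
    (hL : ∀ z, r < ‖z‖ → ‖z‖ < R → 0 < inner ℝ e z → ContDiffAt ℝ 2 w z ∧ wlap e b w z ≤ 0)
    {p q : ℝ} (h1 : ∀ z, ‖z‖ = r → 0 < inner ℝ e z → p + q ≤ w z)
    (h2 : ∀ z, ‖z‖ = R → 0 < inner ℝ e z → p * (r ^ 2 / R ^ 2) ^ m + q ≤ w z)
    {z : V} (hz1 : r ≤ ‖z‖) (hz2 : ‖z‖ < R) (hs : 0 ≤ inner ℝ e z) :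
    p * (r ^ 2 / ‖z‖ ^ 2) ^ m + q ≤ w z := by
  set K : Set V := {z | (r ≤ ‖z‖ ∧ ‖z‖ ≤ R) ∧ 0 ≤ inner ℝ e z} with hK
  set A : Set V := {z | (r < ‖z‖ ∧ ‖z‖ < R) ∧ 0 < inner ℝ e z} with hAdef
  have hA : IsOpen A := ((isOpen_lt continuous_const continuous_norm).inter
    (isOpen_lt continuous_norm continuous_const)).inter (isOpen_halfSpace e)
  have hAK : A ⊆ interior K := interior_maximal
    (fun z hz => ⟨⟨hz.1.1.le, hz.1.2.le⟩, le_of_lt hz.2⟩) hA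
  have hKcl : IsClosed K := ((isClosed_le continuous_const continuous_norm).inter
    (isClosed_le continuous_norm continuous_const)).inter (isClosed_halfSpace e)
  have hKc : IsCompact K := by
    refine (isCompact_closedBall (0 : V) R).of_isClosed_subset hKcl fun z hz => ?_
    simpa using hz.1.2
  have hne : ∀ z ∈ K, ‖z‖ ≠ 0 := fun z hz => (lt_of_lt_of_le hr hz.1.1).ne'
  have main := nonneg_of_wlap_nonpos he hb hKc (A := A)
    (w := fun z => w z - (p * (r ^ 2 / ‖z‖ ^ 2) ^ m + q)) ?_ ?_ ?_ (z := z) ⟨⟨hz1, hz2.le⟩, hs⟩ ?_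
  · linarith
  · refine hw.sub ((continuousOn_const.mul (ContinuousOn.rpow_const ?_ ?_)).add continuousOn_const)
    · exact continuousOn_const.div (by fun_prop) fun z hz => pow_ne_zero 2 (hne z hz)
    · intro z hz
      have := hne z hz
      left; positivity
  · intro z hz hs
    obtain ⟨c1, c2⟩ := hL z hz.1.1 hz.1.2 hs
    obtain ⟨c3, c4⟩ := radial_power_wlap (e := e) (b := b) hm hr hs
    have c5 := (contDiffAt_const (c := p)).mul c3
    refine ⟨hAK hz, c1.sub (c5.add contDiffAt_const), ?_⟩
    rw [wlap_sub c1 (c5.add contDiffAt_const), wlap_add c5 contDiffAt_const,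
      wlap_const_mul p c3, c4, wlap_const]
    linarith
  · intro z hz hs hzA
    have : ‖z‖ = r ∨ ‖z‖ = R := by
      by_contra! hcon
      exact hzA ⟨⟨lt_of_le_of_ne hz.1.1 hcon.1.symm, lt_of_le_of_ne hz.1.2 hcon.2⟩, hs⟩
    rcases this with h | h
    · have := h1 z h hs
      rw [h, div_self (by positivity), Real.one_rpow]
      linarith
    · have := h2 z h hs
      rw [h]
      linarith
  · refine mem_closure_of_line (e := e) ?_
    filter_upwards [self_mem_nhdsWithin, eventually_line_mem (e := e)
      (isOpen_lt continuous_norm continuous_const : IsOpen {z : V | ‖z‖ < R}) hz2] with t ht h3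
    have ht' : 0 < t := ht
    have h4 : 0 < inner ℝ e (z + t • e) := by rw [inner_line he]; linarith
    exact ⟨⟨⟨hz1.trans (norm_le_norm_line he hs ht'.le), le_of_lt h3⟩, h4.le⟩, h4⟩

/-- A nonnegative supersolution in an exterior domain decays no faster than `|z| ^ (-2 m)`. -/
theorem exterior_lower_bound (he : ‖e‖ = 1) (hb : 1 < b)
    (hm : (finrank ℝ V : ℝ) + b = 2 * m + 2) (hm0 : 0 < m) {r c : ℝ} (hr : 0 < r) (hc : 0 ≤ c)
    {w : V → ℝ} (hw : ContinuousOn w {z | r ≤ ‖z‖ ∧ 0 ≤ inner ℝ e z})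
    (hpos : ∀ z, r ≤ ‖z‖ → 0 ≤ inner ℝ e z → 0 ≤ w z)
    (hbd : ∀ z, ‖z‖ = r → 0 ≤ inner ℝ e z → c ≤ w z)
    (hL : ∀ z, r < ‖z‖ → 0 < inner ℝ e z → ContDiffAt ℝ 2 w z ∧ wlap e b w z ≤ 0)
    {z : V} (hz : r ≤ ‖z‖) (hs : 0 ≤ inner ℝ e z) : c * (r ^ 2 / ‖z‖ ^ 2) ^ m ≤ w z := by
  have key : ∀ R : ℝ, ‖z‖ < R →
      c * (r ^ 2 / ‖z‖ ^ 2) ^ m + -(c * (r ^ 2 / R ^ 2) ^ m) ≤ w z := by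
    intro R hR
    have hR0 : 0 < R := hr.trans_le (hz.trans hR.le)
    refine annulus_comparison he hb hm hr (hw.mono fun z hz => ⟨hz.1.1, hz.2⟩)
      (fun z h1 _ h3 => hL z h1 h3) ?_ ?_ hz hR hs
    · intro y hy hsy
      have : 0 ≤ c * (r ^ 2 / R ^ 2) ^ m := by positivity
      linarith [hbd y hy hsy.le]
    · intro y hy hsy
      have := hpos y (by rw [hy]; exact hz.trans hR.le) hsy.le
      linarith
  have hlim : Tendsto (fun R : ℝ => c * (r ^ 2 / ‖z‖ ^ 2) ^ m + -(c * (r ^ 2 / R ^ 2) ^ m)) atTop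
      (𝓝 (c * (r ^ 2 / ‖z‖ ^ 2) ^ m + -(c * 0))) := by
    refine tendsto_const_nhds.add (Tendsto.neg (Tendsto.const_mul c ?_))
    have h1 : Tendsto (fun R : ℝ => r ^ 2 / R ^ 2) atTop (𝓝 0) :=
      tendsto_const_nhds.div_atTop (tendsto_pow_atTop (by norm_num))
    have h2 := h1.rpow_const (p := m) (Or.inr hm0.le)
    rwa [Real.zero_rpow hm0.ne'] at h2
  have := le_of_tendsto hlim ((eventually_gt_atTop ‖z‖).mono key)
  simpa using this

/-- Positivity spreads from the centre by Hopf's exponential barrier on an annulus inside the open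
half-space. -/
theorem pos_on_ball (he : ‖e‖ = 1) (hb : 1 < b) {w : V → ℝ} {p : V} {R : ℝ}
    (hs : ∀ z ∈ Metric.closedBall p R, 0 < inner ℝ e z)
    (hw : ∀ z ∈ Metric.closedBall p R, 0 ≤ w z ∧ ContDiffAt ℝ 2 w z ∧ wlap e b w z ≤ 0)
    (hp : 0 < w p) {z : V} (hz : z ∈ Metric.ball p R) : 0 < w z := by
  have hR : 0 < R := Metric.nonempty_ball.1 ⟨z, hz⟩
  have hpK : p ∈ Metric.closedBall p R := Metric.mem_closedBall_self hR.le
  have hsp := hs p hpK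
  obtain ⟨ρ, hρ0, hρ⟩ : ∃ ρ > 0, ∀ z ∈ Metric.closedBall p ρ, w p / 2 < w z := by
    have h1 : ∀ᶠ z in 𝓝 p, w p / 2 < w z :=
      (hw p hpK).2.1.continuousAt.eventually_const_lt (by linarith)
    obtain ⟨ρ, h2, h3⟩ := Metric.nhds_basis_closedBall.eventually_iff.1 h1
    exact ⟨ρ, h2, fun z hz => h3 hz⟩
  by_cases hzρ : ‖z - p‖ ≤ ρ
  · have := hρ z (by simpa [dist_eq_norm] using hzρ)
    linarith
  push Not at hzρ
  have hzR : ‖z - p‖ < R := by simpa [dist_eq_norm] using hz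
  set N : ℝ := finrank ℝ V + b with hN
  have hNpos : 0 < N := finrank_add_pos hb
  -- The Gaussian is a subsolution where `2 a ‖z - p‖²` is at least `dim V + b(z - p)·e / s`. The
  -- last quotient is at most `b` since `p` has positive height, so this rate suffices for `‖z - p‖
  -- ≥ ρ`.
  set a : ℝ := N / (2 * ρ ^ 2) with ha
  have hapos : 0 < a := by positivity
  have ha2 : 2 * ρ ^ 2 * a = N := by rw [ha]; field_simp
  set ψ : V → ℝ := fun z => Real.exp (-a * ‖z - p‖ ^ 2) with hψ
  set K : Set V := {z | ρ ≤ ‖z - p‖ ∧ ‖z - p‖ ≤ R} with hK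
  set A : Set V := {z | ρ < ‖z - p‖ ∧ ‖z - p‖ < R} with hA
  have hcn : Continuous fun z : V => ‖z - p‖ := by fun_prop
  have hAo : IsOpen A := (isOpen_lt continuous_const hcn).inter (isOpen_lt hcn continuous_const)
  have hAK : A ⊆ interior K := interior_maximal (fun z hz => ⟨hz.1.le, hz.2.le⟩) hAo
  have hKcl : IsClosed K := (isClosed_le continuous_const hcn).inter
    (isClosed_le hcn continuous_const)
  have hKb : K ⊆ Metric.closedBall p R := fun z hz => by simpa [dist_eq_norm] using hz.2
  have hKc : IsCompact K := (isCompact_closedBall p R).of_isClosed_subset hKcl hKb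
  have hψc : ∀ z, ContDiffAt ℝ 2 ψ z := fun z =>
    (contDiffAt_const.mul (normSq_contDiffAt p z)).exp
  have hψL : ∀ z ∈ K, 0 ≤ wlap e b ψ z := by
    intro z hz
    have hsz := hs z (hKb hz)
    have hd : ∀ q : ℝ, HasDerivAt (fun q => Real.exp (-a * q)) (-a * Real.exp (-a * q)) q := by
      intro q
      have := ((hasDerivAt_id q).const_mul (-a)).exp
      refine this.congr_deriv ?_
      simp only [id]; ring
    have := wlap_radial (e := e) (b := b) (g := fun q => Real.exp (-a * q))
      (g' := fun q => -a * Real.exp (-a * q)) (p := p) (z := z)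
      (contDiffAt_const.mul contDiffAt_id).exp (Eventually.of_forall hd) ((hd _).const_mul (-a))
    rw [hψ, this]
    set E := Real.exp (-a * ‖z - p‖ ^ 2) with hE
    have hEpos : 0 < E := Real.exp_pos _
    have h1 : b / inner ℝ e z * inner ℝ (z - p) e ≤ b := by
      rw [inner_sub_left, real_inner_comm e z, real_inner_comm e p, div_mul_eq_mul_div,
        div_le_iff₀ hsz]
      nlinarith
    have h2 : ρ ^ 2 ≤ ‖z - p‖ ^ 2 := by
      have := hz.1
      gcongr
    have h3 : 0 ≤ 2 * a * ‖z - p‖ ^ 2 - finrank ℝ V - b / inner ℝ e z * inner ℝ (z - p) e := by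
      nlinarith
    have h4 := mul_nonneg (mul_pos hapos hEpos).le h3
    calc (0 : ℝ) ≤ 2 * (a * E * (2 * a * ‖z - p‖ ^ 2 - finrank ℝ V
          - b / inner ℝ e z * inner ℝ (z - p) e)) := by linarith
      _ = _ := by ring
  set c := w p / 2 with hc
  have hcpos : 0 < c := by positivity
  have main := nonneg_of_wlap_nonpos he hb hKc (A := A)
    (w := fun z => w z - c * (ψ z - Real.exp (-a * R ^ 2))) ?_ ?_ ?_ (z := z)
    ⟨hzρ.le, hzR.le⟩ (subset_closure ⟨⟨hzρ.le, hzR.le⟩, hs z (hKb ⟨hzρ.le, hzR.le⟩)⟩)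
  · have h5 : Real.exp (-a * R ^ 2) < ψ z := by
      rw [hψ, Real.exp_lt_exp]
      have : ‖z - p‖ ^ 2 < R ^ 2 := by gcongr
      nlinarith
    have := mul_pos hcpos (sub_pos.2 h5)
    linarith
  · intro z hz
    exact ((hw z (hKb hz)).2.1.sub (contDiffAt_const.mul
      ((hψc z).sub contDiffAt_const))).continuousAt.continuousWithinAt
  · intro z hz _
    have hzK : z ∈ K := interior_subset (hAK hz)
    obtain ⟨-, c1, c2⟩ := hw z (hKb hzK)
    have c3 := (hψc z).sub (contDiffAt_const (c := Real.exp (-a * R ^ 2)))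
    have c4 := (contDiffAt_const (c := c)).mul c3
    refine ⟨hAK hz, c1.sub c4, ?_⟩
    rw [wlap_sub c1 c4, wlap_const_mul c c3, wlap_sub (hψc z) contDiffAt_const, wlap_const]
    have := mul_nonneg hcpos.le (hψL z hzK)
    linarith
  · intro z hz _ hzA
    have : ‖z - p‖ = ρ ∨ ‖z - p‖ = R := by
      by_contra! hcon
      exact hzA ⟨lt_of_le_of_ne hz.1 hcon.1.symm, lt_of_le_of_ne hz.2 hcon.2⟩
    rcases this with h | h
    · have h6 := hρ z (by simp [dist_eq_norm, h])
      have h7 : ψ z ≤ 1 := Real.exp_le_one_iff.2 (by nlinarith [sq_nonneg ‖z - p‖])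
      have h8 := Real.exp_pos (-a * R ^ 2)
      nlinarith
    · have := (hw z (hKb hz)).1
      simp only [hψ, h]
      linarith

theorem pos_of_isPreconnected (he : ‖e‖ = 1) (hb : 1 < b) {w : V → ℝ} {U : Set V}
    (hU : IsOpen U) (hUc : IsPreconnected U) (hs : ∀ z ∈ U, 0 < inner ℝ e z)
    (hw : ∀ z ∈ U, 0 ≤ w z ∧ ContDiffAt ℝ 2 w z ∧ wlap e b w z ≤ 0)
    {p : V} (hp : p ∈ U) (hwp : 0 < w p) {z : V} (hz : z ∈ U) : 0 < w z := by
  by_contra hcon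
  have hcont : ContinuousOn w U := fun z hz => (hw z hz).2.1.continuousAt.continuousWithinAt
  have hP : IsOpen (U ∩ {z | 0 < w z}) := by
    have := hcont.isOpen_inter_preimage hU (isOpen_Ioi (a := (0 : ℝ)))
    exact this
  -- If a nearby point `x` had `w x > 0`, positivity would spread over a ball about `x` that
  -- contains `y`.
  have hQ : IsOpen (U ∩ {z | w z ≤ 0}) := by
    rw [Metric.isOpen_iff]
    rintro y ⟨hy, hwy⟩
    obtain ⟨ε, hε, hball⟩ := Metric.isOpen_iff.1 hU y hy
    refine ⟨ε / 3, by positivity, fun x hx => ?_⟩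
    have hx' : dist x y < ε / 3 := hx
    have hsub : Metric.closedBall x (ε / 3) ⊆ U := fun v hv => hball (by
      have h1 : dist v x ≤ ε / 3 := hv
      have := dist_triangle v x y
      show dist v y < ε
      linarith)
    refine ⟨hsub (Metric.mem_closedBall_self (by positivity)), ?_⟩
    by_contra hx0
    have hx1 : 0 < w x := not_le.1 hx0
    have := pos_on_ball he hb (fun z hz => hs z (hsub hz)) (fun z hz => hw z (hsub hz)) hx1
      (z := y) (by rw [Metric.mem_ball, dist_comm]; exact hx')
    exact absurd hwy (not_le.2 this)
  obtain ⟨y, -, hy1, hy2⟩ := hUc _ _ hP hQ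
    (fun y hy => by
      rcases lt_or_ge 0 (w y) with h | h
      · exact Or.inl ⟨hy, h⟩
      · exact Or.inr ⟨hy, h⟩)
    ⟨p, hp, hp, hwp⟩ ⟨z, hz, hz, not_lt.1 hcon⟩
  exact not_lt.2 (show w y ≤ 0 from hy2.2) hy1.2

/-- A subsolution that is positive at `p` but, on the spherical part of the half ball, positive only
at heights bounded below, lies below a multiple of `w`. The flat part needs no check, being
removable. -/
theorem pos_at_boundary (he : ‖e‖ = 1) (hb : 1 < b) {w : V → ℝ} {p : V} {R : ℝ} (hR : 0 < R)
    (hsp : inner ℝ e p = 0)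
    (hcont : ContinuousOn w (Metric.closedBall p R ∩ {z | 0 ≤ inner ℝ e z}))
    (hw : ∀ z ∈ Metric.closedBall p R, 0 < inner ℝ e z →
      0 < w z ∧ ContDiffAt ℝ 2 w z ∧ wlap e b w z ≤ 0) : 0 < w p := by
  set N : ℝ := finrank ℝ V + b with hN
  have hNpos : 0 < N := finrank_add_pos hb
  set K : Set V := Metric.closedBall p R ∩ {z | 0 ≤ inner ℝ e z} with hK
  set A : Set V := Metric.ball p R ∩ {z | 0 < inner ℝ e z} with hA
  have hAK : A ⊆ interior K := interior_maximal
    (fun z hz => ⟨Metric.ball_subset_closedBall hz.1,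
      show (0 : ℝ) ≤ inner ℝ e z from le_of_lt (show (0 : ℝ) < inner ℝ e z from hz.2)⟩)
    (Metric.isOpen_ball.inter (isOpen_halfSpace e))
  have hKc : IsCompact K := (isCompact_closedBall p R).inter_right (isClosed_halfSpace e)
  -- On the sphere `‖z - p‖ = R` the barrier below can be positive only inside this set. It is
  -- compact and avoids `{s = 0}`, so `w` has a positive lower bound on it.
  set K1 : Set V := Metric.closedBall p R ∩ {z | R ^ 2 ≤ 2 * N * (inner ℝ e z) ^ 2}
    ∩ {z | 0 ≤ inner ℝ e z} with hK1
  have hK1c : IsCompact K1 := ((isCompact_closedBall p R).inter_right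
    (isClosed_le continuous_const (by fun_prop))).inter_right (isClosed_halfSpace e)
  obtain ⟨c0, hc0, hc1⟩ : ∃ c0, 0 < c0 ∧ ∀ z ∈ K1, c0 ≤ w z := by
    refine hK1c.exists_forall_le' (hcont.mono fun z hz => ⟨hz.1.1, hz.2⟩) fun z hz => ?_
    have h1 : inner ℝ e z ≠ 0 := by
      intro h0
      have : R ^ 2 ≤ 2 * N * (inner ℝ e z) ^ 2 := hz.1.2
      rw [h0] at this
      nlinarith
    exact (hw z hz.1.1 (lt_of_le_of_ne hz.2 h1.symm)).1
  set c := c0 / (N * R ^ 2) with hc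
  have hcpos : 0 < c := by positivity
  have hcN : c * (N * R ^ 2) = c0 := by rw [hc]; field_simp
  have hsle : ∀ z ∈ Metric.closedBall p R, inner ℝ e z ≤ ‖z - p‖ := by
    intro z _
    have h1 : inner ℝ e z = inner ℝ e (z - p) := by rw [inner_sub_right, hsp, sub_zero]
    rw [h1]
    have := real_inner_le_norm e (z - p)
    rwa [he, one_mul] at this
  -- The operator gives `N(2 + 2b) - 2N = 2bN ≥ 0`, and the value at `p` is `R²/2`.
  set ψ : V → ℝ := fun z => N * (inner ℝ e z) ^ 2 + (R ^ 2 / 2 - ‖z - p‖ ^ 2) with hψ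
  have s1 : ∀ z : V, ContDiffAt ℝ 2 (fun z : V => (inner ℝ e z) ^ 2) z := fun z =>
    (contDiffAt_const.inner ℝ contDiffAt_id).pow 2
  have s2 : ∀ z : V, ContDiffAt ℝ 2 (fun z : V => N * (inner ℝ e z) ^ 2) z := fun z =>
    contDiffAt_const.mul (s1 z)
  have s3 : ∀ z : V, ContDiffAt ℝ 2 (fun z : V => R ^ 2 / 2 - ‖z - p‖ ^ 2) z := fun z =>
    contDiffAt_const.sub (normSq_contDiffAt p z)
  have s4 : ∀ z : V, ContDiffAt ℝ 2 ψ z := fun z => (s2 z).add (s3 z)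
  have hψL : ∀ z : V, 0 < inner ℝ e z → 0 ≤ wlap e b ψ z := by
    intro z hs
    rw [hψ, wlap_add (s2 z) (s3 z), wlap_const_mul N (s1 z),
      wlap_sub contDiffAt_const (normSq_contDiffAt p z), wlap_const, wlap_normSq_sub p hs,
      wlap_height he (g := fun q => q ^ 2) (g' := fun q => 2 * q) (g'' := 2)
        (contDiffAt_id.pow 2)
        (Eventually.of_forall fun q => by simpa using hasDerivAt_pow 2 q)
        (by simpa using (hasDerivAt_id (inner ℝ e z)).const_mul (2 : ℝ)),
      inner_sub_left, real_inner_comm e z, real_inner_comm e p, hsp]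
    have h1 : b / inner ℝ e z * (2 * inner ℝ e z) = 2 * b := by field_simp
    have h2 : 2 * b * (inner ℝ e z - 0) / inner ℝ e z = 2 * b := by field_simp; ring
    rw [h1, h2]
    nlinarith
  have main := nonneg_of_wlap_nonpos he hb hKc (A := A)
    (w := fun z => w z - c * ψ z) ?_ ?_ ?_ (z := p)
    ⟨Metric.mem_closedBall_self hR.le, hsp.ge⟩ ?_
  · simp only [hψ, hsp, sub_self, norm_zero] at main
    have : 0 < c * (R ^ 2 / 2) := by positivity
    nlinarith
  · exact hcont.sub fun z _ => (contDiffAt_const.mul (s4 z)).continuousAt.continuousWithinAt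
  · intro z hz hs
    obtain ⟨-, c1, c2⟩ := hw z (Metric.ball_subset_closedBall hz.1) hs
    have c3 := (contDiffAt_const (c := c)).mul (s4 z)
    refine ⟨hAK hz, c1.sub c3, ?_⟩
    rw [wlap_sub c1 c3, wlap_const_mul c (s4 z)]
    have := mul_nonneg hcpos.le (hψL z hs)
    linarith
  · intro z hz hs hzA
    have hzR : ‖z - p‖ = R := by
      have h1 : ‖z - p‖ ≤ R := by simpa [dist_eq_norm] using hz.1
      refine le_antisymm h1 (not_lt.1 fun h2 => hzA ⟨by simpa [dist_eq_norm] using h2, hs⟩)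
    have hw0 := (hw z hz.1 hs).1
    by_cases h3 : R ^ 2 ≤ 2 * N * (inner ℝ e z) ^ 2
    · have h4 := hc1 z ⟨⟨hz.1, h3⟩, hz.2⟩
      have h5 := hsle z hz.1
      rw [hzR] at h5
      have h6 : (inner ℝ e z) ^ 2 ≤ R ^ 2 := by gcongr
      have h7 : ψ z ≤ N * R ^ 2 := by
        simp only [hψ, hzR]
        nlinarith
      nlinarith
    · push Not at h3
      have h7 : ψ z ≤ 0 := by
        simp only [hψ, hzR]
        nlinarith
      nlinarith
  · refine mem_closure_of_line (e := e) ?_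
    filter_upwards [self_mem_nhdsWithin, eventually_line_mem (e := e) Metric.isOpen_ball
      (Metric.mem_ball_self hR)] with t ht h3
    have ht' : 0 < t := ht
    have h4 : 0 < inner ℝ e (p + t • e) := by rw [inner_line he]; linarith
    exact ⟨⟨Metric.ball_subset_closedBall h3, h4.le⟩, h4⟩

/-- Inversion carries the convex half ball onto this exterior domain. -/
theorem isPreconnected_exterior (e : V) {r : ℝ} (hr : 0 < r) :
    IsPreconnected {z : V | r < ‖z‖ ∧ 0 < inner ℝ e z} := by
  have h1 : IsPreconnected {z : V | ‖z‖ < r ∧ 0 < inner ℝ e z} := by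
    have hc : Convex ℝ (Metric.ball (0 : V) r ∩ {z : V | 0 < inner ℝ e z}) :=
      (convex_ball _ _).inter (convex_halfSpace_gt (innerSL ℝ e).isLinear 0)
    have : {z : V | ‖z‖ < r ∧ 0 < inner ℝ e z}
        = Metric.ball (0 : V) r ∩ {z : V | 0 < inner ℝ e z} := by
      ext z; simp
    rw [this]
    exact hc.isPreconnected
  have hne : ∀ z : V, 0 < inner ℝ e z → z ≠ 0 := by rintro z hz rfl; simp at hz
  have himg : {z : V | r < ‖z‖ ∧ 0 < inner ℝ e z}
      = sphereInv r '' {z : V | ‖z‖ < r ∧ 0 < inner ℝ e z} := by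
    ext z
    constructor
    · rintro ⟨hz1, hz2⟩
      have hz := hne z hz2
      have hz0 : 0 < ‖z‖ := norm_pos_iff.2 hz
      refine ⟨sphereInv r z, ⟨?_, ?_⟩, sphereInv_sphereInv hr hz⟩
      · rw [norm_sphereInv hz, div_lt_iff₀ hz0]; nlinarith
      · rw [inner_sphereInv]; positivity
    · rintro ⟨y, ⟨hy1, hy2⟩, rfl⟩
      have hy := hne y hy2
      have hy0 : 0 < ‖y‖ := norm_pos_iff.2 hy
      refine ⟨?_, ?_⟩
      · rw [norm_sphereInv hy, lt_div_iff₀ hy0]; nlinarith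
      · rw [inner_sphereInv]; positivity
  rw [himg]
  exact h1.image _ ((sphereInv_continuousOn r).mono fun z hz => hne z hz.2)

end Comparison

/-! ### Moving spheres: the comparison equation, the start, and the Hopf lemma. -/

section MovingSpheres

variable {V : Type*} [NormedAddCommGroup V] [InnerProductSpace ℝ V] [FiniteDimensional ℝ V]
variable {e : V} {b m α : ℝ} {u : V → ℝ}

/-- Everywhere positive `C²` functions solving `Δu + (b / s) ∂_s u + u ^ α = 0` where `s > 0`. -/
structure IsPosSolution (e : V) (b α : ℝ) (u : V → ℝ) : Prop where
  contDiff : ContDiff ℝ 2 u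
  pos : ∀ z, 0 < u z
  equation : ∀ z, 0 < inner ℝ e z → wlap e b u z = -(u z) ^ α

/-- The Kelvin transform of `u` in the sphere of radius `ρ` lies below `u` outside the sphere. -/
def Below (e : V) (m : ℝ) (u : V → ℝ) (ρ : ℝ) : Prop :=
  ∀ z, ρ ≤ ‖z‖ → 0 ≤ inner ℝ e z → kelvin m ρ u z ≤ u z

/-- Outside the sphere `κ = ρ²/‖z‖² ≤ 1`, so `κ^(m+2) ≤ κ^(mα)`. The Kelvin transform `v` therefore
has operator at least `-v^α`, which is at least `-u^α` wherever `v ≤ u`. -/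
theorem wlap_sub_kelvin_nonpos (hm : (finrank ℝ V : ℝ) + b = 2 * m + 2) (hα : 0 < α)
    (hα2 : m * α ≤ m + 2) (hu : IsPosSolution e b α u) {ρ : ℝ} (hρ : 0 < ρ) {z : V}
    (hz : ρ ≤ ‖z‖) (hs : 0 < inner ℝ e z) (hle : kelvin m ρ u z ≤ u z) :
    ContDiffAt ℝ 2 (fun z => u z - kelvin m ρ u z) z ∧
      wlap e b (fun z => u z - kelvin m ρ u z) z ≤ 0 := by
  have hz0 : z ≠ 0 := by rintro rfl; simp at hs
  have hzn : 0 < ‖z‖ := norm_pos_iff.2 hz0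
  have c1 := hu.contDiff.contDiffAt (x := z)
  have c2 := kelvin_contDiffAt (m := m) hρ hz0 (hu.contDiff.contDiffAt (x := sphereInv ρ z))
  refine ⟨c1.sub c2, ?_⟩
  rw [wlap_sub c1 c2, wlap_kelvin hm hρ hs.ne' hu.contDiff.contDiffAt, hu.equation z hs,
    hu.equation (sphereInv ρ z) (by rw [inner_sphereInv]; positivity)]
  have hK : 0 < ρ ^ 2 / ‖z‖ ^ 2 := by positivity
  have hK1 : ρ ^ 2 / ‖z‖ ^ 2 ≤ 1 := by
    rw [div_le_one (by positivity)]; gcongr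
  have hU := hu.pos (sphereInv ρ z)
  have h1 : (kelvin m ρ u z) ^ α = (ρ ^ 2 / ‖z‖ ^ 2) ^ (m * α) * u (sphereInv ρ z) ^ α := by
    rw [kelvin, Real.mul_rpow (by positivity) hU.le, ← Real.rpow_mul hK.le]
  have h2 : (ρ ^ 2 / ‖z‖ ^ 2) ^ (m + 2) ≤ (ρ ^ 2 / ‖z‖ ^ 2) ^ (m * α) :=
    Real.rpow_le_rpow_of_exponent_ge hK hK1 hα2
  have h3 : (kelvin m ρ u z) ^ α ≤ u z ^ α :=
    Real.rpow_le_rpow (by rw [kelvin]; positivity) hle hα.le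
  have h4 : 0 < u (sphereInv ρ z) ^ α := Real.rpow_pos_of_pos hU α
  rw [h1] at h3
  nlinarith

theorem continuousOn_sub_kelvin (hu : ContDiff ℝ 2 u) {ρ : ℝ} (hρ : 0 < ρ) {S : Set V}
    (hS : ∀ z ∈ S, ρ ≤ ‖z‖) : ContinuousOn (fun z => u z - kelvin m ρ u z) S := fun z hz =>
  (hu.contDiffAt.sub (kelvin_contDiffAt hρ (norm_pos_iff.1 (hρ.trans_le (hS z hz)))
    hu.contDiffAt)).continuousAt.continuousWithinAt

theorem mem_closure_exterior (he : ‖e‖ = 1) {ρ : ℝ} {z : V} (hz : ρ ≤ ‖z‖)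
    (hs : 0 ≤ inner ℝ e z) : z ∈ closure {z : V | ρ < ‖z‖ ∧ 0 < inner ℝ e z} := by
  refine mem_closure_of_line (e := e) ?_
  filter_upwards [self_mem_nhdsWithin] with t ht
  have ht' : 0 < t := ht
  have h4 : 0 < inner ℝ e (z + t • e) := by rw [inner_line he]; linarith
  refine ⟨?_, h4⟩
  have := normSq_line z e t
  rw [real_inner_comm, he] at this
  have h2 : ‖z‖ ^ 2 < ‖z + t • e‖ ^ 2 := by
    rw [this]
    have := mul_nonneg ht'.le hs
    nlinarith [sq_pos_of_pos ht']
  exact hz.trans_lt (lt_of_pow_lt_pow_left₀ 2 (norm_nonneg _) h2)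

/-- The strong maximum principle for `u` minus its Kelvin transform, a nonnegative supersolution on
the connected exterior half-domain. -/
theorem strict_or_eq (he : ‖e‖ = 1) (hb : 1 < b) (hm : (finrank ℝ V : ℝ) + b = 2 * m + 2)
    (hα : 0 < α) (hα2 : m * α ≤ m + 2) (hu : IsPosSolution e b α u) {ρ : ℝ} (hρ : 0 < ρ)
    (hB : Below e m u ρ) :
    (∀ z, ρ < ‖z‖ → 0 ≤ inner ℝ e z → kelvin m ρ u z < u z) ∨
      ∀ z, ρ ≤ ‖z‖ → 0 ≤ inner ℝ e z → kelvin m ρ u z = u z := by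
  set w : V → ℝ := fun z => u z - kelvin m ρ u z with hw
  have hwc : ContinuousOn w {z | ρ ≤ ‖z‖} := continuousOn_sub_kelvin hu.contDiff hρ fun z hz => hz
  have hUo : IsOpen {z : V | ρ < ‖z‖ ∧ 0 < inner ℝ e z} :=
    (isOpen_lt continuous_const continuous_norm).inter (isOpen_halfSpace e)
  have hprop : ∀ z, ρ < ‖z‖ → 0 < inner ℝ e z →
      0 ≤ w z ∧ ContDiffAt ℝ 2 w z ∧ wlap e b w z ≤ 0 := fun z h1 h2 =>
    ⟨sub_nonneg.2 (hB z h1.le h2.le),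
      wlap_sub_kelvin_nonpos hm hα hα2 hu hρ h1.le h2 (hB z h1.le h2.le)⟩
  by_cases h : ∃ p, ρ < ‖p‖ ∧ 0 < inner ℝ e p ∧ kelvin m ρ u p < u p
  · obtain ⟨p, hp1, hp2, hp3⟩ := h
    have hpos : ∀ z, ρ < ‖z‖ → 0 < inner ℝ e z → 0 < w z := fun z h1 h2 =>
      pos_of_isPreconnected he hb hUo (isPreconnected_exterior e hρ) (fun z hz => hz.2)
        (fun z hz => hprop z hz.1 hz.2) (p := p) ⟨hp1, hp2⟩ (sub_pos.2 hp3) ⟨h1, h2⟩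
    refine Or.inl fun z h1 h2 => sub_pos.1 ?_
    rcases lt_or_eq_of_le h2 with h3 | h3
    · exact hpos z h1 h3
    · obtain ⟨R, hR, hball⟩ := Metric.nhds_basis_closedBall.mem_iff.1
        ((isOpen_lt continuous_const continuous_norm : IsOpen {z : V | ρ < ‖z‖}).mem_nhds h1)
      exact pos_at_boundary he hb hR h3.symm (hwc.mono fun y hy => show ρ ≤ ‖y‖ from
        le_of_lt (show ρ < ‖y‖ from hball hy.1))
        fun y hy hs => ⟨hpos y (hball hy) hs, (hprop y (hball hy) hs).2⟩
  · push Not at h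
    refine Or.inr fun z h1 h2 => ?_
    have hcl := mem_closure_exterior he h1 h2
    have hz : ContinuousWithinAt w {z : V | ρ < ‖z‖ ∧ 0 < inner ℝ e z} z :=
      (hwc z h1).mono fun y hy => le_of_lt hy.1
    have h3 := hz.mem_closure_image hcl
    have h4 : w z ∈ ({0} : Set ℝ) := by
      refine closure_minimal ?_ isClosed_singleton h3
      rintro _ ⟨y, hy, rfl⟩
      have := h y hy.1 hy.2
      have := hB y hy.1.le hy.2.le
      simp only [hw, mem_singleton_iff]
      linarith
    have h5 : u z - kelvin m ρ u z = 0 := h4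
    linarith

theorem not_kelvin_eq_of_subcritical (hm : (finrank ℝ V : ℝ) + b = 2 * m + 2) (he : ‖e‖ = 1)
    (hα2 : m * α < m + 2) (hu : IsPosSolution e b α u) {ρ : ℝ} (hρ : 0 < ρ)
    (h : ∀ z, ρ ≤ ‖z‖ → 0 ≤ inner ℝ e z → kelvin m ρ u z = u z) : False := by
  -- Any point of the open half-space outside the sphere would do; here the conformal factor is
  -- `1/4`, and its powers `m + 2 > mα` differ strictly.
  set z : V := (2 * ρ) • e with hz
  have hzn : ‖z‖ = 2 * ρ := by rw [hz, norm_smul, he, Real.norm_eq_abs, abs_of_pos] <;> linarith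
  have hs : 0 < inner ℝ e z := by
    rw [hz, inner_smul_right, real_inner_self_eq_norm_sq, he]; linarith
  have hev : kelvin m ρ u =ᶠ[𝓝 z] u := by
    filter_upwards [(isOpen_halfSpace e).mem_nhds hs,
      (isOpen_lt continuous_const continuous_norm : IsOpen {z : V | ρ < ‖z‖}).mem_nhds
        (show ρ < ‖z‖ by rw [hzn]; linarith)] with y h1 h2
    exact h y (le_of_lt h2) (le_of_lt h1)
  have h1 := wlap_congr (e := e) (b := b) hev
  have hK : ρ ^ 2 / ‖z‖ ^ 2 = 1 / 4 := by rw [hzn]; field_simp; norm_num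
  rw [wlap_kelvin hm hρ hs.ne' hu.contDiff.contDiffAt, hu.equation z hs,
    hu.equation (sphereInv ρ z) (by rw [inner_sphereInv]; positivity), ← hev.self_of_nhds, kelvin, hK] at h1
  have hU := hu.pos (sphereInv ρ z)
  rw [Real.mul_rpow (by positivity) hU.le, ← Real.rpow_mul (by norm_num)] at h1
  have h2 : ((1 : ℝ) / 4) ^ (m + 2) < (1 / 4) ^ (m * α) :=
    Real.rpow_lt_rpow_of_exponent_gt (by norm_num) (by norm_num) hα2
  have h4 : 0 < u (sphereInv ρ z) ^ α := Real.rpow_pos_of_pos hU α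
  nlinarith

/-- The radial derivative of `r ^ m u`, up to a positive factor. -/
def radialDeriv (m : ℝ) (u : V → ℝ) (z : V) : ℝ := m * u z + fderiv ℝ u z z

theorem continuous_radialDeriv (hu : ContDiff ℝ 2 u) : Continuous (radialDeriv m u) := by
  have h1 := hu.continuous
  have h2 := hu.continuous_fderiv (by norm_num)
  exact (continuous_const.mul h1).add (h2.clm_apply continuous_id)

theorem hasDerivAt_ray (hu : ContDiff ℝ 2 u) (z : V) {t : ℝ} (ht : 0 < t) :
    HasDerivAt (fun t : ℝ => t ^ m * u (t • z)) (t ^ (m - 1) * radialDeriv m u (t • z)) t := by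
  have h1 : HasDerivAt (fun t : ℝ => t ^ m) (m * t ^ (m - 1)) t :=
    Real.hasDerivAt_rpow_const (Or.inl ht.ne')
  have h2 : HasDerivAt (fun t : ℝ => t • z) z t := by
    simpa using (hasDerivAt_id t).smul_const z
  have h3 : HasDerivAt (fun t : ℝ => u (t • z)) (fderiv ℝ u (t • z) z) t :=
    (hu.differentiable (by norm_num) _).hasFDerivAt.comp_hasDerivAt t h2
  refine (h1.mul h3).congr_deriv ?_
  rw [radialDeriv, map_smul, smul_eq_mul, Real.rpow_sub_one ht.ne']
  field_simp

theorem ray_le_of_radialDeriv_nonneg (hu : ContDiff ℝ 2 u) {z : V} {κ : ℝ} (hκ : 0 < κ)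
    (hκ1 : κ ≤ 1) (h : ∀ t, κ ≤ t → t ≤ 1 → 0 ≤ radialDeriv m u (t • z)) :
    κ ^ m * u (κ • z) ≤ u z := by
  have hmono : MonotoneOn (fun t : ℝ => t ^ m * u (t • z)) (Icc κ 1) := by
    refine monotoneOn_of_hasDerivWithinAt_nonneg (convex_Icc κ 1)
      (f' := fun t => t ^ (m - 1) * radialDeriv m u (t • z)) ?_ ?_ ?_
    · exact fun t ht =>
        (hasDerivAt_ray hu z (hκ.trans_le ht.1)).continuousAt.continuousWithinAt
    · intro t ht
      rw [interior_Icc] at ht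
      exact (hasDerivAt_ray hu z (hκ.trans ht.1)).hasDerivWithinAt
    · intro t ht
      rw [interior_Icc] at ht
      have := h t ht.1.le ht.2.le
      have := hκ.trans ht.1
      positivity
  have := hmono ⟨le_rfl, hκ1⟩ ⟨hκ1, le_rfl⟩ hκ1
  simpa using this

/-- The Kelvin transform at `z` is `t^m u(t z)` at `t = ρ²/‖z‖² ≤ 1`, so it suffices that this
expression grows up to `t = 1`. This settles the comparison near the sphere, where the difference
degenerates. -/
theorem kelvin_le_of_radialDeriv_nonneg (hu : ContDiff ℝ 2 u) {z : V} {ρ : ℝ} (hρ : 0 < ρ)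
    (hz : ρ ≤ ‖z‖) (hs : 0 ≤ inner ℝ e z)
    (h : ∀ y : V, ρ ^ 2 / ‖z‖ ≤ ‖y‖ → ‖y‖ ≤ ‖z‖ → 0 ≤ inner ℝ e y → 0 ≤ radialDeriv m u y) :
    kelvin m ρ u z ≤ u z := by
  have hz0 : 0 < ‖z‖ := hρ.trans_le hz
  refine ray_le_of_radialDeriv_nonneg hu (by positivity) ?_ fun t ht1 ht2 => ?_
  · rw [div_le_one (by positivity)]; gcongr
  · have ht0 : 0 < t := lt_of_lt_of_le (by positivity) ht1
    refine h _ ?_ ?_ ?_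
    · rw [norm_smul, Real.norm_eq_abs, abs_of_pos ht0]
      calc ρ ^ 2 / ‖z‖ = ρ ^ 2 / ‖z‖ ^ 2 * ‖z‖ := by field_simp
        _ ≤ _ := by gcongr
    · rw [norm_smul, Real.norm_eq_abs, abs_of_pos ht0]
      nlinarith
    · rw [inner_smul_right]; positivity

theorem isCompact_cap (e : V) (r : ℝ) :
    IsCompact {z : V | ‖z‖ = r ∧ 0 ≤ inner ℝ e z} := by
  have h1 : IsCompact {z : V | ‖z‖ = r} := by
    simpa [Metric.sphere, dist_eq_norm] using isCompact_sphere (0 : V) r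
  exact h1.inter_right (isClosed_halfSpace e)

theorem exists_cap_lower_bound {w : V → ℝ} {r : ℝ}
    (hw : ContinuousOn w {z : V | ‖z‖ = r ∧ 0 ≤ inner ℝ e z})
    (hpos : ∀ z, ‖z‖ = r → 0 ≤ inner ℝ e z → 0 < w z) :
    ∃ c, 0 < c ∧ ∀ z, ‖z‖ = r → 0 ≤ inner ℝ e z → c ≤ w z := by
  obtain ⟨c, h1, h2⟩ := (isCompact_cap e r).exists_forall_le' hw fun z hz => hpos z hz.1 hz.2
  exact ⟨c, h1, fun z h3 h4 => h2 z ⟨h3, h4⟩⟩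

theorem wlap_nonpos (hu : IsPosSolution e b α u) {z : V} (hs : 0 < inner ℝ e z) :
    wlap e b u z ≤ 0 := by
  rw [hu.equation z hs]
  have := Real.rpow_pos_of_pos (hu.pos z) α
  linarith

/-- Near the origin `m u + z·∇u` is positive by continuity. Farther out `u ≥ c (r/‖z‖)^(2m)`, while
the transform is at most `M (ρ/‖z‖)^(2m)`, which is smaller for small `ρ`. -/
theorem below_of_small (he : ‖e‖ = 1) (hb : 1 < b) (hm : (finrank ℝ V : ℝ) + b = 2 * m + 2)
    (hm0 : 0 < m) (hu : IsPosSolution e b α u) :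
    ∃ ρ₀ > 0, ∀ ρ, 0 < ρ → ρ ≤ ρ₀ → Below e m u ρ := by
  obtain ⟨r, hr, hG⟩ : ∃ r > 0, ∀ z : V, ‖z‖ ≤ r → 0 < radialDeriv m u z := by
    have h0 : 0 < radialDeriv m u 0 := by
      simp only [radialDeriv, map_zero, add_zero]
      exact mul_pos hm0 (hu.pos 0)
    have h1 := (continuous_radialDeriv (m := m) hu.contDiff).continuousAt.eventually_const_lt h0
    obtain ⟨r, h2, h3⟩ := Metric.nhds_basis_closedBall.eventually_iff.1 h1
    exact ⟨r, h2, fun z hz => h3 (by simpa using hz)⟩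
  obtain ⟨c, hc, hcu⟩ := exists_cap_lower_bound (e := e) (r := r) hu.contDiff.continuous.continuousOn
    fun z _ _ => hu.pos z
  have hext : ∀ z : V, r ≤ ‖z‖ → 0 ≤ inner ℝ e z → c * (r ^ 2 / ‖z‖ ^ 2) ^ m ≤ u z :=
    fun z h1 h2 => exterior_lower_bound he hb hm hm0 hr hc.le hu.contDiff.continuous.continuousOn
      (fun z _ _ => (hu.pos z).le) hcu (fun z _ h3 => ⟨hu.contDiff.contDiffAt, wlap_nonpos hu h3⟩)
      h1 h2
  obtain ⟨M, hM⟩ : ∃ M, ∀ z : V, ‖z‖ ≤ r → u z ≤ M := by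
    obtain ⟨M, hM⟩ := (isCompact_closedBall (0 : V) r).bddAbove_image
      hu.contDiff.continuous.continuousOn
    exact ⟨M, fun z hz => hM (mem_image_of_mem _ (by simpa using hz))⟩
  have hMpos : 0 < M := (hu.pos 0).trans_le (hM 0 (by simpa using hr.le))
  have hlim : Tendsto (fun ρ : ℝ => (ρ ^ 2) ^ m * M) (𝓝 0) (𝓝 0) := by
    have h1 : Tendsto (fun ρ : ℝ => ρ ^ 2) (𝓝 0) (𝓝 0) := by
      simpa using (continuous_pow 2).tendsto (0 : ℝ)
    have h2 := (h1.rpow_const (p := m) (Or.inr hm0.le)).mul_const M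
    rwa [Real.zero_rpow hm0.ne', zero_mul] at h2
  have hev := hlim.eventually_lt_const (show 0 < c * (r ^ 2) ^ m by positivity)
  obtain ⟨δ, hδ, hδ2⟩ := Metric.nhds_basis_closedBall.eventually_iff.1 hev
  refine ⟨min r δ, lt_min hr hδ, fun ρ hρ hρ2 z hz hs => ?_⟩
  have hz0 : 0 < ‖z‖ := hρ.trans_le hz
  rcases le_total ‖z‖ r with h | h
  · exact kelvin_le_of_radialDeriv_nonneg hu.contDiff hρ hz hs
      fun y _ h2 _ => (hG y (h2.trans h)).le
  · have h1 := hext z h hs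
    have h2 : u (sphereInv ρ z) ≤ M := by
      refine hM _ ?_
      rw [norm_sphereInv (norm_pos_iff.1 hz0), div_le_iff₀ hz0]
      have : ρ ≤ r := hρ2.trans (min_le_left _ _)
      nlinarith
    have h3 : (ρ ^ 2) ^ m * M < c * (r ^ 2) ^ m := hδ2 (by
      simpa [abs_of_pos hρ] using hρ2.trans (min_le_right _ _))
    refine le_trans ?_ h1
    rw [kelvin, Real.div_rpow (by positivity) (by positivity),
      Real.div_rpow (by positivity) (by positivity)]
    have h4 : 0 < (‖z‖ ^ 2) ^ m := by positivity
    rw [div_mul_eq_mul_div, mul_div_assoc', div_le_div_iff_of_pos_right h4]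
    have : (ρ ^ 2) ^ m * u (sphereInv ρ z) ≤ (ρ ^ 2) ^ m * M := by gcongr
    linarith

theorem deriv_nonneg_of_right {f : ℝ → ℝ} {f' a : ℝ} (hf : HasDerivAt f f' a)
    (h : ∀ᶠ t in 𝓝[>] a, f a ≤ f t) : 0 ≤ f' := by
  have h1 := (hasDerivAt_iff_tendsto_slope.1 hf).mono_left
    (nhdsWithin_mono a fun t (ht : t ∈ Ioi a) => ne_of_gt ht)
  refine ge_of_tendsto h1 ?_
  filter_upwards [h, self_mem_nhdsWithin] with t h2 h3
  rw [slope_def_field]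
  have : a < t := h3
  exact div_nonneg (by linarith) (by linarith)

/-- Hopf's lemma on the sphere: on the annulus `ρ ≤ ‖y‖ < 2ρ` the difference dominates `c(1 -
(ρ/‖y‖)^(2m))`. At radius `ρ` its derivative along the ray is twice `radialDeriv`, hence at least
`2mc`. -/
theorem radialDeriv_pos_of_strict (he : ‖e‖ = 1) (hb : 1 < b)
    (hm : (finrank ℝ V : ℝ) + b = 2 * m + 2) (hm0 : 0 < m) (hα : 0 < α) (hα2 : m * α ≤ m + 2)
    (hu : IsPosSolution e b α u) {ρ : ℝ} (hρ : 0 < ρ) (hB : Below e m u ρ)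
    (hst : ∀ z, ρ < ‖z‖ → 0 ≤ inner ℝ e z → kelvin m ρ u z < u z)
    {z : V} (hz : ‖z‖ = ρ) (hs : 0 ≤ inner ℝ e z) : 0 < radialDeriv m u z := by
  obtain ⟨c, hc, hcw⟩ := exists_cap_lower_bound (e := e) (r := 2 * ρ)
    (w := fun z => u z - kelvin m ρ u z)
    (continuousOn_sub_kelvin hu.contDiff hρ fun z hz => by rw [hz.1]; linarith)
    fun z h1 h2 => sub_pos.2 (hst z (by rw [h1]; linarith) h2)
  have hcomp : ∀ y : V, ρ ≤ ‖y‖ → ‖y‖ < 2 * ρ → 0 ≤ inner ℝ e y →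
      -c * (ρ ^ 2 / ‖y‖ ^ 2) ^ m + c ≤ u y - kelvin m ρ u y := by
    intro y h1 h2 h3
    refine annulus_comparison he hb hm hρ (w := fun z => u z - kelvin m ρ u z)
      (continuousOn_sub_kelvin hu.contDiff hρ fun z hz => hz.1.1)
      (fun z h1 h2 h3 => wlap_sub_kelvin_nonpos hm hα hα2 hu hρ h1.le h3 (hB z h1.le h3.le))
      ?_ ?_ h1 h2 h3
    · intro z h4 h5
      have := hB z h4.ge h5.le
      linarith
    · intro z h4 h5
      have := hcw z h4 h5.le
      have h6 : 0 ≤ c * (ρ ^ 2 / (2 * ρ) ^ 2) ^ m := by positivity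
      linarith
  have hzne : z ≠ 0 := norm_pos_iff.1 (hz ▸ hρ)
  have hz0 : ‖z‖ ≠ 0 := norm_ne_zero_iff.2 hzne
  -- along the ray through `z` the Kelvin transform at `t z` is `t⁻²ᵐ u (t⁻¹ z)`
  have hk : ∀ t : ℝ, 0 < t → kelvin m ρ u (t • z) = (t⁻¹ ^ 2) ^ m * u (t⁻¹ • z) := by
    intro t ht
    have h1 : ρ ^ 2 / ‖t • z‖ ^ 2 = t⁻¹ ^ 2 := by
      rw [norm_smul, hz, Real.norm_eq_abs, abs_of_pos ht]; field_simp
    rw [kelvin, sphereInv, h1, smul_smul]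
    congr 3
    field_simp
  have d1 : HasDerivAt (fun t : ℝ => u (t • z)) (fderiv ℝ u z z) 1 := by
    have h2 : HasDerivAt (fun t : ℝ => t • z) z 1 := by
      simpa using (hasDerivAt_id (1 : ℝ)).smul_const z
    have h3 : HasFDerivAt u (fderiv ℝ u z) ((1 : ℝ) • z) := by
      rw [one_smul]; exact (hu.contDiff.differentiable (by norm_num) _).hasFDerivAt
    exact h3.comp_hasDerivAt 1 h2
  have dinv : HasDerivAt (fun t : ℝ => t⁻¹) (-1) 1 := by
    simpa using hasDerivAt_inv (one_ne_zero (α := ℝ))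
  have d2 : HasDerivAt (fun t : ℝ => u (t⁻¹ • z)) (-fderiv ℝ u z z) 1 := by
    have d1' : HasDerivAt (fun t : ℝ => u (t • z)) (fderiv ℝ u z z) (1 : ℝ)⁻¹ := by simpa using d1
    have := d1'.comp 1 dinv
    simpa [Function.comp_def] using this
  have d3 : HasDerivAt (fun t : ℝ => (t⁻¹ ^ 2) ^ m) (-2 * m) 1 := by
    have h1 : HasDerivAt (fun t : ℝ => t⁻¹ ^ 2) (-2) 1 := by
      refine (dinv.pow 2).congr_deriv ?_
      simp
    refine (h1.rpow_const (p := m) (Or.inl (by norm_num))).congr_deriv ?_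
    simp
  have d4 := (d1.sub (d3.mul d2)).sub ((d3.const_mul (-c)).add_const c)
  have hnn := deriv_nonneg_of_right d4 ?_
  · simp only [inv_one, one_pow, Real.one_rpow, one_smul] at hnn
    have : 0 < c * m := mul_pos hc hm0
    rw [radialDeriv]
    linarith
  · filter_upwards [Ioo_mem_nhdsGT (show (1 : ℝ) < 2 by norm_num)] with t ht
    have ht0 : 0 < t := by linarith [ht.1]
    have hn : ‖t • z‖ = t * ρ := by rw [norm_smul, hz, Real.norm_eq_abs, abs_of_pos ht0]
    have h1 := hcomp (t • z) (by rw [hn]; nlinarith [ht.1]) (by rw [hn]; nlinarith [ht.2])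
      (by rw [inner_smul_right]; positivity)
    rw [hk t ht0, hn, show ρ ^ 2 / (t * ρ) ^ 2 = t⁻¹ ^ 2 by field_simp] at h1
    simp only [Pi.sub_apply, Pi.mul_apply, inv_one, one_pow, Real.one_rpow, one_smul]
    linarith

end MovingSpheres

/-! ### Continuation of the spheres and the resulting alternative. -/

section MovingSpheresMain

variable {V : Type*} [NormedAddCommGroup V] [InnerProductSpace ℝ V] [FiniteDimensional ℝ V]
variable {e : V} {b m α : ℝ} {u : V → ℝ}

theorem kelvin_eq_div {ρ : ℝ} (z : V) :
    kelvin m ρ u z = (ρ ^ 2) ^ m * u (ρ ^ 2 • ((‖z‖ ^ 2)⁻¹ • z)) / (‖z‖ ^ 2) ^ m := by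
  rw [kelvin, sphereInv, Real.div_rpow (by positivity) (by positivity), smul_smul, div_eq_mul_inv (ρ ^ 2)]
  ring

/-- Openness of the set of admissible radii. The shell around the sphere is handled by the uniform
sign of the radial derivative, the rest by a margin decaying like `‖z‖^(-2m)`, the same rate as the
Kelvin transforms. -/
theorem below_extend (he : ‖e‖ = 1) (hb : 1 < b)
    (hm : (finrank ℝ V : ℝ) + b = 2 * m + 2) (hm0 : 0 < m) (hα : 0 < α) (hα2 : m * α ≤ m + 2)
    (hu : IsPosSolution e b α u) {ρ : ℝ} (hρ : 0 < ρ) (hB : Below e m u ρ)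
    (hst : ∀ z, ρ < ‖z‖ → 0 ≤ inner ℝ e z → kelvin m ρ u z < u z) :
    ∃ δ > 0, ∀ ρ', ρ ≤ ρ' → ρ' < ρ + δ → Below e m u ρ' := by
  -- near the sphere
  obtain ⟨η, hη, hηG⟩ : ∃ η > 0, ∀ z : V, |‖z‖ - ρ| < η → ‖z‖ ≤ 2 * ρ → 0 ≤ inner ℝ e z →
      0 < radialDeriv m u z := by
    set C : Set V := (Metric.closedBall 0 (2 * ρ) ∩ {z | radialDeriv m u z ≤ 0})
      ∩ {z | 0 ≤ inner ℝ e z} with hC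
    have hCc : IsCompact C := ((isCompact_closedBall _ _).inter_right
      (isClosed_le (continuous_radialDeriv hu.contDiff) continuous_const)).inter_right
      (isClosed_halfSpace e)
    obtain ⟨η, h1, h2⟩ := hCc.exists_forall_le' (f := fun z : V => |‖z‖ - ρ|) (a := 0)
      (by fun_prop) fun z hz => by
        refine abs_pos.2 fun h0 => ?_
        have h3 := radialDeriv_pos_of_strict he hb hm hm0 hα hα2 hu hρ hB hst
          (sub_eq_zero.1 h0) hz.2
        exact not_lt.2 (show radialDeriv m u z ≤ 0 from hz.1.2) h3
    refine ⟨η, h1, fun z h3 h4 h5 => ?_⟩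
    by_contra hcon
    exact not_lt.2 (h2 z ⟨⟨by simpa using h4, not_lt.1 hcon⟩, h5⟩) h3
  set η' := min η ρ with hη'
  have hη'0 : 0 < η' := lt_min hη hρ
  have hη'1 : η' ≤ η := min_le_left _ _
  have hη'2 : η' ≤ ρ := min_le_right _ _
  set r := ρ + η' / 2 with hr
  have hr0 : 0 < r := by positivity
  have hρr : ρ < r := by linarith
  -- far from the sphere
  obtain ⟨c, hc, hcw⟩ := exists_cap_lower_bound (e := e) (r := r)
    (w := fun z => u z - kelvin m ρ u z)
    (continuousOn_sub_kelvin hu.contDiff hρ fun z hz => by rw [hz.1]; exact hρr.le)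
    fun z h1 h2 => sub_pos.2 (hst z (by rw [h1]; exact hρr) h2)
  have hfar : ∀ z : V, r ≤ ‖z‖ → 0 ≤ inner ℝ e z →
      c * (r ^ 2 / ‖z‖ ^ 2) ^ m ≤ u z - kelvin m ρ u z := fun z h1 h2 =>
    exterior_lower_bound he hb hm hm0 hr0 hc.le (w := fun z => u z - kelvin m ρ u z)
      (continuousOn_sub_kelvin hu.contDiff hρ fun z hz => hρr.le.trans hz.1)
      (fun z h3 h4 => sub_nonneg.2 (hB z (hρr.le.trans h3) h4)) hcw
      (fun z h3 h4 => wlap_sub_kelvin_nonpos hm hα hα2 hu hρ (hρr.trans h3).le h4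
        (hB z (hρr.trans h3).le h4.le)) h1 h2
  have hcr : 0 < c * (r ^ 2) ^ m := by positivity
  -- After multiplication by `‖z‖^(2m)` and in the variable `y = z/‖z‖²`, the unbounded region lies
  -- in a compact ball, on which the dependence on the radius is uniform.
  have hev : ∀ᶠ σ in 𝓝 ρ, ∀ y ∈ Metric.closedBall (0 : V) (1 / r),
      (σ ^ 2) ^ m * u (σ ^ 2 • y) < (ρ ^ 2) ^ m * u (ρ ^ 2 • y) + c * (r ^ 2) ^ m := by
    refine (isCompact_closedBall (0 : V) (1 / r)).eventually_forall_of_forall_eventually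
      (P := fun σ y => (σ ^ 2) ^ m * u (σ ^ 2 • y)
        < (ρ ^ 2) ^ m * u (ρ ^ 2 • y) + c * (r ^ 2) ^ m) fun y _ => ?_
    have huc := hu.contDiff.continuous
    have h1 : Continuous fun x : ℝ × V => (x.1 ^ 2) ^ m * u (x.1 ^ 2 • x.2) :=
      ((continuous_fst.pow 2).rpow_const fun _ => Or.inr hm0.le).mul
        (huc.comp ((continuous_fst.pow 2).smul continuous_snd))
    have h2 : Continuous fun x : ℝ × V =>
        (ρ ^ 2) ^ m * u (ρ ^ 2 • x.2) + c * (r ^ 2) ^ m :=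
      (continuous_const.mul (huc.comp (continuous_const.smul continuous_snd))).add
        continuous_const
    refine (isOpen_lt h1 h2).mem_nhds ?_
    show (ρ ^ 2) ^ m * u (ρ ^ 2 • y) < (ρ ^ 2) ^ m * u (ρ ^ 2 • y) + c * (r ^ 2) ^ m
    linarith
  obtain ⟨δ, hδ, hδ2⟩ := Metric.nhds_basis_ball.eventually_iff.1 hev
  refine ⟨min δ (η' / 2), lt_min hδ (by positivity), fun σ hσ1 hσ2 z hz hs => ?_⟩
  have hσ0 : 0 < σ := hρ.trans_le hσ1
  have hz0 : 0 < ‖z‖ := hσ0.trans_le hz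
  rcases le_total ‖z‖ r with h | h
  · refine kelvin_le_of_radialDeriv_nonneg hu.contDiff hσ0 hz hs fun y h1 h2 h3 => ?_
    refine (hηG y ?_ ?_ h3).le
    -- Here `σ ≥ ρ`, `‖z‖ ≤ ρ + η'/2` and `(ρ - η')(ρ + η'/2) < ρ²`, so the ray segment stays in the
    -- shell where the radial derivative is positive.
    · have h4 : ρ - η' < σ ^ 2 / ‖z‖ := by
        rw [lt_div_iff₀ hz0]
        have h5 : (ρ - η') * ‖z‖ ≤ (ρ - η') * r :=
          mul_le_mul_of_nonneg_left h (by linarith)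
        nlinarith
      rw [abs_lt]
      constructor <;> linarith
    · linarith
  · have h1 := hfar z h hs
    have hy : (‖z‖ ^ 2)⁻¹ • z ∈ Metric.closedBall (0 : V) (1 / r) := by
      rw [mem_closedBall_zero_iff, norm_smul, norm_inv, Real.norm_eq_abs,
        abs_of_nonneg (by positivity)]
      have : (‖z‖ ^ 2)⁻¹ * ‖z‖ = 1 / ‖z‖ := by field_simp
      rw [this]
      gcongr
    have h2 := hδ2 (show σ ∈ Metric.ball ρ δ by
      rw [Metric.mem_ball, Real.dist_eq, abs_of_nonneg (by linarith)]
      have := min_le_left δ (η' / 2)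
      linarith) _ hy
    have hzm : 0 < (‖z‖ ^ 2) ^ m := by positivity
    rw [kelvin_eq_div] at h1 ⊢
    rw [Real.div_rpow (by positivity) (by positivity)] at h1
    have h3 : (σ ^ 2) ^ m * u (σ ^ 2 • ((‖z‖ ^ 2)⁻¹ • z)) / (‖z‖ ^ 2) ^ m
        ≤ ((ρ ^ 2) ^ m * u (ρ ^ 2 • ((‖z‖ ^ 2)⁻¹ • z)) + c * (r ^ 2) ^ m) / (‖z‖ ^ 2) ^ m := by
      gcongr
    rw [add_div, mul_div_assoc c] at h3
    linarith

/-- The moving sphere alternative at the origin. -/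
theorem below_forall_or_kelvin_eq (he : ‖e‖ = 1) (hb : 1 < b)
    (hm : (finrank ℝ V : ℝ) + b = 2 * m + 2) (hm0 : 0 < m) (hα : 0 < α) (hα2 : m * α ≤ m + 2)
    (hu : IsPosSolution e b α u) :
    (∀ ρ, 0 < ρ → Below e m u ρ) ∨
      ∃ ρ, 0 < ρ ∧ ∀ z, ρ ≤ ‖z‖ → 0 ≤ inner ℝ e z → kelvin m ρ u z = u z := by
  obtain ⟨ρ₀, hρ₀, hsmall⟩ := below_of_small he hb hm hm0 hu
  set S : Set ℝ := {ρ | 0 < ρ ∧ ∀ ρ', 0 < ρ' → ρ' ≤ ρ → Below e m u ρ'} with hS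
  have hne : ρ₀ ∈ S := ⟨hρ₀, hsmall⟩
  by_cases hbd : BddAbove S
  · right
    set ρ := sSup S with hρdef
    have hρ : 0 < ρ := hρ₀.trans_le (le_csSup hbd hne)
    have hlt : ∀ σ, 0 < σ → σ < ρ → Below e m u σ := by
      intro σ h1 h2
      obtain ⟨τ, h3, h4⟩ := exists_lt_of_lt_csSup ⟨ρ₀, hne⟩ h2
      exact h3.2 σ h1 h4.le
    have hB : Below e m u ρ := by
      intro z hz hs
      have hc : Tendsto (fun σ : ℝ => kelvin m σ u z) (𝓝[<] ρ) (𝓝 (kelvin m ρ u z)) := by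
        have : Continuous fun σ : ℝ => kelvin m σ u z := by
          simp only [kelvin, sphereInv]
          exact (((continuous_pow 2).div_const _).rpow_const fun _ => Or.inr hm0.le).mul
            (hu.contDiff.continuous.comp (((continuous_pow 2).div_const _).smul continuous_const))
        exact this.continuousAt.tendsto.mono_left nhdsWithin_le_nhds
      refine le_of_tendsto hc ?_
      filter_upwards [Ioo_mem_nhdsLT hρ] with σ hσ
      exact hlt σ hσ.1 hσ.2 z (hσ.2.le.trans hz) hs
    rcases strict_or_eq he hb hm hα hα2 hu hρ hB with h | h
    · exfalso
      obtain ⟨δ, hδ, h1⟩ := below_extend he hb hm hm0 hα hα2 hu hρ hB h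
      have h2 : ρ + δ / 2 ∈ S := by
        refine ⟨by positivity, fun σ h3 h4 => ?_⟩
        rcases lt_or_ge σ ρ with h5 | h5
        · exact hlt σ h3 h5
        · exact h1 σ h5 (by linarith)
      have := le_csSup hbd h2
      linarith
    · exact ⟨ρ, hρ, h⟩
  · left
    intro ρ hρ
    rw [not_bddAbove_iff] at hbd
    obtain ⟨σ, h1, h2⟩ := hbd ρ
    exact h1.2 ρ hρ h2.le

/-- The sphere of radius `√κ ‖z‖` sends `z` to `κ z`; hence `r^m u` is nondecreasing along rays when
no sphere ever stops. -/
theorem ray_le_of_below (h : ∀ ρ, 0 < ρ → Below e m u ρ) {z : V} (hz : z ≠ 0)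
    (hs : 0 ≤ inner ℝ e z) {κ : ℝ} (hκ : 0 < κ) (hκ1 : κ ≤ 1) : κ ^ m * u (κ • z) ≤ u z := by
  have hz0 : 0 < ‖z‖ := norm_pos_iff.2 hz
  have h1 := h (√κ * ‖z‖) (by positivity) z (by
    have : √κ ≤ 1 := Real.sqrt_le_one.2 hκ1
    nlinarith) hs
  have h2 : (√κ * ‖z‖) ^ 2 / ‖z‖ ^ 2 = κ := by
    rw [mul_pow, Real.sq_sqrt hκ.le]; field_simp
  rwa [kelvin, sphereInv, h2] at h1

theorem radialDeriv_nonneg_of_below (hm0 : 0 < m) (hu : IsPosSolution e b α u)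
    (h : ∀ ρ, 0 < ρ → Below e m u ρ) {z : V} (hs : 0 ≤ inner ℝ e z) : 0 ≤ radialDeriv m u z := by
  by_cases hz : z = 0
  · subst hz
    simp only [radialDeriv, map_zero, add_zero]
    exact (mul_pos hm0 (hu.pos 0)).le
  have hd := hasDerivAt_ray (m := m) hu.contDiff z one_pos
  -- The monotonicity is known for `t ≤ 1` only; reflecting `t` turns this into a one-sided
  -- comparison from the right.
  have hneg : HasDerivAt (fun t : ℝ => (-t) ^ m * u ((-t) • z)) (-radialDeriv m u z) (-1) := by
    have h1 : HasDerivAt (fun t : ℝ => t ^ m * u (t • z)) (radialDeriv m u z) (-(-1 : ℝ)) := by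
      simpa using hd
    have := h1.comp (-1) (hasDerivAt_neg (-1 : ℝ))
    simpa [Function.comp_def] using this
  have := deriv_nonneg_of_right hneg.neg ?_
  · simpa using this
  · filter_upwards [Ioo_mem_nhdsGT (show (-1 : ℝ) < 0 by norm_num)] with t ht
    have := ray_le_of_below h hz hs (κ := -t) (by linarith [ht.2]) (by linarith [ht.1])
    simpa using this

theorem lower_bound_of_below (hu : IsPosSolution e b α u)
    (h : ∀ ρ, 0 < ρ → Below e m u ρ) :
    ∃ c > 0, ∀ z, 1 ≤ ‖z‖ → 0 ≤ inner ℝ e z → c * ‖z‖⁻¹ ^ m ≤ u z := by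
  obtain ⟨c, hc, hcu⟩ := exists_cap_lower_bound (e := e) (r := 1) hu.contDiff.continuous.continuousOn
    fun z _ _ => hu.pos z
  refine ⟨c, hc, fun z hz hs => ?_⟩
  have hz0 : 0 < ‖z‖ := by linarith
  have h1 := ray_le_of_below h (norm_pos_iff.1 hz0) hs (κ := ‖z‖⁻¹) (by positivity)
    (inv_le_one_of_one_le₀ hz)
  have h2 := hcu (‖z‖⁻¹ • z) (by rw [norm_smul]; simp [hz0.ne'])
    (by rw [inner_smul_right]; positivity)
  have h3 : ‖z‖⁻¹ ^ m * c ≤ ‖z‖⁻¹ ^ m * u (‖z‖⁻¹ • z) := by gcongr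
  linarith

end MovingSpheresMain

/-! ### Subcritical nonexistence, and equality with a Kelvin transform at every centre. -/

section Nonexistence

variable {V : Type*} [NormedAddCommGroup V] [InnerProductSpace ℝ V] [FiniteDimensional ℝ V]
variable {e : V} {b m α : ℝ} {u : V → ℝ}

theorem exponent_pos (he : ‖e‖ = 1) (hb : 1 < b) (hm : (finrank ℝ V : ℝ) + b = 2 * m + 2) :
    0 < m := by
  have : Nontrivial V := ⟨e, 0, by rintro rfl; simp at he⟩
  have h1 : (1 : ℝ) ≤ finrank ℝ V := by exact_mod_cast (finrank_pos (R := ℝ) (M := V))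
  linarith

/-- An explicit substitute for the first eigenfunction of a ball. With `x = ρ² - ‖z - p‖²` the
expression is at least `8ρ² - (8 + 4N)x + (2 + N)²x²/ρ²`, a square plus `4ρ²`. -/
theorem wlap_bump_lower_bound (hb : 0 < b) {p z : V} {ρ : ℝ} (hρ : 0 < ρ)
    (hp : 0 < inner ℝ e p) (hz : ‖z - p‖ < ρ) (hs : 0 < inner ℝ e z) :
    0 < wlap e b (fun w => (ρ ^ 2 - ‖w - p‖ ^ 2) ^ 2) z
      + (2 + (finrank ℝ V + b)) ^ 2 / ρ ^ 2 * (ρ ^ 2 - ‖z - p‖ ^ 2) ^ 2 := by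
  have hd : ∀ q : ℝ, HasDerivAt (fun q : ℝ => (ρ ^ 2 - q) ^ 2) (-2 * (ρ ^ 2 - q)) q := by
    intro q
    refine (((hasDerivAt_id q).const_sub (ρ ^ 2)).pow 2).congr_deriv ?_
    simp
  have hd2 : ∀ q : ℝ, HasDerivAt (fun q : ℝ => -2 * (ρ ^ 2 - q)) 2 q := by
    intro q
    refine (((hasDerivAt_id q).const_sub (ρ ^ 2)).const_mul (-2)).congr_deriv ?_
    simp
  rw [wlap_radial (g := fun q : ℝ => (ρ ^ 2 - q) ^ 2) (g' := fun q => -2 * (ρ ^ 2 - q)) (g'' := 2)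
    ((contDiffAt_const.sub contDiffAt_id).pow 2) (Eventually.of_forall hd) (hd2 _)]
  have h1 : b / inner ℝ e z * inner ℝ (z - p) e ≤ b := by
    rw [inner_sub_left, real_inner_comm e z, real_inner_comm e p, div_mul_eq_mul_div,
      div_le_iff₀ hs]
    nlinarith
  set q := ‖z - p‖ ^ 2 with hq
  set x := ρ ^ 2 - q with hx
  have hxpos : 0 < x := by
    have : ‖z - p‖ ^ 2 < ρ ^ 2 := by gcongr
    linarith
  set N : ℝ := finrank ℝ V + b with hN
  have hN0 : 0 ≤ N := by positivity
  have h2 : x * (b / inner ℝ e z * inner ℝ (z - p) e) ≤ x * b := by gcongr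
  have h3 : 4 * q * 2 + 2 * finrank ℝ V * (-2 * x)
      + b / inner ℝ e z * (2 * (-2 * x) * inner ℝ (z - p) e) ≥ 8 * (ρ ^ 2 - x) - 4 * N * x := by
    have : q = ρ ^ 2 - x := by rw [hx]; ring
    rw [this, hN]
    nlinarith
  have h4 : 0 < 8 * ρ ^ 2 - (8 + 4 * N) * x + (2 + N) ^ 2 / ρ ^ 2 * x ^ 2 := by
    have : 8 * ρ ^ 2 - (8 + 4 * N) * x + (2 + N) ^ 2 / ρ ^ 2 * x ^ 2
        = ((2 * ρ - (2 + N) * x / ρ) ^ 2) + 4 * ρ ^ 2 := by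
      field_simp; ring
    rw [this]; positivity
  linarith

/-- There is no positive solution with subcritical exponent. -/
theorem not_isPosSolution_of_subcritical (he : ‖e‖ = 1) (hb : 1 < b)
    (hm : (finrank ℝ V : ℝ) + b = 2 * m + 2) (hα : 1 < α) (hα2 : m * α < m + 2) :
    ¬IsPosSolution e b α u := by
  intro hu
  have hm0 := exponent_pos he hb hm
  have hB : ∀ ρ, 0 < ρ → Below e m u ρ := by
    rcases below_forall_or_kelvin_eq he hb hm hm0 (by linarith) hα2.le hu with h | ⟨ρ, hρ, h⟩
    · exact h
    · exact (not_kelvin_eq_of_subcritical hm he hα2 hu hρ h).elim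
  obtain ⟨c, hc, hcu⟩ := lower_bound_of_below hu hB
  set N : ℝ := finrank ℝ V + b with hN
  -- Subcriticality makes `2 - m(α - 1)` positive, so a large scale exists. The factor `16` comes
  -- from `ρ = X/4`, and `4 ≤ X` keeps the test ball outside the unit ball.
  obtain ⟨X, hX1, hX4⟩ : ∃ X : ℝ, 16 * (2 + N) ^ 2 / c ^ (α - 1) ≤ X ^ (2 - m * (α - 1)) ∧ 4 ≤ X :=
    (((tendsto_rpow_atTop (show 0 < 2 - m * (α - 1) by linarith)).eventually_ge_atTop _).and
      (eventually_ge_atTop 4)).exists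
  have hX0 : 0 < X := by linarith
  have hcα : 0 < c ^ (α - 1) := by positivity
  set R := X / 2 with hR
  set ρ := R / 2 with hρ
  have hρ0 : 0 < ρ := by positivity
  set p : V := R • e with hp
  have hsp : inner ℝ e p = R := by rw [hp, inner_smul_right, real_inner_self_eq_norm_sq, he]; ring
  have hpn : ‖p‖ = R := by rw [hp, norm_smul, he, Real.norm_eq_abs, abs_of_pos] <;> linarith
  have hball : ∀ z ∈ Metric.closedBall p ρ, ‖z - p‖ ≤ ρ ∧ ρ ≤ inner ℝ e z ∧ 1 ≤ ‖z‖ ∧ ‖z‖ ≤ X := by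
    intro z hz
    have h1 : ‖z - p‖ ≤ ρ := by simpa [dist_eq_norm] using hz
    have h2 : |inner ℝ e (z - p)| ≤ ‖z - p‖ := by
      simpa [he] using abs_real_inner_le_norm e (z - p)
    rw [inner_sub_right, hsp, abs_le] at h2
    have h3 := norm_sub_norm_le p z
    rw [norm_sub_rev] at h3
    have h4 := norm_sub_norm_le z p
    refine ⟨h1, ?_, ?_, ?_⟩ <;> linarith
  have hlow : ∀ z ∈ Metric.closedBall p ρ, (2 + N) ^ 2 / ρ ^ 2 ≤ u z ^ (α - 1) := by
    intro z hz
    obtain ⟨-, h2, h3, h4⟩ := hball z hz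
    have h5 : c * X⁻¹ ^ m ≤ u z := by
      refine le_trans ?_ (hcu z h3 (hρ0.le.trans h2))
      gcongr
    have h6 : (c * X⁻¹ ^ m) ^ (α - 1) ≤ u z ^ (α - 1) :=
      Real.rpow_le_rpow (by positivity) h5 (by linarith)
    refine le_trans ?_ h6
    rw [Real.mul_rpow hc.le (by positivity), ← Real.rpow_mul (by positivity),
      Real.inv_rpow hX0.le]
    rw [Real.rpow_sub hX0, div_le_iff₀ hcα, Real.rpow_two] at hX1
    have h7 : 0 < X ^ (m * (α - 1)) := by positivity
    have h8 : ρ ^ 2 = X ^ 2 / 16 := by rw [hρ, hR]; ring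
    rw [h8, div_le_iff₀ (by positivity)]
    calc (2 + N) ^ 2 ≤ (X ^ 2 / X ^ (m * (α - 1)) * c ^ (α - 1)) / 16 := by linarith
      _ = _ := by field_simp
  set φ : V → ℝ := fun w => (ρ ^ 2 - ‖w - p‖ ^ 2) ^ 2 with hφ
  have hφc : ∀ z, ContDiffAt ℝ 2 φ z := fun z =>
    (contDiffAt_const.sub (normSq_contDiffAt p z)).pow 2
  have huc : ∀ z, ContDiffAt ℝ 2 u z := fun z => hu.contDiff.contDiffAt
  -- At a maximum of `φ/u`, the function `M u - φ` has a local minimum with value `0`. There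
  -- `-u^(α-1) φ - wlap φ ≥ 0`, against the lower bound on `u^(α-1)` and the bump inequality.
  obtain ⟨z₁, hz1, hmax⟩ := (isCompact_closedBall p ρ).exists_isMaxOn
    ⟨p, Metric.mem_closedBall_self hρ0.le⟩ (f := fun z => φ z / u z) (fun z _ =>
      ((hφc z).continuousAt.div (huc z).continuousAt (hu.pos z).ne').continuousWithinAt)
  set M := φ z₁ / u z₁ with hM
  have hle : ∀ z ∈ Metric.closedBall p ρ, φ z ≤ M * u z := fun z hz =>
    (div_le_iff₀ (hu.pos z)).1 (hmax hz)
  have hMpos : 0 < M := by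
    have h1 := hle p (Metric.mem_closedBall_self hρ0.le)
    have h2 : 0 < φ p := by
      have : φ p = (ρ ^ 2) ^ 2 := by simp [hφ]
      rw [this]; positivity
    exact pos_of_mul_pos_left (h2.trans_le h1) (hu.pos p).le
  have heq : φ z₁ = M * u z₁ := by rw [hM]; field_simp [(hu.pos z₁).ne']
  obtain ⟨h1, h2, -, -⟩ := hball z₁ hz1
  have hz1' : ‖z₁ - p‖ < ρ := by
    refine lt_of_le_of_ne h1 fun h0 => ?_
    have h3 : φ z₁ = 0 := by simp [hφ, h0]
    have := mul_pos hMpos (hu.pos z₁)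
    linarith
  have hs : 0 < inner ℝ e z₁ := hρ0.trans_le h2
  have cM : ContDiffAt ℝ 2 (fun z => M * u z) z₁ := contDiffAt_const.mul (huc z₁)
  have hmin : IsLocalMin (fun z => M * u z - φ z) z₁ := by
    filter_upwards [Metric.isOpen_ball.mem_nhds
      (show z₁ ∈ Metric.ball p ρ by simpa [dist_eq_norm] using hz1')] with z hz
    have := hle z (Metric.ball_subset_closedBall hz)
    linarith
  have h5 := wlap_nonneg_of_isLocalMin (e := e) (b := b) (cM.sub (hφc z₁)) hmin
  rw [wlap_sub cM (hφc z₁), wlap_const_mul M (huc z₁), hu.equation z₁ hs] at h5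
  have h6 := wlap_bump_lower_bound (e := e) (b := b) (by linarith) hρ0
    (by rw [hsp]; positivity) hz1' hs
  change 0 < wlap e b φ z₁ + (2 + N) ^ 2 / ρ ^ 2 * φ z₁ at h6
  have h7 := hlow z₁ hz1
  have h8 : u z₁ ^ α = u z₁ ^ (α - 1) * u z₁ := by
    rw [← Real.rpow_add_one (hu.pos z₁).ne']; congr 1; ring
  have h9 : 0 < φ z₁ := by rw [heq]; exact mul_pos hMpos (hu.pos z₁)
  have h10 : (2 + N) ^ 2 / ρ ^ 2 * φ z₁ ≤ u z₁ ^ (α - 1) * φ z₁ := by gcongr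
  rw [h8] at h5
  rw [heq] at h10 h6
  linarith

theorem lap_eq_of_orthogonal (he : ‖e‖ = 1) {f : V → ℝ} {z : V} {κ : ℝ}
    (h : ∀ v : V, inner ℝ e v = 0 → fderiv ℝ (fderiv ℝ f) z v v = κ * ‖v‖ ^ 2) :
    lap f z = fderiv ℝ (fderiv ℝ f) z e e + κ * (finrank ℝ V - 1) := by
  classical
  have ho : Orthonormal ℝ ((↑) : ({e} : Set V) → V) := by
    refine ⟨?_, ?_⟩
    · rintro ⟨x, hx⟩
      show ‖x‖ = 1
      rw [mem_singleton_iff.1 hx]; exact he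
    · rintro ⟨x, hx⟩ ⟨y, hy⟩ hxy
      exact (hxy (Subtype.ext ((mem_singleton_iff.1 hx).trans (mem_singleton_iff.1 hy).symm))).elim
  obtain ⟨t, B, ht, hB⟩ := ho.exists_orthonormalBasis_extension
  have het : e ∈ t := ht rfl
  have hBe : B ⟨e, het⟩ = e := by rw [hB]
  rw [lap_eq_sum B, ← Finset.add_sum_erase _ _ (Finset.mem_univ (⟨e, het⟩ : t)), hBe]
  congr 1
  have hcard : ((Finset.univ.erase (⟨e, het⟩ : t)).card : ℝ) = finrank ℝ V - 1 := by
    rw [Finset.card_erase_of_mem (Finset.mem_univ _), Finset.card_univ,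
      finrank_eq_card_basis B.toBasis, Nat.cast_sub (Fintype.card_pos_iff.2 ⟨⟨e, het⟩⟩)]
    simp
  rw [← hcard, mul_comm, ← nsmul_eq_mul]
  refine Finset.sum_eq_card_nsmul fun i hi => ?_
  have hne : i ≠ ⟨e, het⟩ := Finset.ne_of_mem_erase hi
  have hio : inner ℝ e (B i) = 0 := by
    rw [← hBe]; exact B.orthonormal.2 hne.symm
  rw [h _ hio, B.orthonormal.1 i]
  ring

theorem fderiv_translate (x₀ z : V) :
    fderiv ℝ (fun z => u (z + x₀)) z = fderiv ℝ u (z + x₀) := fderiv_comp_add_right x₀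

theorem IsPosSolution.translate (hu : IsPosSolution e b α u) {x₀ : V} (hx : inner ℝ e x₀ = 0) :
    IsPosSolution e b α (fun z => u (z + x₀)) where
  contDiff := hu.contDiff.comp (contDiff_id.add contDiff_const)
  pos z := hu.pos _
  equation z hz := by
    have h1 : inner ℝ e (z + x₀) = inner ℝ e z := by rw [inner_add_right, hx, add_zero]
    have h2 : fderiv ℝ (fun z => u (z + x₀)) = fun z => fderiv ℝ u (z + x₀) := by
      ext1 z; exact fderiv_translate x₀ z
    have h3 : fderiv ℝ (fderiv ℝ (fun z => u (z + x₀))) z = fderiv ℝ (fderiv ℝ u) (z + x₀) := by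
      rw [h2]; exact fderiv_comp_add_right x₀
    rw [← hu.equation (z + x₀) (by rwa [h1])]
    simp only [wlap, lap, h1, h3, fderiv_translate]

/-- A positive solution of critical (or subcritical) growth cannot be independent of the variables
orthogonal to `e`. -/
theorem exists_fderiv_ne_zero (he : ‖e‖ = 1) (hb : 1 < b)
    (hm : (finrank ℝ V : ℝ) + b = 2 * m + 2) (hV : 2 ≤ finrank ℝ V) (hα : 1 < α)
    (hα2 : m * α ≤ m + 2) (hu : IsPosSolution e b α u) :
    ∃ z v, 0 < inner ℝ e z ∧ inner ℝ e v = 0 ∧ fderiv ℝ u z v ≠ 0 := by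
  by_contra! hcon
  have hV' : (2 : ℝ) ≤ finrank ℝ V := by exact_mod_cast hV
  -- The weight belonging to a one-dimensional base. It is below `m` since `dim V ≥ 2`, so an
  -- exponent at most critical for `m` is strictly subcritical for `m'`.
  set m' : ℝ := (b - 1) / 2 with hm'
  have hm0 := exponent_pos he hb hm
  have hline : ∀ t : ℝ, HasDerivAt (fun t : ℝ => t • e) e t := fun t => by
    simpa using (hasDerivAt_id t).smul_const e
  have hd1 : ∀ t : ℝ, HasDerivAt (fun t : ℝ => u (t • e)) (fderiv ℝ u (t • e) e) t := fun t =>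
    (hu.contDiff.differentiable (by norm_num) _).hasFDerivAt.comp_hasDerivAt t (hline t)
  have hd2 : ∀ t : ℝ, HasDerivAt (fun t : ℝ => fderiv ℝ u (t • e) e)
      (fderiv ℝ (fderiv ℝ u) (t • e) e e) t := fun t => by
    have := hasDerivAt_fderiv_comp (γ := fun t : ℝ => t • e) (γ' := fun _ => e) (γ'' := 0)
      (t := t) hu.contDiff.contDiffAt (hline t) (hasDerivAt_const t e)
    simpa using this
  refine not_isPosSolution_of_subcritical (V := ℝ) (e := 1) (b := b) (m := m') (α := α)
    (u := fun t => u (t • e)) (by simp) hb (by simp [hm']; ring) hα ?_ ⟨?_, ?_, ?_⟩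
  · have h1 : m' < m := by rw [hm']; linarith
    have h2 : α - 1 ≤ 2 / m := by rw [le_div_iff₀ hm0]; linarith
    have h3 : 0 < m' := by rw [hm']; linarith
    have h4 : m' * (α - 1) ≤ m' * (2 / m) := by gcongr
    have h5 : m' * (2 / m) < 2 := by
      rw [mul_div_assoc', div_lt_iff₀ hm0]; linarith
    linarith
  · exact hu.contDiff.comp (contDiff_id.smul contDiff_const)
  · exact fun t => hu.pos _
  · intro t ht
    have ht' : 0 < t := by simpa using ht
    have hs : 0 < inner ℝ e (t • e) := by
      rw [inner_smul_right, real_inner_self_eq_norm_sq, he]; linarith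
    rw [← hu.equation (t • e) hs]
    have hlap : lap u (t • e) = fderiv ℝ (fderiv ℝ u) (t • e) e e := by
      rw [lap_eq_of_orthogonal he (κ := 0), zero_mul, add_zero]
      intro v hv
      rw [zero_mul]
      refine fderiv_fderiv_eq_of_line hu.contDiff.contDiffAt (φ' := fun _ => 0) ?_
        (hasDerivAt_const _ _)
      refine Eventually.of_forall fun τ => ?_
      have h1 := (hu.contDiff.differentiable (by norm_num)
        (t • e + τ • v)).hasFDerivAt.comp_hasDerivAt τ (hasDerivAt_line (t • e) v τ)
      rwa [hcon _ v (by rw [inner_add_right, inner_smul_right e v, hv]; linarith) hv] at h1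
    have hlap1 : lap (fun t : ℝ => u (t • e)) t = fderiv ℝ (fderiv ℝ u) (t • e) e e := by
      rw [lap_eq_of_orthogonal (e := (1 : ℝ)) (by simp) (κ := 0)]
      · simp only [zero_mul, add_zero]
        refine fderiv_fderiv_eq_of_line (φ' := fun τ => fderiv ℝ u ((t + τ) • e) e)
          (hu.contDiff.comp (contDiff_id.smul contDiff_const)).contDiffAt ?_ ?_
        · refine Eventually.of_forall fun τ => ?_
          have := (hd1 (t + τ)).comp_const_add t τ
          simpa using this
        · have h2 : HasDerivAt (fun t : ℝ => fderiv ℝ u (t • e) e)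
            (fderiv ℝ (fderiv ℝ u) (t • e) e e) (t + 0) := by rw [add_zero]; exact hd2 t
          exact h2.comp_const_add t 0
      · intro v hv
        have : v = 0 := by simpa using hv
        simp [this]
    simp only [wlap, hlap, hlap1]
    rw [inner_smul_right, real_inner_self_eq_norm_sq, he]
    have h3 : fderiv ℝ (fun t : ℝ => u (t • e)) t 1 = fderiv ℝ u (t • e) e := by
      rw [fderiv_apply_one_eq_deriv]; exact (hd1 t).deriv
    rw [h3]
    simp

theorem exists_kelvin_eq (he : ‖e‖ = 1) (hb : 1 < b)
    (hm : (finrank ℝ V : ℝ) + b = 2 * m + 2) (hV : 2 ≤ finrank ℝ V) (hα : 1 < α)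
    (hα2 : m * α ≤ m + 2) (hu : IsPosSolution e b α u) (x₁ : V) (hx₁ : inner ℝ e x₁ = 0) :
    ∃ ρ, 0 < ρ ∧ ∀ z, ρ ≤ ‖z‖ → 0 ≤ inner ℝ e z →
      kelvin m ρ (fun z => u (z + x₁)) z = u (z + x₁) := by
  have hm0 := exponent_pos he hb hm
  have alt := fun (x : V) (hx : inner ℝ e x = 0) =>
    below_forall_or_kelvin_eq he hb hm hm0 (by linarith) hα2 (hu.translate hx)
  rcases alt x₁ hx₁ with hB | h
  swap
  · exact h
  exfalso
  -- the alternative must hold at some centre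
  obtain ⟨x₀, hx₀, ρ, hρ, hk⟩ : ∃ x₀ : V, inner ℝ e x₀ = 0 ∧ ∃ ρ, 0 < ρ ∧ ∀ z, ρ ≤ ‖z‖ →
      0 ≤ inner ℝ e z → kelvin m ρ (fun z => u (z + x₀)) z = u (z + x₀) := by
    by_contra! hcon
    obtain ⟨z, v, hz, hv, hne⟩ := exists_fderiv_ne_zero he hb hm hV hα hα2 hu
    -- Monotonicity about the centre `t v`, evaluated at the fixed point `z`, is affine in `t`;
    -- holding for all `t`, it forces the slope to vanish.
    have hall : ∀ t : ℝ, 0 ≤ m * u z + fderiv ℝ u z z - t * fderiv ℝ u z v := by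
      intro t
      have htv : inner ℝ e (t • v) = 0 := by rw [inner_smul_right, hv, mul_zero]
      rcases alt (t • v) htv with h | ⟨ρ, h1, h2⟩
      · have h3 := radialDeriv_nonneg_of_below hm0 (hu.translate htv) h (z := z - t • v)
          (by rw [inner_sub_right, htv]; linarith)
        rw [radialDeriv, fderiv_translate] at h3
        simp only [sub_add_cancel, map_sub, map_smul, smul_eq_mul] at h3
        linarith
      · obtain ⟨y, h3, h4, h5⟩ := hcon (t • v) htv ρ h1
        exact (h5 (h2 y h3 h4)).elim
    have := hall ((m * u z + fderiv ℝ u z z + 1) / fderiv ℝ u z v)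
    rw [div_mul_cancel₀ _ hne] at this
    linarith
  obtain ⟨M, hM⟩ : ∃ M, ∀ y ∈ Metric.closedBall x₀ ρ, u y ≤ M := by
    obtain ⟨M, hM⟩ := (isCompact_closedBall x₀ ρ).bddAbove_image
      hu.contDiff.continuous.continuousOn
    exact ⟨M, fun z hz => hM (mem_image_of_mem _ hz)⟩
  have hMpos : 0 < M := (hu.pos x₀).trans_le (hM x₀ (Metric.mem_closedBall_self hρ.le))
  -- Equality with the Kelvin transform at `x₀` gives decay of order `t^(-2m)` along the vertical
  -- line through `x₁`.
  have hupper : ∀ t, ρ ≤ t → (t ^ 2) ^ m * u (t • e + x₁) ≤ (ρ ^ 2) ^ m * M := by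
    intro t ht
    have ht0 : 0 < t := hρ.trans_le ht
    set z := t • e + (x₁ - x₀) with hz
    have hzx : z + x₀ = t • e + x₁ := by rw [hz]; abel
    have hzn : ‖z‖ ^ 2 = t ^ 2 + ‖x₁ - x₀‖ ^ 2 := by
      have h0 : inner ℝ e (x₁ - x₀) = 0 := by rw [inner_sub_right, hx₁, hx₀, sub_zero]
      rw [hz, norm_add_sq_real, inner_smul_left, h0, norm_smul, he, Real.norm_eq_abs, mul_one,
        sq_abs]
      simp
    have htz : t ≤ ‖z‖ := le_of_sq_le_sq (by rw [hzn]; nlinarith [sq_nonneg ‖x₁ - x₀‖])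
      (norm_nonneg _)
    have hz0 : 0 < ‖z‖ := ht0.trans_le htz
    have hs : 0 ≤ inner ℝ e z := by
      rw [hz, inner_add_right, inner_smul_right, real_inner_self_eq_norm_sq, he, inner_sub_right,
        hx₁, hx₀]
      linarith
    have h1 := hk z (ht.trans htz) hs
    rw [hzx, kelvin] at h1
    have h2 : u (sphereInv ρ z + x₀) ≤ M := by
      refine hM _ ?_
      rw [Metric.mem_closedBall, dist_eq_norm, add_sub_cancel_right,
        norm_sphereInv (norm_pos_iff.1 hz0), div_le_iff₀ hz0]
      nlinarith
    rw [← h1, ← mul_assoc, ← Real.mul_rpow (by positivity) (by positivity)]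
    have h3 : t ^ 2 * (ρ ^ 2 / ‖z‖ ^ 2) ≤ ρ ^ 2 := by
      rw [mul_div_assoc', div_le_iff₀ (by positivity)]
      have : t ^ 2 ≤ ‖z‖ ^ 2 := by gcongr
      nlinarith [sq_nonneg ρ]
    have h4 : (t ^ 2 * (ρ ^ 2 / ‖z‖ ^ 2)) ^ m ≤ (ρ ^ 2) ^ m :=
      Real.rpow_le_rpow (by positivity) h3 hm0.le
    have h5 := hu.pos (sphereInv ρ z + x₀)
    gcongr
  -- Dominating all Kelvin transforms about `x₁` bounds the limit of `t^(2m) u` from below by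
  -- `σ^(2m) u(x₁)` for every `σ`, which is unbounded.
  have hσ : ∀ σ, 0 < σ → (σ ^ 2) ^ m * u x₁ ≤ (ρ ^ 2) ^ m * M := by
    intro σ hσ
    have hlim : Tendsto (fun t : ℝ => (σ ^ 2) ^ m * u ((σ ^ 2 / t) • e + x₁)) atTop
        (𝓝 ((σ ^ 2) ^ m * u ((0 : ℝ) • e + x₁))) := by
      have h1 : Tendsto (fun t : ℝ => σ ^ 2 / t) atTop (𝓝 0) :=
        tendsto_const_nhds.div_atTop tendsto_id
      have h2 : Continuous fun τ : ℝ => (σ ^ 2) ^ m * u (τ • e + x₁) :=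
        continuous_const.mul (hu.contDiff.continuous.comp (by fun_prop))
      exact (h2.tendsto 0).comp h1
    rw [zero_smul, zero_add] at hlim
    refine le_of_tendsto hlim ?_
    filter_upwards [eventually_ge_atTop ρ, eventually_ge_atTop σ] with t ht1 ht2
    have ht0 : 0 < t := hρ.trans_le ht1
    refine le_trans ?_ (hupper t ht1)
    have hn : ‖t • e‖ = t := by rw [norm_smul, he, Real.norm_eq_abs, abs_of_pos ht0, mul_one]
    have h1 := hB σ hσ (t • e) (by rw [hn]; exact ht2)
      (by rw [inner_smul_right, real_inner_self_eq_norm_sq, he]; linarith)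
    rw [kelvin, sphereInv, hn, smul_smul, Real.div_rpow (by positivity) (by positivity),
      show σ ^ 2 / t ^ 2 * t = σ ^ 2 / t by field_simp, div_mul_eq_mul_div,
      div_le_iff₀ (by positivity)] at h1
    linarith
  have hlim : Tendsto (fun σ : ℝ => (σ ^ 2) ^ m * u x₁) atTop atTop :=
    ((tendsto_rpow_atTop hm0).comp (tendsto_pow_atTop (by norm_num))).atTop_mul_const (hu.pos x₁)
  obtain ⟨σ, h1, h2⟩ := ((hlim.eventually_gt_atTop ((ρ ^ 2) ^ m * M)).and
    (eventually_gt_atTop 0)).exists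
  exact not_lt.2 (hσ σ h2) h1

end Nonexistence

/-! ### The profile `u^(-1/m)`: its equation, its inversion symmetry and the sphere radii. -/

section Profile

variable {V : Type*} [NormedAddCommGroup V] [InnerProductSpace ℝ V] [FiniteDimensional ℝ V]
variable {e : V} {b m α : ℝ} {u : V → ℝ}

/-- The squared norm of the gradient. -/
def gradSq (f : V → ℝ) (z : V) : ℝ := ∑ i, fderiv ℝ f z (stdOrthonormalBasis ℝ V i) ^ 2

theorem fderiv_comp_real {f : V → ℝ} {g g' : ℝ → ℝ} {z : V} (hf : ContDiffAt ℝ 2 f z)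
    (h1 : HasDerivAt g (g' (f z)) (f z)) (v : V) :
    fderiv ℝ (fun w => g (f w)) z v = g' (f z) * fderiv ℝ f z v := by
  have h3 := h1.comp_hasFDerivAt z (hf.differentiableAt (by norm_num)).hasFDerivAt
  have h4 : fderiv ℝ (fun w => g (f w)) z = g' (f z) • fderiv ℝ f z := h3.fderiv
  rw [h4]; simp

theorem wlap_comp {f : V → ℝ} {g g' : ℝ → ℝ} {g'' : ℝ} {z : V} (hf : ContDiffAt ℝ 2 f z)
    (hg : ContDiffAt ℝ 2 g (f z)) (h1 : ∀ᶠ q in 𝓝 (f z), HasDerivAt g (g' q) q)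
    (h2 : HasDerivAt g' g'' (f z)) :
    wlap e b (fun w => g (f w)) z = g' (f z) * wlap e b f z + g'' * gradSq f z := by
  have hc : ContDiffAt ℝ 2 (fun w => g (f w)) z := hg.comp z hf
  have d2 : ∀ v : V, fderiv ℝ (fderiv ℝ (fun w => g (f w))) z v v
      = g' (f z) * fderiv ℝ (fderiv ℝ f) z v v + g'' * fderiv ℝ f z v ^ 2 := by
    intro v
    have hz : z + (0 : ℝ) • v = z := by simp
    have e1 := eventually_hasDerivAt_comp (γ := fun t : ℝ => z + t • v) (γ' := fun _ => v) (t := 0)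
      (by simpa [hz] using hf) (Eventually.of_forall (hasDerivAt_line z v))
    have e2 := hasDerivAt_fderiv_comp (γ := fun t : ℝ => z + t • v) (γ' := fun _ => v) (γ'' := 0)
      (t := 0) (by simpa [hz] using hf) (hasDerivAt_line z v 0) (hasDerivAt_const 0 v)
    simp only [hz, map_zero, add_zero] at e2
    have hct : Tendsto (fun t : ℝ => f (z + t • v)) (𝓝 0) (𝓝 (f z)) := by
      have := e1.self_of_nhds.continuousAt.tendsto
      simpa using this
    have h2' : HasDerivAt g' g'' (f (z + (0 : ℝ) • v)) := by rwa [hz]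
    refine fderiv_fderiv_eq_of_line hc
      (φ' := fun t => g' (f (z + t • v)) * fderiv ℝ f (z + t • v) v) ?_ ?_
    · filter_upwards [e1, hct.eventually h1] with t a1 a2
      exact a2.comp t a1
    · refine ((h2'.comp 0 e1.self_of_nhds).mul e2).congr_deriv ?_
      simp only [hz, Function.comp]
      ring
  simp only [wlap, lap, d2, fderiv_comp_real hf h1.self_of_nhds, gradSq,
    Finset.sum_add_distrib, ← Finset.mul_sum]
  ring

/-- The profile `u ^ (-1 / m)`, a quadratic polynomial for the standard solutions. -/
def profile (m : ℝ) (u : V → ℝ) (z : V) : ℝ := u z ^ (-(1 / m))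

theorem profile_pos (hu : ∀ z, 0 < u z) (z : V) : 0 < profile m u z :=
  Real.rpow_pos_of_pos (hu z) _

theorem profile_contDiff (hu : ∀ z, 0 < u z) (hc : ContDiff ℝ 2 u) :
    ContDiff ℝ 2 (profile m u) := hc.rpow_const_of_ne fun z => (hu z).ne'

/-- At the critical exponent the powers of `u` in the nonlinear term cancel, leaving the constant
`1/m` and making quadratic polynomials natural solutions. -/
theorem profile_equation (hm : 0 < m) (hα : m * α = m + 2) (hu : IsPosSolution e b α u) {z : V}
    (hs : 0 < inner ℝ e z) :
    profile m u z * wlap e b (profile m u) z = (m + 1) * gradSq (profile m u) z + 1 / m := by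
  have hU := hu.pos z
  set p : ℝ := -(1 / m) with hp
  have hd : ∀ q : ℝ, 0 < q → HasDerivAt (fun q : ℝ => q ^ p) (p * q ^ (p - 1)) q := fun q hq =>
    Real.hasDerivAt_rpow_const (Or.inl hq.ne')
  have hw : wlap e b (profile m u) z = p * u z ^ (p - 1) * wlap e b u z
      + p * ((p - 1) * u z ^ (p - 1 - 1)) * gradSq u z :=
    wlap_comp (g := fun q : ℝ => q ^ p) (g' := fun q => p * q ^ (p - 1)) hu.contDiff.contDiffAt
      (Real.contDiffAt_rpow_const_of_ne hU.ne')
      (by filter_upwards [lt_mem_nhds hU] with q hq using hd q hq)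
      ((Real.hasDerivAt_rpow_const (Or.inl hU.ne')).const_mul p)
  have hg : gradSq (profile m u) z = (p * u z ^ (p - 1)) ^ 2 * gradSq u z := by
    have : ∀ v, fderiv ℝ (profile m u) z v = p * u z ^ (p - 1) * fderiv ℝ u z v :=
      fderiv_comp_real (g := fun q : ℝ => q ^ p) (g' := fun q => p * q ^ (p - 1))
        hu.contDiff.contDiffAt (hd _ hU)
    simp only [gradSq, this, mul_pow, Finset.mul_sum]
  rw [hw, hg, hu.equation z hs, profile, ← hp, Real.rpow_sub_one hU.ne' (p - 1),
    Real.rpow_sub_one hU.ne' p]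
  have h1 : u z ^ p * (u z ^ p / u z) * u z ^ α = 1 := by
    rw [← Real.rpow_sub_one hU.ne', ← Real.rpow_add hU, ← Real.rpow_add hU]
    have : p + (p - 1) + α = 0 := by
      have : α = (m + 2) / m := by field_simp; linarith
      rw [hp, this]; field_simp; ring
    rw [this, Real.rpow_zero]
  have h2 : p = -1 / m := by rw [hp]; ring
  have h3 : u z ^ p * (p * (u z ^ p / u z) * -u z ^ α) = 1 / m := by
    calc _ = -p * (u z ^ p * (u z ^ p / u z) * u z ^ α) := by ring
      _ = 1 / m := by rw [h1, h2]; field_simp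
  rw [mul_add, h3]
  clear_value p
  subst h2
  field_simp
  ring

theorem profile_symmetry (hm : 0 < m) (hu : ∀ z, 0 < u z) {x₀ : V} {ρ : ℝ} (hρ : 0 < ρ)
    (h : ∀ z, ρ ≤ ‖z‖ → 0 ≤ inner ℝ e z →
      kelvin m ρ (fun z => u (z + x₀)) z = u (z + x₀)) {z : V} (hz : z ≠ 0)
    (hs : 0 ≤ inner ℝ e z) :
    ρ ^ 2 * profile m u (z + x₀) = ‖z‖ ^ 2 * profile m u (sphereInv ρ z + x₀) := by
  have key : ∀ z, ρ ≤ ‖z‖ → 0 ≤ inner ℝ e z →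
      ρ ^ 2 * profile m u (z + x₀) = ‖z‖ ^ 2 * profile m u (sphereInv ρ z + x₀) := by
    intro z h1 h2
    have hz0 : 0 < ‖z‖ := hρ.trans_le h1
    have h3 : 0 < ρ ^ 2 / ‖z‖ ^ 2 := by positivity
    rw [profile, profile, ← h z h1 h2, kelvin,
      Real.mul_rpow (by positivity) (hu _).le, ← Real.rpow_mul h3.le,
      show m * -(1 / m) = -1 by field_simp, Real.rpow_neg_one]
    field_simp
  rcases le_total ρ ‖z‖ with h1 | h1
  · exact key z h1 hs
  · have hz0 : 0 < ‖z‖ := norm_pos_iff.2 hz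
    have h2 := key (sphereInv ρ z) (by
      rw [norm_sphereInv hz, le_div_iff₀ hz0]; nlinarith) (by rw [inner_sphereInv]; positivity)
    rw [sphereInv_sphereInv hρ hz, norm_sphereInv_sq hz] at h2
    field_simp at h2
    linarith

variable {Ψ : V → ℝ}

/-- The inversion turns the first-order Taylor expansion of `Ψ` at `x₀` into a two-term expansion at
infinity along `v`. The left side involves the centre only through `Ψ x₀ / ρ²`, so expansions from
different centres can be compared. -/
theorem profile_asymptotics (hc : ContDiff ℝ 2 Ψ) {x₀ : V} (hx₀ : inner ℝ e x₀ = 0) {ρ : ℝ}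
    (hρ : 0 < ρ) (h : ∀ z, z ≠ 0 → 0 ≤ inner ℝ e z →
      ρ ^ 2 * Ψ (z + x₀) = ‖z‖ ^ 2 * Ψ (sphereInv ρ z + x₀))
    {v : V} (hv : ‖v‖ = 1) (hs : 0 ≤ inner ℝ e v) :
    Tendsto (fun t : ℝ => (Ψ (t • v) - Ψ x₀ / ρ ^ 2 * t ^ 2) / t) atTop
      (𝓝 (fderiv ℝ Ψ x₀ v - 2 * (Ψ x₀ / ρ ^ 2) * inner ℝ x₀ v)) := by
  set q : ℝ → ℝ := fun t => ‖t • v - x₀‖ ^ 2 with hq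
  have hqe : ∀ t, q t = t ^ 2 - 2 * t * inner ℝ x₀ v + ‖x₀‖ ^ 2 := by
    intro t
    simp only [hq]
    rw [norm_sub_sq_real, norm_smul, hv, inner_smul_left, real_inner_comm, Real.norm_eq_abs, mul_one,
      sq_abs]
    simp only [conj_trivial]; ring
  have hinv : Tendsto (fun t : ℝ => t⁻¹) atTop (𝓝 0) := tendsto_inv_atTop_zero
  have hq2 : Tendsto (fun t => q t / t ^ 2) atTop (𝓝 1) := by
    have h1 : Tendsto (fun t : ℝ => 1 - 2 * inner ℝ x₀ v * t⁻¹ + ‖x₀‖ ^ 2 * (t⁻¹ * t⁻¹)) atTop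
        (𝓝 (1 - 2 * inner ℝ x₀ v * 0 + ‖x₀‖ ^ 2 * (0 * 0))) :=
      (tendsto_const_nhds.sub (hinv.const_mul _)).add ((hinv.mul hinv).const_mul _)
    simp only [mul_zero, sub_zero, add_zero] at h1
    refine h1.congr' ?_
    filter_upwards [eventually_gt_atTop 0] with t ht
    rw [hqe]; field_simp
  have hq3 : Tendsto (fun t => (q t - t ^ 2) / t) atTop (𝓝 (-2 * inner ℝ x₀ v)) := by
    have h1 : Tendsto (fun t : ℝ => -2 * inner ℝ x₀ v + ‖x₀‖ ^ 2 * t⁻¹) atTop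
        (𝓝 (-2 * inner ℝ x₀ v + ‖x₀‖ ^ 2 * 0)) :=
      tendsto_const_nhds.add (hinv.const_mul _)
    simp only [mul_zero, add_zero] at h1
    refine h1.congr' ?_
    filter_upwards [eventually_gt_atTop 0] with t ht
    rw [hqe]; field_simp; ring
  have hq4 : Tendsto (fun t => t ^ 2 / q t) atTop (𝓝 1) := by
    have := hq2.inv₀ one_ne_zero
    simpa using this
  set ξ : ℝ → V := fun t => (ρ ^ 2 / q t) • (t • v - x₀) with hξ
  have hne : ∀ᶠ t : ℝ in atTop, t • v - x₀ ≠ 0 := by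
    filter_upwards [eventually_gt_atTop ‖x₀‖] with t ht h0
    have : ‖t • v‖ = ‖x₀‖ := by rw [sub_eq_zero.1 h0]
    rw [norm_smul, hv, Real.norm_eq_abs, mul_one,
      abs_of_pos ((norm_nonneg _).trans_lt ht)] at this
    exact ht.ne' this
  have hcξ : Tendsto (fun t => t • ξ t) atTop (𝓝 (ρ ^ 2 • v)) := by
    have h1 : Tendsto (fun t : ℝ => (ρ ^ 2 * (t ^ 2 / q t)) • (v - t⁻¹ • x₀)) atTop
        (𝓝 ((ρ ^ 2 * 1) • (v - (0 : ℝ) • x₀))) :=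
      (hq4.const_mul _).smul (tendsto_const_nhds.sub (hinv.smul_const x₀))
    rw [zero_smul, sub_zero, mul_one] at h1
    refine h1.congr' ?_
    filter_upwards [eventually_gt_atTop 0] with t ht
    simp only [hξ, smul_sub, smul_smul]
    congr 2 <;> field_simp
  have hξ0 : Tendsto ξ atTop (𝓝 0) := by
    have h1 := hinv.smul hcξ
    rw [zero_smul] at h1
    refine h1.congr' ?_
    filter_upwards [eventually_gt_atTop 0] with t ht
    rw [smul_smul, inv_mul_cancel₀ ht.ne', one_smul]
  have hlim := (hc.differentiable (by norm_num) x₀).hasFDerivAt.hasFDerivWithinAt (s := univ) |>.lim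
    hξ0 (Eventually.of_forall fun _ => mem_univ _) hcξ
  have h2 := (((hq2.mul_const (1 / ρ ^ 2)).mul hlim)).add (hq3.const_mul (Ψ x₀ / ρ ^ 2))
  have h3 : 1 * (1 / ρ ^ 2) * (fderiv ℝ Ψ x₀) (ρ ^ 2 • v) + Ψ x₀ / ρ ^ 2 * (-2 * inner ℝ x₀ v)
      = fderiv ℝ Ψ x₀ v - 2 * (Ψ x₀ / ρ ^ 2) * inner ℝ x₀ v := by
    rw [map_smul, smul_eq_mul]; field_simp; ring
  rw [h3] at h2
  refine h2.congr' ?_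
  filter_upwards [eventually_gt_atTop 0, hne] with t ht h0
  have h4 := h (t • v - x₀) h0 (by
    rw [inner_sub_right, hx₀, inner_smul_right, sub_zero]; positivity)
  have h5 : Ψ (t • v) = q t / ρ ^ 2 * Ψ (x₀ + ξ t) := by
    rw [sub_add_cancel] at h4
    have : sphereInv ρ (t • v - x₀) + x₀ = x₀ + ξ t := by rw [add_comm]; rfl
    rw [this] at h4
    field_simp
    linarith
  rw [h5, smul_eq_mul]
  field_simp
  ring

theorem profile_growth (he : ‖e‖ = 1) (hc : ContDiff ℝ 2 Ψ) {x₀ : V} (hx₀ : inner ℝ e x₀ = 0)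
    {ρ : ℝ} (hρ : 0 < ρ) (h : ∀ z, z ≠ 0 → 0 ≤ inner ℝ e z →
      ρ ^ 2 * Ψ (z + x₀) = ‖z‖ ^ 2 * Ψ (sphereInv ρ z + x₀)) :
    Tendsto (fun t : ℝ => Ψ (t • e) / t ^ 2) atTop (𝓝 (Ψ x₀ / ρ ^ 2)) := by
  have h1 := profile_asymptotics hc hx₀ hρ h he (by rw [real_inner_self_eq_norm_sq, he]; norm_num)
  have h2 := (h1.mul (tendsto_inv_atTop_zero (𝕜 := ℝ))).add_const (Ψ x₀ / ρ ^ 2)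
  rw [mul_zero, zero_add] at h2
  refine h2.congr' ?_
  filter_upwards [eventually_gt_atTop 0] with t ht
  field_simp
  ring

/-- On the hyperplane `s = 0` the profile is a quadratic polynomial, and the inversion radii are
the corresponding powers. -/
theorem exists_center (he : ‖e‖ = 1) (hc : ContDiff ℝ 2 Ψ) (hpos : ∀ z, 0 < Ψ z)
    (h : ∀ x₀, inner ℝ e x₀ = 0 → ∃ ρ : ℝ, 0 < ρ ∧ ∀ z, z ≠ 0 → 0 ≤ inner ℝ e z →
      ρ ^ 2 * Ψ (z + x₀) = ‖z‖ ^ 2 * Ψ (sphereInv ρ z + x₀)) :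
    ∃ (x : V) (d : ℝ), inner ℝ e x = 0 ∧ 0 < d ∧ ∀ x₀, inner ℝ e x₀ = 0 → ∀ z, z ≠ 0 →
      0 ≤ inner ℝ e z → (‖x₀ - x‖ ^ 2 + d) * Ψ (z + x₀)
        = ‖z‖ ^ 2 * Ψ (((‖x₀ - x‖ ^ 2 + d) / ‖z‖ ^ 2) • z + x₀) := by
  choose! ρ hρ hsym using h
  set a := Ψ 0 / ρ 0 ^ 2 with ha
  have h00 : inner ℝ e (0 : V) = 0 := inner_zero_right e
  have hapos : 0 < a := div_pos (hpos 0) (pow_pos (hρ 0 h00) 2)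
  -- Both numbers are the quadratic growth rate of `Ψ` along the axis, which does not know the
  -- centre.
  have hax : ∀ x, inner ℝ e x = 0 → Ψ x / ρ x ^ 2 = a := fun x hx =>
    tendsto_nhds_unique (profile_growth he hc hx (hρ x hx) (hsym x hx))
      (profile_growth he hc h00 (hρ 0 h00) (hsym 0 h00))
  have hgrad1 : ∀ x, inner ℝ e x = 0 → ∀ v, inner ℝ e v = 0 → ‖v‖ = 1 →
      fderiv ℝ Ψ x v = fderiv ℝ Ψ 0 v + 2 * a * inner ℝ x v := by
    intro x hx v hv hv1
    have h1 := profile_asymptotics hc hx (hρ x hx) (hsym x hx) hv1 hv.ge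
    have h2 := profile_asymptotics hc h00 (hρ 0 h00) (hsym 0 h00) hv1 hv.ge
    rw [hax x hx] at h1
    rw [← ha, inner_zero_left, mul_zero, sub_zero] at h2
    have := tendsto_nhds_unique h1 h2
    linarith
  have hgrad : ∀ x, inner ℝ e x = 0 → ∀ v, inner ℝ e v = 0 →
      fderiv ℝ Ψ x v = fderiv ℝ Ψ 0 v + 2 * a * inner ℝ x v := by
    intro x hx v hv
    by_cases hv0 : v = 0
    · simp [hv0]
    have hn : ‖v‖ ≠ 0 := norm_ne_zero_iff.2 hv0
    have h1 := hgrad1 x hx (‖v‖⁻¹ • v) (by rw [inner_smul_right, hv, mul_zero])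
      (by rw [norm_smul]; simp [hn])
    rw [map_smul, map_smul, inner_smul_right, smul_eq_mul, smul_eq_mul] at h1
    field_simp at h1
    linarith
  have hquad : ∀ x, inner ℝ e x = 0 → Ψ x = Ψ 0 + fderiv ℝ Ψ 0 x + a * ‖x‖ ^ 2 := by
    intro x hx
    have hd : ∀ t : ℝ, HasDerivAt (fun t : ℝ => Ψ (t • x) - t * fderiv ℝ Ψ 0 x - a * ‖x‖ ^ 2 * t ^ 2)
        0 t := by
      intro t
      have h1 : HasDerivAt (fun t : ℝ => t • x) x t := by
        simpa using (hasDerivAt_id t).smul_const x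
      have h2 : HasDerivAt (fun t : ℝ => Ψ (t • x)) (fderiv ℝ Ψ (t • x) x) t :=
        (hc.differentiable (by norm_num) _).hasFDerivAt.comp_hasDerivAt t h1
      have h3 := (h2.sub ((hasDerivAt_id t).mul_const (fderiv ℝ Ψ 0 x))).sub
        ((hasDerivAt_pow 2 t).const_mul (a * ‖x‖ ^ 2))
      refine h3.congr_deriv ?_
      rw [hgrad (t • x) (by rw [inner_smul_right, hx, mul_zero]) x hx, inner_smul_left,
        real_inner_self_eq_norm_sq]
      simp
      ring
    have := is_const_of_deriv_eq_zero (fun t => (hd t).differentiableAt) (fun t => (hd t).deriv) 1 0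
    simp only [one_smul, zero_smul, one_mul, zero_mul, one_pow, mul_one] at this
    linarith
  set g := (toDual ℝ V).symm (fderiv ℝ Ψ 0) with hg
  have hgv : ∀ v, inner ℝ g v = fderiv ℝ Ψ 0 v := fun v => toDual_symm_apply
  -- The vertex of the quadratic polynomial, from the tangential part of the gradient at the origin.
  set x : V := (-(1 / (2 * a))) • (g - (inner ℝ e g) • e) with hx
  have hxe : inner ℝ e x = 0 := by
    rw [hx, inner_smul_right, inner_sub_right, inner_smul_right, real_inner_self_eq_norm_sq, he]
    ring
  have hxv : ∀ v, inner ℝ e v = 0 → fderiv ℝ Ψ 0 v = -2 * a * inner ℝ x v := by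
    intro v hv
    rw [← hgv, hx, inner_smul_left, inner_sub_left, inner_smul_left, hv]
    simp only [conj_trivial]
    field_simp
    ring
  set D := Ψ 0 - a * ‖x‖ ^ 2 with hD
  have hform : ∀ y, inner ℝ e y = 0 → Ψ y = a * ‖y - x‖ ^ 2 + D := by
    intro y hy
    rw [hquad y hy, hxv y hy, norm_sub_sq_real, real_inner_comm x y, hD]
    ring
  have hDpos : 0 < D := by
    have := hform x hxe
    rw [sub_self, norm_zero] at this
    have := hpos x
    linarith
  refine ⟨x, D / a, hxe, div_pos hDpos hapos, fun y hy z hz hs => ?_⟩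
  have hρy := hρ y hy
  have h1 : ρ y ^ 2 = ‖y - x‖ ^ 2 + D / a := by
    have h2 := hax y hy
    rw [hform y hy, div_eq_iff (by positivity)] at h2
    field_simp
    linarith
  rw [← h1]
  exact hsym y hy z hz hs

end Profile

/-! ### The integral identity on the axis. -/

section ODE

/-- Rigidity for the ordinary differential equation satisfied along the axis. -/
theorem axis_rigidity {b m d : ℝ} {n : ℕ} (hb : 1 < b) (hm : 0 < m) (hn : 1 ≤ n) (hd : 0 < d)
    (hN : (n : ℝ) + 1 + b = 2 * m + 2) {η η₁ η₂ : ℝ → ℝ} (hpos : ∀ s, 0 < η s)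
    (h1 : ∀ s, HasDerivAt η (η₁ s) s) (h2 : ∀ s, HasDerivAt η₁ (η₂ s) s) (hc : Continuous η₂)
    (heq : ∀ s, 0 < s → s ^ 2 < d →
      η s * (η₂ s + b / s * η₁ s + n * (2 * (η s - s * η₁ s) / (d - s ^ 2)))
        = (m + 1) * η₁ s ^ 2 + 1 / m) :
    ∃ c, 0 < c ∧ 4 * (m + 1) * m * d * c ^ 2 = 1 ∧
      ∀ s, 0 ≤ s → s ^ 2 ≤ d → η s = c * (d + s ^ 2) := by
  set N : ℝ := 2 * m + 2 with hNdef
  have hN0 : 0 < N := by positivity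
  set Q : ℝ → ℝ := fun s => ((m + 1) * η₁ s ^ 2 + 1 / m) / η s with hQ
  set J : ℝ → ℝ := fun s => η₁ s * (d + s ^ 2) - 2 * s * η s with hJ
  set μ : ℝ → ℝ := fun s => 2 * (η s - s * η₁ s) / (d - s ^ 2) with hμ
  set W : ℝ → ℝ := fun s => s ^ b * (d - s ^ 2) ^ n * η s ^ (-(2 * m + 1)) with hW
  -- This is `η₂ - Q/N` rewritten by the equation so that only `η` and `η₁` occur; it is thus
  -- differentiable although `η` is merely `C²`.
  set A : ℝ → ℝ := fun s => (1 - 1 / N) * Q s - b * (η₁ s / s) - n * μ s with hA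
  have hηc : Continuous η := continuous_iff_continuousAt.2 fun s => (h1 s).continuousAt
  have hη₁c : Continuous η₁ := continuous_iff_continuousAt.2 fun s => (h2 s).continuousAt
  have hη₂ : ∀ s, 0 < s → s ^ 2 < d → η₂ s = Q s - b * (η₁ s / s) - n * μ s := by
    intro s hs hsd
    have h3 := heq s hs hsd
    have h4 : Q s = η₂ s + b / s * η₁ s + n * μ s := by
      simp only [hQ, hμ]
      rw [← h3]
      field_simp [(hpos s).ne']
    rw [h4]; ring
  -- the three trace-free second derivatives
  have hA1 : ∀ s, 0 < s → s ^ 2 < d → A s = η₂ s - Q s / N := by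
    intro s hs hsd
    rw [hη₂ s hs hsd]
    simp only [hA]; ring
  -- The second derivatives `η₂`, `η₁/s` and `μ` count with multiplicities `1`, `b` and `n`; their
  -- weighted sum is `Q` and `N = 1 + b + n`, so subtracting `Q/N` gives the trace-free part. `J`
  -- vanishes exactly for multiples of `d + s²`.
  have dF : ∀ s, 0 < s → s ^ 2 < d → HasDerivAt (fun s => W s * J s * A s)
      (W s * ((d + s ^ 2) * ((η₂ s - Q s / N) ^ 2 + b * (η₁ s / s - Q s / N) ^ 2
        + n * (μ s - Q s / N) ^ 2))) s := by
    intro s hs hsd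
    have hds : 0 < d - s ^ 2 := by linarith
    have hηs := hpos s
    have d1 := h1 s
    have d2 := h2 s
    have dsq : HasDerivAt (fun s : ℝ => s ^ 2) (2 * s) s := by simpa using hasDerivAt_pow 2 s
    have dQ : HasDerivAt Q (N * η₁ s / η s * (η₂ s - Q s / N)) s := by
      have := (((d2.pow 2).const_mul (m + 1)).add_const (1 / m)).div d1 hηs.ne'
      refine this.congr_deriv ?_
      simp only [hQ, hNdef, Pi.pow_apply]
      field_simp
      ring
    have dJ : HasDerivAt J ((d + s ^ 2) * (η₂ s - Q s / N) - 2 * s ^ 2 * (η₁ s / s - Q s / N)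
        - (d - s ^ 2) * (μ s - Q s / N)) s := by
      have := (d2.mul (dsq.const_add d)).sub (((hasDerivAt_id s).const_mul 2).mul d1)
      refine this.congr_deriv ?_
      simp only [hμ, id]
      field_simp
      ring
    have dμ : HasDerivAt μ (2 * s / (d - s ^ 2) * (μ s - η₂ s)) s := by
      have := ((d1.sub ((hasDerivAt_id s).mul d2)).const_mul 2).div (dsq.const_sub d) hds.ne'
      refine this.congr_deriv ?_
      simp only [hμ, id, Pi.sub_apply, Pi.mul_apply]
      field_simp
      ring
    have d3 : HasDerivAt (fun s => η₁ s / s) ((η₂ s - η₁ s / s) / s) s := by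
      have := d2.div (hasDerivAt_id s) hs.ne'
      refine this.congr_deriv ?_
      simp only [id]
      field_simp
    have dA : HasDerivAt A ((1 - 1 / N) * (N * η₁ s / η s * (η₂ s - Q s / N))
        - b * ((η₂ s - η₁ s / s) / s) - n * (2 * s / (d - s ^ 2) * (μ s - η₂ s))) s :=
      ((dQ.const_mul _).sub (d3.const_mul b)).sub (dμ.const_mul (n : ℝ))
    have dW : HasDerivAt W (W s * (b / s - 2 * n * s / (d - s ^ 2) - (2 * m + 1) * η₁ s / η s)) s := by
      have e1 : HasDerivAt (fun s : ℝ => s ^ b) (b * s ^ (b - 1)) s :=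
        Real.hasDerivAt_rpow_const (Or.inl hs.ne')
      have e2 := (dsq.const_sub d).pow n
      have e3 := d1.rpow_const (p := -(2 * m + 1)) (Or.inl hηs.ne')
      refine ((e1.mul e2).mul e3).congr_deriv ?_
      obtain ⟨k, rfl⟩ : ∃ k, n = k + 1 := ⟨n - 1, by omega⟩
      rw [Real.rpow_sub_one hs.ne', Real.rpow_sub_one hηs.ne']
      simp only [hW, Pi.mul_apply, Pi.pow_apply, Nat.add_sub_cancel]
      field_simp
      ring
    refine ((dW.mul dJ).mul dA).congr_deriv ?_
    have hJ' : J s = s * (d - s ^ 2) * ((η₁ s / s - Q s / N) - (μ s - Q s / N)) := by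
      simp only [hJ, hμ]; field_simp; ring
    have htr : A s = -b * (η₁ s / s - Q s / N) - n * (μ s - Q s / N) := by
      have : N = n + 1 + b := by linarith
      simp only [hA]
      field_simp
      rw [this]
      ring
    have hη2' : η₂ s = A s + Q s / N := by rw [hA1 s hs hsd]; ring
    simp only [Pi.mul_apply]
    rw [hJ', hη2']
    have e4 : 2 * m + 1 = N - 1 := by rw [hNdef]; ring
    rw [e4]
    generalize hR : Q s / N = R at *
    have e5 : η₁ s / s = (η₁ s / s - R) + R := by ring
    have e6 : μ s = (μ s - R) + R := by ring
    generalize hA2 : η₁ s / s - R = A2 at *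
    generalize hA3 : μ s - R = A3 at *
    rw [e5, e6]
    have hbt : A s = -b * A2 - n * A3 := htr
    generalize A s = A1 at *
    clear_value W
    field_simp
    rw [hbt]
    ring
  set F : ℝ → ℝ := fun s => W s * J s * (η₂ s - Q s / N) with hF
  have hsq : ∀ s, s ∈ Ioo 0 √d → 0 < s ∧ s ^ 2 < d := by
    intro s hs
    refine ⟨hs.1, ?_⟩
    have := hs.2
    rwa [Real.lt_sqrt hs.1.le] at this
  have hWpos : ∀ s, 0 < s → s ^ 2 < d → 0 < W s := by
    intro s hs hsd
    have : 0 < d - s ^ 2 := by linarith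
    have := hpos s
    simp only [hW]; positivity
  have dF' : ∀ s ∈ Ioo 0 √d, HasDerivAt F
      (W s * ((d + s ^ 2) * ((η₂ s - Q s / N) ^ 2 + b * (η₁ s / s - Q s / N) ^ 2
        + n * (μ s - Q s / N) ^ 2))) s := by
    intro s hs
    refine (dF s (hsq s hs).1 (hsq s hs).2).congr_of_eventuallyEq ?_
    filter_upwards [isOpen_Ioo.mem_nhds hs] with t ht
    simp only [hF]
    rw [hA1 t (hsq t ht).1 (hsq t ht).2]
  have hFc : ContinuousOn F (Icc 0 √d) := by
    have hQc : Continuous Q :=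
      ((continuous_const.mul (hη₁c.pow 2)).add continuous_const).div hηc fun s => (hpos s).ne'
    have hJc : Continuous J := (hη₁c.mul (by fun_prop)).sub ((by fun_prop : Continuous
      fun s : ℝ => 2 * s).mul hηc)
    have hWc : Continuous W := by
      refine Continuous.mul (Continuous.mul ?_ (by fun_prop)) ?_
      · exact continuous_id.rpow_const fun s => Or.inr (by linarith)
      · exact hηc.rpow_const fun s => Or.inl (hpos s).ne'
    exact ((hWc.mul hJc).mul (hc.sub (hQc.div_const N))).continuousOn
  have hmono : MonotoneOn F (Icc 0 √d) := by
    refine monotoneOn_of_hasDerivWithinAt_nonneg (convex_Icc _ _) hFc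
      (fun s hs => ?_) (f' := fun s => W s * ((d + s ^ 2) * ((η₂ s - Q s / N) ^ 2
        + b * (η₁ s / s - Q s / N) ^ 2 + n * (μ s - Q s / N) ^ 2))) (fun s hs => ?_)
    · rw [interior_Icc] at hs
      exact (dF' s hs).hasDerivWithinAt
    · rw [interior_Icc] at hs
      have := hWpos s (hsq s hs).1 (hsq s hs).2
      have : 0 < b := by linarith
      positivity
  have hsd0 : 0 < √d := Real.sqrt_pos.2 hd
  -- The weight kills both end points: `s^b` at `0`, and `(d - s²)^n` with `n ≥ 1` at `√d`. A
  -- monotone `F` is then identically zero.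
  have hF0 : F 0 = 0 := by
    simp only [hF, hW]
    rw [Real.zero_rpow (by linarith)]
    ring
  have hFd : F √d = 0 := by
    simp only [hF, hW]
    rw [Real.sq_sqrt hd.le, sub_self, zero_pow (by omega)]
    ring
  have hFz : ∀ s ∈ Icc 0 √d, F s = 0 := by
    intro s hs
    have a1 := hmono ⟨le_rfl, hsd0.le⟩ hs hs.1
    have a2 := hmono hs ⟨hsd0.le, le_rfl⟩ hs.2
    linarith
  have hJ0 : ∀ s ∈ Ioo 0 √d, J s = 0 := by
    intro s hs
    obtain ⟨hs0, hsd⟩ := hsq s hs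
    have a1 : HasDerivAt F 0 s := by
      refine (hasDerivAt_const s (0 : ℝ)).congr_of_eventuallyEq ?_
      filter_upwards [isOpen_Ioo.mem_nhds hs] with t ht
      exact hFz t ⟨ht.1.le, ht.2.le⟩
    have a2 := (dF' s hs).unique a1
    have a3 := hWpos s hs0 hsd
    have a4 : 0 < d + s ^ 2 := by positivity
    have a5 : (η₂ s - Q s / N) ^ 2 + b * (η₁ s / s - Q s / N) ^ 2 + n * (μ s - Q s / N) ^ 2 = 0 := by
      rcases mul_eq_zero.1 a2 with h | h
      · exact absurd h a3.ne'
      · rcases mul_eq_zero.1 h with h | h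
        · exact absurd h a4.ne'
        · exact h
    have b1 : 0 ≤ (η₂ s - Q s / N) ^ 2 := sq_nonneg _
    have b2 : 0 ≤ b * (η₁ s / s - Q s / N) ^ 2 := by have : 0 < b := by linarith
                                                     positivity
    have b3 : 0 ≤ n * (μ s - Q s / N) ^ 2 := by positivity
    have c2 : η₁ s / s - Q s / N = 0 := by
      have : b * (η₁ s / s - Q s / N) ^ 2 = 0 := by linarith
      rcases mul_eq_zero.1 this with h | h
      · linarith
      · exact pow_eq_zero_iff (two_ne_zero) |>.1 h
    have c3 : μ s - Q s / N = 0 := by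
      have : n * (μ s - Q s / N) ^ 2 = 0 := by linarith
      rcases mul_eq_zero.1 this with h | h
      · have : (1 : ℝ) ≤ n := by exact_mod_cast hn
        linarith
      · exact pow_eq_zero_iff (two_ne_zero) |>.1 h
    have hds : 0 < d - s ^ 2 := by linarith
    have : J s = s * (d - s ^ 2) * ((η₁ s / s - Q s / N) - (μ s - Q s / N)) := by
      simp only [hJ, hμ]; field_simp; ring
    rw [this, c2, c3]; ring
  set c := η 0 / d with hcdef
  have hcpos : 0 < c := div_pos (hpos 0) hd
  have hform : ∀ s ∈ Icc 0 √d, η s = c * (d + s ^ 2) := by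
    have hg : ∀ s ∈ Icc 0 √d, η s / (d + s ^ 2) = η 0 / (d + 0 ^ 2) := by
      refine constant_of_has_deriv_right_zero ?_ ?_
      · exact (hηc.div (by fun_prop) fun s => by positivity).continuousOn
      · intro s hs
        have hden : HasDerivAt (fun s : ℝ => d + s ^ 2) (2 * s) s := by
          simpa using (hasDerivAt_pow 2 s).const_add d
        refine HasDerivAt.hasDerivWithinAt (((h1 s).div hden (by positivity)).congr_deriv ?_)
        have : J s = 0 := by
          rcases eq_or_lt_of_le hs.1 with h | h
          · -- by continuity at the origin
            have hJc : Continuous J := (hη₁c.mul (by fun_prop)).sub ((by fun_prop : Continuous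
              fun s : ℝ => 2 * s).mul hηc)
            have t1 : Tendsto J (𝓝[>] 0) (𝓝 (J 0)) :=
              hJc.continuousAt.tendsto.mono_left nhdsWithin_le_nhds
            have t2 : Tendsto J (𝓝[>] 0) (𝓝 0) := by
              refine tendsto_const_nhds.congr' ?_
              filter_upwards [Ioo_mem_nhdsGT hsd0] with t ht using (hJ0 t ht).symm
            rw [← h]
            exact tendsto_nhds_unique t1 t2
          · exact hJ0 s ⟨h, hs.2⟩
        have h5 : η₁ s * (d + s ^ 2) - η s * (2 * s) = 0 := by
          rw [← this]; simp only [hJ]; ring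
        rw [h5, zero_div]
    intro s hs
    have := hg s hs
    rw [hcdef, ← div_mul_cancel₀ (η s) (show d + s ^ 2 ≠ 0 by positivity), this]
    simp
  refine ⟨c, hcpos, ?_, fun s hs hsd => hform s ⟨hs, Real.le_sqrt_of_sq_le hsd⟩⟩
  set s := √d / 2 with hs
  have hsI : s ∈ Ioo 0 √d := ⟨by positivity, by rw [hs]; linarith⟩
  obtain ⟨hs0, hsd⟩ := hsq s hsI
  have ev : η =ᶠ[𝓝 s] fun s => c * (d + s ^ 2) := by
    filter_upwards [isOpen_Ioo.mem_nhds hsI] with t ht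
    exact hform t ⟨ht.1.le, ht.2.le⟩
  have hp : ∀ t : ℝ, HasDerivAt (fun s : ℝ => c * (d + s ^ 2)) (c * (2 * t)) t := fun t => by
    simpa using ((hasDerivAt_pow 2 t).const_add d).const_mul c
  have ev1 : η₁ =ᶠ[𝓝 s] fun s => c * (2 * s) := by
    filter_upwards [ev.eventuallyEq_nhds] with t ht
    exact (h1 t).unique ((hp t).congr_of_eventuallyEq ht)
  have e2 : η₂ s = 2 * c := by
    refine (h2 s).unique (HasDerivAt.congr_of_eventuallyEq ?_ ev1)
    refine (((hasDerivAt_id s).const_mul 2).const_mul c).congr_deriv (by ring)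
  have h6 := heq s hs0 hsd
  have hds : 0 < d - s ^ 2 := by linarith
  rw [ev.self_of_nhds, ev1.self_of_nhds, e2] at h6
  have h7 : b = 2 * m + 1 - n := by linarith
  rw [h7] at h6
  field_simp at h6
  have h8 : (d - s ^ 2) * (4 * (m + 1) * m * d * c ^ 2 - 1) = 0 := by linear_combination h6
  rcases mul_eq_zero.1 h8 with h | h
  · exact absurd h hds.ne'
  · linarith

end ODE

/-! ### From the axis to the half-space: classification at the critical exponent. -/

section Classification

variable {V : Type*} [NormedAddCommGroup V] [InnerProductSpace ℝ V] [FiniteDimensional ℝ V]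
variable {e : V} {b m α d : ℝ} {u Ψ : V → ℝ}

/-- On the fixed sphere the symmetry reads `Ψ(t z + x₀) = t² Ψ(t⁻¹ z + x₀)`; differentiating at `t =
1` gives `D = 2Ψ - D`. -/
theorem fderiv_of_fixed_sphere (hd : 0 < d) (hc : ContDiff ℝ 2 Ψ)
    (hsym : ∀ x₀, inner ℝ e x₀ = 0 → ∀ z, z ≠ 0 → 0 ≤ inner ℝ e z →
      (‖x₀‖ ^ 2 + d) * Ψ (z + x₀) = ‖z‖ ^ 2 * Ψ (((‖x₀‖ ^ 2 + d) / ‖z‖ ^ 2) • z + x₀))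
    {x₀ z : V} (hx₀ : inner ℝ e x₀ = 0) (hs : 0 ≤ inner ℝ e z) (hz : ‖z‖ ^ 2 = ‖x₀‖ ^ 2 + d) :
    fderiv ℝ Ψ (z + x₀) z = Ψ (z + x₀) := by
  have hq : 0 < ‖z‖ ^ 2 := by rw [hz]; positivity
  have hz0 : z ≠ 0 := by rintro rfl; simp at hq
  have hzn : ‖z‖ ≠ 0 := norm_ne_zero_iff.2 hz0
  have d1 : HasDerivAt (fun t : ℝ => Ψ (t • z + x₀)) (fderiv ℝ Ψ (z + x₀) z) 1 := by
    have h2 : HasDerivAt (fun t : ℝ => t • z + x₀) z 1 := by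
      simpa using ((hasDerivAt_id (1 : ℝ)).smul_const z).add_const x₀
    have h3 : HasFDerivAt Ψ (fderiv ℝ Ψ (z + x₀)) ((1 : ℝ) • z + x₀) := by
      rw [one_smul]; exact (hc.differentiable (by norm_num) _).hasFDerivAt
    exact h3.comp_hasDerivAt 1 h2
  have dinv : HasDerivAt (fun t : ℝ => t⁻¹) (-1) 1 := by
    simpa using hasDerivAt_inv (one_ne_zero (α := ℝ))
  have d2 : HasDerivAt (fun t : ℝ => Ψ (t⁻¹ • z + x₀)) (-fderiv ℝ Ψ (z + x₀) z) 1 := by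
    have d1' : HasDerivAt (fun t : ℝ => Ψ (t • z + x₀)) (fderiv ℝ Ψ (z + x₀) z) (1 : ℝ)⁻¹ := by
      simpa using d1
    have := d1'.comp 1 dinv
    simpa [Function.comp_def] using this
  have d3 := ((hasDerivAt_pow 2 (1 : ℝ)).mul d2)
  have d4 := d1.unique (d3.congr_of_eventuallyEq ?_)
  · simp only [Nat.cast_ofNat, one_pow, inv_one, one_smul] at d4
    linarith
  · filter_upwards [lt_mem_nhds (one_pos (α := ℝ))] with t ht
    have h1 := hsym x₀ hx₀ (t • z) (smul_ne_zero ht.ne' hz0)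
      (by rw [inner_smul_right]; positivity)
    rw [← hz, norm_smul, mul_pow, Real.norm_eq_abs, sq_abs, smul_smul,
      show ‖z‖ ^ 2 / (t ^ 2 * ‖z‖ ^ 2) * t = t⁻¹ by field_simp] at h1
    simp only [Pi.mul_apply]
    have h2 : ‖z‖ ^ 2 * (Ψ (t • z + x₀) - t ^ 2 * Ψ (t⁻¹ • z + x₀)) = 0 := by linarith
    rcases mul_eq_zero.1 h2 with h | h
    · exact absurd h hq.ne'
    · linarith

/-- Each point `s e + τ ω` with `τ ≠ 0` lies on a fixed sphere centred on `ℝω`, whose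
normal-derivative relation is a first-order identity in `τ`. Its value and derivative at `τ = 0`
give the two claims. -/
theorem axis_derivatives (he : ‖e‖ = 1) (hd : 0 < d) (hc : ContDiff ℝ 2 Ψ)
    (hsym : ∀ x₀, inner ℝ e x₀ = 0 → ∀ z, z ≠ 0 → 0 ≤ inner ℝ e z →
      (‖x₀‖ ^ 2 + d) * Ψ (z + x₀) = ‖z‖ ^ 2 * Ψ (((‖x₀‖ ^ 2 + d) / ‖z‖ ^ 2) • z + x₀))
    {ω : V} (hω : inner ℝ e ω = 0) (hω1 : ‖ω‖ = 1) {s : ℝ} (hs : 0 ≤ s) (hsd : s ^ 2 < d) :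
    fderiv ℝ Ψ (s • e) ω = 0 ∧ fderiv ℝ (fderiv ℝ Ψ) (s • e) ω ω
      = 2 * (Ψ (s • e) - s * fderiv ℝ Ψ (s • e) e) / (d - s ^ 2) := by
  have hds : 0 < d - s ^ 2 := by linarith
  set y : ℝ → V := fun τ => s • e + τ • ω with hy
  have hyc : Continuous y := by fun_prop
  set k : ℝ → ℝ := fun τ => Ψ (y τ) - s * fderiv ℝ Ψ (y τ) e with hk
  have hdc : Continuous (fderiv ℝ Ψ) := hc.continuous_fderiv (by norm_num)
  have hkc : Continuous k := (hc.continuous.comp hyc).sub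
    (continuous_const.mul ((hdc.comp hyc).clm_apply continuous_const))
  set p : ℝ → ℝ := fun τ => fderiv ℝ Ψ (y τ) ω with hp
  have hpc : Continuous p := (hdc.comp hyc).clm_apply continuous_const
  have hne : ∀ τ, τ ≠ 0 → (τ ^ 2 + d - s ^ 2) * p τ = 2 * τ * k τ := by
    intro τ hτ
    -- The solution of `s² + (τ - c)² = c² + d`: the centre `c ω` whose sphere contains `s e + τ ω`.
    set c := (τ ^ 2 + s ^ 2 - d) / (2 * τ) with hcdef
    have hx : inner ℝ e (c • ω) = 0 := by rw [inner_smul_right, hω, mul_zero]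
    have hz : s • e + (τ - c) • ω + c • ω = y τ := by
      simp only [hy, sub_smul]; abel
    have hn : ‖s • e + (τ - c) • ω‖ ^ 2 = s ^ 2 + (τ - c) ^ 2 := by
      rw [norm_add_sq_real, inner_smul_left, inner_smul_right, hω, norm_smul, norm_smul, he, hω1]
      simp
    have h1 := fderiv_of_fixed_sphere hd hc hsym hx (z := s • e + (τ - c) • ω) (by
      rw [inner_add_right, inner_smul_right, inner_smul_right, hω, real_inner_self_eq_norm_sq, he]
      linarith) (by
      rw [hn, norm_smul, hω1, mul_pow, Real.norm_eq_abs, sq_abs, hcdef]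
      field_simp
      ring)
    rw [hz, map_add, map_smul, map_smul, smul_eq_mul, smul_eq_mul] at h1
    have h2 : τ - c = (τ ^ 2 + d - s ^ 2) / (2 * τ) := by rw [hcdef]; field_simp; ring
    rw [h2] at h1
    simp only [hk, hp]
    field_simp at h1
    linarith
  have hall : ∀ τ, (τ ^ 2 + d - s ^ 2) * p τ = 2 * τ * k τ := by
    have h1 : (fun τ => (τ ^ 2 + d - s ^ 2) * p τ) = fun τ => 2 * τ * k τ := by
      refine Continuous.ext_on (dense_compl_singleton (0 : ℝ)) (by fun_prop) (by fun_prop) ?_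
      exact fun τ hτ => hne τ hτ
    exact fun τ => congrFun h1 τ
  have hp0 : p 0 = 0 := by
    have := hall 0
    rw [mul_zero, zero_mul] at this
    rcases mul_eq_zero.1 this with h | h
    · nlinarith
    · exact h
  have hy0 : y 0 = s • e := by simp [hy]
  refine ⟨by rw [← hy0]; exact hp0, ?_⟩
  have dp : HasDerivAt p (fderiv ℝ (fderiv ℝ Ψ) (s • e) ω ω) 0 := by
    have := hasDerivAt_fderiv_comp (f := Ψ) (γ := y) (γ' := fun _ => ω) (γ'' := 0) (t := 0)
      hc.contDiffAt (hasDerivAt_line (s • e) ω 0) (hasDerivAt_const _ _)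
    simpa [hy0] using this
  have dl := ((((hasDerivAt_pow 2 (0 : ℝ)).add_const d).sub_const (s ^ 2)).mul dp)
  have dr : HasDerivAt (fun τ : ℝ => 2 * τ * k τ) (2 * k 0) 0 := by
    rw [hasDerivAt_iff_tendsto_slope]
    have h1 : Tendsto (fun τ : ℝ => 2 * k τ) (𝓝[≠] 0) (𝓝 (2 * k 0)) :=
      ((continuous_const.mul hkc).tendsto 0).mono_left nhdsWithin_le_nhds
    refine h1.congr' ?_
    filter_upwards [self_mem_nhdsWithin] with τ hτ
    have : τ ≠ 0 := hτ
    rw [slope_def_field]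
    field_simp
    ring
  have h5 := dl.unique (dr.congr_of_eventuallyEq (Eventually.of_forall hall))
  simp only [hp0, hk, hy0] at h5
  rw [eq_div_iff hds.ne']
  simp only [Nat.cast_ofNat, mul_zero, zero_add] at h5
  linarith

/-- On the axis the gradient is vertical and the Hessian is a multiple of the identity on `e⊥`, so
the equation for `Ψ` closes up into the ODE of `axis_rigidity`. -/
theorem profile_eq_on_axis (he : ‖e‖ = 1) (hb : 1 < b) (hm0 : 0 < m)
    (hm : (finrank ℝ V : ℝ) + b = 2 * m + 2) (hV : 2 ≤ finrank ℝ V) (hd : 0 < d)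
    (hc : ContDiff ℝ 2 Ψ) (hpos : ∀ z, 0 < Ψ z)
    (heq : ∀ z, 0 < inner ℝ e z → Ψ z * wlap e b Ψ z = (m + 1) * gradSq Ψ z + 1 / m)
    (hsym : ∀ x₀, inner ℝ e x₀ = 0 → ∀ z, z ≠ 0 → 0 ≤ inner ℝ e z →
      (‖x₀‖ ^ 2 + d) * Ψ (z + x₀) = ‖z‖ ^ 2 * Ψ (((‖x₀‖ ^ 2 + d) / ‖z‖ ^ 2) • z + x₀)) :
    ∃ c, 0 < c ∧ 4 * (m + 1) * m * d * c ^ 2 = 1 ∧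
      ∀ s : ℝ, 0 ≤ s → s ^ 2 ≤ d → Ψ (s • e) = c * (d + s ^ 2) := by
  have hline : ∀ t : ℝ, HasDerivAt (fun t : ℝ => t • e) e t := fun t => by
    simpa using (hasDerivAt_id t).smul_const e
  have hcl : Continuous fun t : ℝ => t • e := by fun_prop
  obtain ⟨n, hn⟩ : ∃ n, finrank ℝ V = n + 1 := ⟨finrank ℝ V - 1, by omega⟩
  refine axis_rigidity (n := n) (b := b) (m := m) (d := d) (η := fun s => Ψ (s • e))
    (η₁ := fun s => fderiv ℝ Ψ (s • e) e) (η₂ := fun s => fderiv ℝ (fderiv ℝ Ψ) (s • e) e e)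
    hb hm0 (by omega) hd (by rw [← hm, hn]; push_cast; ring) (fun s => hpos _)
    (fun s => (hc.differentiable (by norm_num) _).hasFDerivAt.comp_hasDerivAt s (hline s))
    (fun s => ?_) ?_ fun s hs hsd => ?_
  · have := hasDerivAt_fderiv_comp (γ := fun t : ℝ => t • e) (γ' := fun _ => e) (γ'' := 0)
      (t := s) hc.contDiffAt (hline s) (hasDerivAt_const s e)
    simpa using this
  · have h1 : Continuous (fderiv ℝ (fderiv ℝ Ψ)) :=
      (hc.fderiv_right (m := 1) (by norm_num)).continuous_fderiv (by norm_num)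
    exact ((h1.comp hcl).clm_apply continuous_const).clm_apply continuous_const
  · have hin : inner ℝ e (s • e) = s := by
      rw [inner_smul_right, real_inner_self_eq_norm_sq, he]; ring
    have hax := fun ω hω hω1 => axis_derivatives (ω := ω) he hd hc hsym hω hω1 hs.le hsd
    set κ := 2 * (Ψ (s • e) - s * fderiv ℝ Ψ (s • e) e) / (d - s ^ 2) with hκ
    have hfd : ∀ v, inner ℝ e v = 0 → fderiv ℝ Ψ (s • e) v = 0 ∧
        fderiv ℝ (fderiv ℝ Ψ) (s • e) v v = κ * ‖v‖ ^ 2 := by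
      intro v hv
      by_cases hv0 : v = 0
      · simp [hv0]
      have hvn : ‖v‖ ≠ 0 := norm_ne_zero_iff.2 hv0
      obtain ⟨h1, h2⟩ := hax (‖v‖⁻¹ • v) (by rw [inner_smul_right, hv, mul_zero])
        (by rw [norm_smul]; simp [hvn])
      simp only [map_smul, smul_apply, smul_eq_mul] at h1 h2
      refine ⟨?_, ?_⟩
      · rcases mul_eq_zero.1 h1 with h | h
        · exact absurd h (inv_ne_zero hvn)
        · exact h
      · field_simp at h2
        linarith
    have hlap := lap_eq_of_orthogonal he fun v hv => (hfd v hv).2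
    have hgrad : gradSq Ψ (s • e) = fderiv ℝ Ψ (s • e) e ^ 2 := by
      have h1 : ∀ v, fderiv ℝ Ψ (s • e) v = inner ℝ e v * fderiv ℝ Ψ (s • e) e := by
        intro v
        have h2 := (hfd (v - inner ℝ e v • e) (by
          rw [inner_sub_right, inner_smul_right, real_inner_self_eq_norm_sq, he]; ring)).1
        rw [map_sub, map_smul, smul_eq_mul] at h2
        linarith
      have h3 := sum_inner_sq e
      rw [he] at h3
      rw [gradSq, Finset.sum_congr rfl fun i _ => by rw [h1, mul_pow], ← Finset.sum_mul, h3]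
      ring
    have h4 := heq (s • e) (by rw [hin]; exact hs)
    rw [hgrad, wlap, hlap, hin, hn] at h4
    rw [← h4, hκ]
    push_cast
    ring

theorem profile_eq_quadratic (he : ‖e‖ = 1) (hb : 1 < b) (hm0 : 0 < m)
    (hm : (finrank ℝ V : ℝ) + b = 2 * m + 2) (hV : 2 ≤ finrank ℝ V) (hd : 0 < d)
    (hc : ContDiff ℝ 2 Ψ) (hpos : ∀ z, 0 < Ψ z)
    (heq : ∀ z, 0 < inner ℝ e z → Ψ z * wlap e b Ψ z = (m + 1) * gradSq Ψ z + 1 / m)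
    (hsym : ∀ x₀, inner ℝ e x₀ = 0 → ∀ z, z ≠ 0 → 0 ≤ inner ℝ e z →
      (‖x₀‖ ^ 2 + d) * Ψ (z + x₀) = ‖z‖ ^ 2 * Ψ (((‖x₀‖ ^ 2 + d) / ‖z‖ ^ 2) • z + x₀)) :
    ∃ c, 0 < c ∧ 4 * (m + 1) * m * d * c ^ 2 = 1 ∧
      ∀ z, 0 ≤ inner ℝ e z → Ψ z = c * (d + ‖z‖ ^ 2) := by
  obtain ⟨c, hc0, hc1, hax⟩ := profile_eq_on_axis he hb hm0 hm hV hd hc hpos heq hsym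
  refine ⟨c, hc0, hc1, ?_⟩
  have hse : ∀ s : ℝ, inner ℝ e (s • e) = s := fun s => by
    rw [inner_smul_right, real_inner_self_eq_norm_sq, he]; ring
  have hsn : ∀ s : ℝ, ‖s • e‖ ^ 2 = s ^ 2 := fun s => by
    rw [norm_smul, he, Real.norm_eq_abs, mul_one, sq_abs]
  have haxis : ∀ s : ℝ, 0 ≤ s → Ψ (s • e) = c * (d + s ^ 2) := by
    intro s hs
    rcases le_total (s ^ 2) d with h | h
    · exact hax s hs h
    -- The inversion about the origin exchanges the two sides of `√d` on the axis.
    · have hs2 : 0 < s ^ 2 := hd.trans_le h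
      have hs0 : 0 < s := lt_of_le_of_ne hs (by rintro rfl; simp at hs2)
      have h1 := hsym 0 (inner_zero_right e) (s • e)
        (smul_ne_zero hs0.ne' (by rintro rfl; simp at he)) (by rw [hse]; exact hs)
      rw [norm_zero, hsn, smul_smul, add_zero, add_zero] at h1
      have h2 := hax ((0 ^ 2 + d) / s ^ 2 * s) (by positivity) (by
        have : ((0 ^ 2 + d) / s ^ 2 * s) ^ 2 = d * (d / s ^ 2) := by field_simp; ring
        rw [this]
        have : d / s ^ 2 ≤ 1 := by rw [div_le_one hs2]; exact h
        nlinarith)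
      rw [h2] at h1
      field_simp at h1
      have h3 : d * (Ψ (s • e) - c * (d + s ^ 2)) = 0 := by linear_combination h1
      rcases mul_eq_zero.1 h3 with h | h
      · exact absurd h hd.ne'
      · linarith
  intro z hz
  set s := inner ℝ e z with hs
  set x := z - s • e with hx
  have hxe : inner ℝ e x = 0 := by rw [hx, inner_sub_right, hse, hs, sub_self]
  have hzx : z = x + s • e := by rw [hx]; abel
  have hnorm : ∀ t r : ℝ, ‖t • x + r • e‖ ^ 2 = t ^ 2 * ‖x‖ ^ 2 + r ^ 2 := by
    intro t r
    rw [norm_add_sq_real, inner_smul_left, inner_smul_right, real_inner_comm, hxe, hsn, norm_smul,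
      mul_pow, Real.norm_eq_abs, sq_abs]
    ring
  have hzn : ‖z‖ ^ 2 = ‖x‖ ^ 2 + s ^ 2 := by
    have := hnorm 1 s
    rw [one_smul, ← hzx] at this
    rw [this]; ring
  by_cases hx0 : x = 0
  · have : z = s • e := by rw [hzx, hx0, zero_add]
    rw [this, haxis s hz, hsn]
  have hτ : 0 < ‖x‖ ^ 2 := pow_pos (norm_pos_iff.2 hx0) 2
  -- an inversion centred on the line through `x` that maps `z` to the axis
  obtain ⟨k, hk0, hk⟩ : ∃ k < 0, ‖x‖ ^ 2 * k ^ 2 + k * (d - ‖x‖ ^ 2 - s ^ 2) - d = 0 := by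
    set B := d - ‖x‖ ^ 2 - s ^ 2 with hB
    have h1 : 0 ≤ B ^ 2 + 4 * ‖x‖ ^ 2 * d := by positivity
    have h2 : |B| < √(B ^ 2 + 4 * ‖x‖ ^ 2 * d) := by
      rw [Real.lt_sqrt (abs_nonneg _), sq_abs]
      have : 0 < 4 * ‖x‖ ^ 2 * d := by positivity
      linarith
    have h3 := neg_abs_le B
    refine ⟨(-B - √(B ^ 2 + 4 * ‖x‖ ^ 2 * d)) / (2 * ‖x‖ ^ 2),
      div_neg_of_neg_of_pos (by linarith) (by positivity), ?_⟩
    have h4 := Real.sq_sqrt h1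
    generalize √(B ^ 2 + 4 * ‖x‖ ^ 2 * d) = S at h4 ⊢
    field_simp
    linear_combination h4
  have hk1 : k - 1 < 0 := by linarith
  have hy := hsym (k • x) (by rw [inner_smul_right, hxe, mul_zero]) ((1 - k) • x + s • e) (by
      intro h0
      have h1 := hnorm (1 - k) s
      rw [h0, norm_zero] at h1
      have : 0 < (1 - k) ^ 2 * ‖x‖ ^ 2 := mul_pos (by nlinarith) hτ
      nlinarith [sq_nonneg s])
    (by rw [inner_add_right, inner_smul_right, hxe, hse]; linarith)
  have hq : 0 < (1 - k) ^ 2 * ‖x‖ ^ 2 + s ^ 2 := by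
    have : 0 < (1 - k) ^ 2 * ‖x‖ ^ 2 := mul_pos (by nlinarith) hτ
    positivity
  have hkx : ‖k • x‖ ^ 2 = k ^ 2 * ‖x‖ ^ 2 := by
    rw [norm_smul, mul_pow, Real.norm_eq_abs, sq_abs]
  -- The quadratic equation for `k` says exactly this: with inversion factor `k/(k - 1)` the
  -- horizontal component `κ(1 - k) + k` of the image vanishes. Negativity of `k` makes the factor
  -- positive.
  have hκ : (k ^ 2 * ‖x‖ ^ 2 + d) / ((1 - k) ^ 2 * ‖x‖ ^ 2 + s ^ 2) = k / (k - 1) := by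
    rw [div_eq_div_iff hq.ne' hk1.ne]
    linear_combination hk
  have e1 : (1 - k) • x + s • e + k • x = z := by
    rw [hzx, sub_smul, one_smul]; abel
  have e2 : (k / (k - 1)) • ((1 - k) • x + s • e) + k • x = (k / (k - 1) * s) • e := by
    rw [smul_add, smul_smul, smul_smul, add_right_comm, ← add_smul]
    have : k / (k - 1) * (1 - k) + k = 0 := by
      have := hk1.ne
      field_simp
      ring
    rw [this, zero_smul, zero_add]
  have hκ0 : 0 < k / (k - 1) := div_pos_of_neg_of_neg hk0 hk1
  rw [hkx, hnorm, e1, hκ, e2, haxis _ (by positivity)] at hy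
  have hA : k ^ 2 * ‖x‖ ^ 2 + d = k / (k - 1) * ((1 - k) ^ 2 * ‖x‖ ^ 2 + s ^ 2) :=
    (div_eq_iff hq.ne').1 hκ
  rw [hA] at hy
  have hkne := hk1.ne
  have h5 : d + (k / (k - 1) * s) ^ 2 = k / (k - 1) * (d + (‖x‖ ^ 2 + s ^ 2)) := by
    field_simp
    linear_combination -hk
  rw [h5] at hy
  rw [hzn]
  have h6 : k / (k - 1) * ((1 - k) ^ 2 * ‖x‖ ^ 2 + s ^ 2) ≠ 0 := (mul_pos hκ0 hq).ne'
  have h7 : k / (k - 1) * ((1 - k) ^ 2 * ‖x‖ ^ 2 + s ^ 2)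
      * (Ψ z - c * (d + (‖x‖ ^ 2 + s ^ 2))) = 0 := by linear_combination hy
  rcases mul_eq_zero.1 h7 with h | h
  · exact absurd h h6
  · linarith

/-- Classification of the positive solutions with critical exponent. -/
theorem IsPosSolution.eq_of_critical (he : ‖e‖ = 1) (hb : 1 < b)
    (hm : (finrank ℝ V : ℝ) + b = 2 * m + 2) (hV : 2 ≤ finrank ℝ V) (hα : 1 < α)
    (hα2 : m * α = m + 2) (hu : IsPosSolution e b α u) :
    ∃ (x : V) (d c : ℝ), inner ℝ e x = 0 ∧ 0 < d ∧ 0 < c ∧ 4 * (m + 1) * m * d * c ^ 2 = 1 ∧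
      ∀ z, 0 ≤ inner ℝ e z → u z = (c * (d + ‖z - x‖ ^ 2)) ^ (-m) := by
  have hm0 := exponent_pos he hb hm
  obtain ⟨x, d, hx, hd, hsym⟩ := exists_center (e := e) he (profile_contDiff (m := m) hu.pos hu.contDiff)
    (profile_pos hu.pos) fun x₀ hx₀ => by
      obtain ⟨ρ, hρ, h⟩ := exists_kelvin_eq he hb hm hV hα hα2.le hu x₀ hx₀
      exact ⟨ρ, hρ, fun z hz hs => profile_symmetry hm0 hu.pos hρ h hz hs⟩
  have hv := hu.translate hx
  obtain ⟨c, hc, hc1, hq⟩ := profile_eq_quadratic he hb hm0 hm hV hd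
    (profile_contDiff (m := m) hv.pos hv.contDiff) (profile_pos hv.pos)
    (fun z hz => profile_equation hm0 hα2 hv hz) fun x₀ hx₀ z hz hs => by
      have h1 := hsym (x₀ + x) (by rw [inner_add_right, hx₀, hx, add_zero]) z hz hs
      rw [add_sub_cancel_right] at h1
      simp only [profile] at h1 ⊢
      simpa only [add_assoc] using h1
  refine ⟨x, d, c, hx, hd, hc, hc1, fun z hz => ?_⟩
  have h1 := hq (z - x) (by rw [inner_sub_right, hx, sub_zero]; exact hz)
  simp only [profile, sub_add_cancel] at h1
  rw [← h1, ← Real.rpow_mul (hu.pos z).le, show -(1 / m) * -m = 1 by field_simp, Real.rpow_one]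

end Classification

/-! ### Connectedness of the half-space. -/

section HalfSpace

variable {V : Type*} [NormedAddCommGroup V] [InnerProductSpace ℝ V]

theorem isPreconnected_halfSpace (e : V) : IsPreconnected {z : V | 0 < inner ℝ e z} :=
  (convex_halfSpace_gt (f := fun z : V => inner ℝ e z)
    ⟨fun x y => inner_add_right e x y, fun c x => inner_smul_right e x c⟩ 0).isPreconnected

end HalfSpace

/-! ### The substitution `y = s²/4` and the return to the original variables. -/

section Coordinates

variable {n : ℕ} {a α : ℝ} {u : EuclideanSpace ℝ (Fin n) × ℝ → ℝ}

/-- The Euclidean space of the variables `(x, s)`, where `y = s ^ 2 / 4`. -/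
abbrev LiftSpace (n : ℕ) : Type := WithLp 2 (EuclideanSpace ℝ (Fin n) × ℝ)

/-- The unit vector in the direction of `s`. -/
def vert (n : ℕ) : LiftSpace n := WithLp.toLp 2 (0, 1)

/-- The function `(x, s) ↦ u (x, s ^ 2 / 4)`. -/
def lift (u : EuclideanSpace ℝ (Fin n) × ℝ → ℝ) (z : LiftSpace n) : ℝ :=
  u (z.fst, z.snd ^ 2 / 4)

theorem norm_vert : ‖vert n‖ = 1 := by
  have h : ‖vert n‖ ^ 2 = 1 := by
    rw [WithLp.prod_norm_sq_eq_of_L2]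
    simp [vert]
  nlinarith [norm_nonneg (vert n)]

theorem inner_vert (z : LiftSpace n) : inner ℝ (vert n) z = z.snd := by
  rw [WithLp.prod_inner_apply]
  simp [vert]

theorem finrank_liftSpace : finrank ℝ (LiftSpace n) = n + 1 := by
  rw [(WithLp.linearEquiv 2 ℝ (EuclideanSpace ℝ (Fin n) × ℝ)).finrank_eq]
  simp

theorem IsSolution.contDiffAt (hu : IsSolution n a α u) {p : EuclideanSpace ℝ (Fin n) × ℝ}
    (hp : 0 < p.2) : ContDiffAt ℝ 2 u p := by
  refine hu.contDiffOn.contDiffAt (mem_of_superset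
    ((isOpen_lt continuous_const continuous_snd).mem_nhds hp) fun q hq => ?_)
  exact le_of_lt (show 0 < q.2 from hq)

theorem IsSolution.lift_contDiff (hu : IsSolution n a α u) : ContDiff ℝ 2 (lift u) := by
  have h1 : ContDiff ℝ 2 fun z : LiftSpace n => z.fst :=
    (WithLp.fstL 2 ℝ (EuclideanSpace ℝ (Fin n)) ℝ).contDiff
  have h2 : ContDiff ℝ 2 fun z : LiftSpace n => z.snd :=
    (WithLp.sndL 2 ℝ (EuclideanSpace ℝ (Fin n)) ℝ).contDiff
  exact hu.contDiffOn.comp_contDiff (h1.prodMk ((h2.pow 2).div_const 4)) fun z =>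
    show 0 ≤ z.snd ^ 2 / 4 by positivity

theorem fderiv_fderiv_lift_horizontal (hu : IsSolution n a α u) {z : LiftSpace n}
    (hz : 0 < z.snd) (v : EuclideanSpace ℝ (Fin n)) :
    fderiv ℝ (fderiv ℝ (lift u)) z (WithLp.toLp 2 (v, 0)) (WithLp.toLp 2 (v, 0))
      = fderiv ℝ (fderiv ℝ fun x => u (x, z.snd ^ 2 / 4)) z.fst v v := by
  have hf : ContDiffAt ℝ 2 (fun x => u (x, z.snd ^ 2 / 4)) z.fst :=
    (hu.contDiffAt (p := (z.fst, z.snd ^ 2 / 4)) (show 0 < z.snd ^ 2 / 4 by positivity)).comp z.fst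
      (contDiffAt_id.prodMk contDiffAt_const)
  have h0 : z.fst + (0 : ℝ) • v = z.fst := by simp
  have e1 := eventually_hasDerivAt_comp (γ := fun t : ℝ => z.fst + t • v) (γ' := fun _ => v)
    (t := 0) (by simpa [h0] using hf) (Eventually.of_forall (hasDerivAt_line z.fst v))
  have e2 := hasDerivAt_fderiv_comp (γ := fun t : ℝ => z.fst + t • v) (γ' := fun _ => v)
    (γ'' := 0) (t := 0) (by simpa [h0] using hf) (hasDerivAt_line z.fst v 0)
    (hasDerivAt_const 0 v)
  simp only [h0, map_zero, add_zero] at e2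
  refine fderiv_fderiv_eq_of_line hu.lift_contDiff.contDiffAt ?_ e2
  simpa [lift] using e1

theorem line_vertical (z : LiftSpace n) (t : ℝ) :
    lift u (z + t • vert n) = u (z.fst, (z.snd + t) ^ 2 / 4) := by
  simp [lift, vert]

theorem IsSolution.slice_derivs (hu : IsSolution n a α u) (x : EuclideanSpace ℝ (Fin n)) {y : ℝ}
    (hy : 0 < y) : HasDerivAt (fun s => u (x, s)) (deriv (fun s => u (x, s)) y) y ∧
      HasDerivAt (deriv fun s => u (x, s)) (iteratedDeriv 2 (fun s => u (x, s)) y) y := by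
  have hf : ContDiffAt ℝ 2 (fun s => u (x, s)) y :=
    (hu.contDiffAt (p := (x, y)) hy).comp y (contDiffAt_const.prodMk contDiffAt_id)
  refine ⟨(hf.differentiableAt (by norm_num)).hasDerivAt, ?_⟩
  rw [iteratedDeriv_succ, iteratedDeriv_one]
  have h : ContDiffAt ℝ 1 (deriv fun s => u (x, s)) y := hf.derivWithin (m := 1) (by norm_num)
  exact (h.differentiableAt (by norm_num)).hasDerivAt

/-- By the chain rule `∂ₛ²` becomes `y ∂ᵧ² + ½ ∂ᵧ`, and `(b/s) ∂ₛ` becomes `(b/2) ∂ᵧ`; with `b = 2a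
- 1` the first-order terms add up to `a ∂ᵧ`. -/
theorem IsSolution.wlap_lift (hu : IsSolution n a α u) {z : LiftSpace n} (hz : 0 < z.snd) :
    wlap (vert n) (2 * a - 1) (lift u) z = -lift u z ^ α := by
  have hc := hu.lift_contDiff.contDiffAt (x := z)
  set g : ℝ → ℝ := fun s => u (z.fst, s) with hg
  have hq : ∀ t : ℝ, HasDerivAt (fun t : ℝ => (z.snd + t) ^ 2 / 4) ((z.snd + t) / 2) t := by
    intro t
    have := (((hasDerivAt_id t).const_add z.snd).pow 2).div_const 4
    refine HasDerivAt.congr_deriv this ?_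
    simp; ring
  have hpos : ∀ᶠ t : ℝ in 𝓝 0, 0 < z.snd + t := by
    have : ContinuousAt (fun t : ℝ => z.snd + t) 0 := by fun_prop
    exact this.eventually (lt_mem_nhds (by simpa using hz))
  have h1 : ∀ᶠ t in 𝓝 (0 : ℝ), HasDerivAt (fun t : ℝ => lift u (z + t • vert n))
      (deriv g ((z.snd + t) ^ 2 / 4) * ((z.snd + t) / 2)) t := by
    filter_upwards [hpos] with t ht
    simp only [line_vertical]
    exact (hu.slice_derivs z.fst (by positivity)).1.comp t (hq t)
  have h2 : HasDerivAt (fun t : ℝ => deriv g ((z.snd + t) ^ 2 / 4) * ((z.snd + t) / 2))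
      (z.snd ^ 2 / 4 * iteratedDeriv 2 g (z.snd ^ 2 / 4) + deriv g (z.snd ^ 2 / 4) / 2) 0 := by
    have a1 := (hu.slice_derivs z.fst (y := (z.snd + 0) ^ 2 / 4)
      (by rw [add_zero]; positivity)).2.comp 0 (hq 0)
    have a2 := ((hasDerivAt_id (0 : ℝ)).const_add z.snd).div_const 2
    refine HasDerivAt.congr_deriv (a1.mul a2) ?_
    simp only [add_zero, Function.comp]
    ring
  have hV := fderiv_fderiv_eq_of_line hc h1 h2
  have hD := fderiv_eq_of_line hc h1.self_of_nhds
  have hL : lap (lift u) z = Laplacian.laplacian (fun x => u (x, z.snd ^ 2 / 4)) z.fst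
      + (z.snd ^ 2 / 4 * iteratedDeriv 2 g (z.snd ^ 2 / 4) + deriv g (z.snd ^ 2 / 4) / 2) := by
    rw [laplacian_eq_sum (stdOrthonormalBasis ℝ (EuclideanSpace ℝ (Fin n))),
      lap_eq_sum ((stdOrthonormalBasis ℝ (EuclideanSpace ℝ (Fin n))).prod
      (OrthonormalBasis.singleton Unit ℝ)), Fintype.sum_sum_type]
    congr 1
    · refine Finset.sum_congr rfl fun i _ => ?_
      rw [← fderiv_fderiv_lift_horizontal hu hz]
      simp
    · rw [← hV]
      simp [vert]
  have heq := hu.equation z.fst (z.snd ^ 2 / 4) (by positivity)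
  rw [wlap, hL, hD, inner_vert, add_zero]
  have : lift u z = u (z.fst, z.snd ^ 2 / 4) := rfl
  rw [this]
  have hs : (2 * a - 1) / z.snd * (deriv g (z.snd ^ 2 / 4) * (z.snd / 2))
      = (a - 1 / 2) * deriv g (z.snd ^ 2 / 4) := by
    field_simp
  rw [hs]
  linear_combination heq

theorem IsSolution.lift_nonneg (hu : IsSolution n a α u) (z : LiftSpace n) : 0 ≤ lift u z :=
  hu.nonneg _ (show 0 ≤ z.snd ^ 2 / 4 by positivity)

theorem eq_lift (x : EuclideanSpace ℝ (Fin n)) {y : ℝ} (hy : 0 ≤ y) :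
    u (x, y) = lift u (WithLp.toLp 2 (x, 2 * √y)) := by
  have : (2 * √y) ^ 2 / 4 = y := by rw [mul_pow, Real.sq_sqrt hy]; ring
  simp [lift, this]

/-- A solution vanishes identically or lifts to a positive solution. -/
theorem IsSolution.eq_zero_or_isPosSolution (ha : 1 < a) (hu : IsSolution n a α u) :
    (∀ p ∈ closedHalfSpace n, u p = 0) ∨ IsPosSolution (vert n) (2 * a - 1) α (lift u) := by
  have hb : 1 < 2 * a - 1 := by linarith
  have hopen := isOpen_halfSpace (vert n)
  have hsuper : ∀ z : LiftSpace n, 0 < inner ℝ (vert n) z →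
      0 ≤ lift u z ∧ ContDiffAt ℝ 2 (lift u) z ∧ wlap (vert n) (2 * a - 1) (lift u) z ≤ 0 := by
    intro z hz
    rw [inner_vert] at hz
    refine ⟨hu.lift_nonneg z, hu.lift_contDiff.contDiffAt, ?_⟩
    rw [hu.wlap_lift hz]
    exact neg_nonpos.2 (Real.rpow_nonneg (hu.lift_nonneg z) _)
  by_cases hex : ∃ p : LiftSpace n, 0 < inner ℝ (vert n) p ∧ 0 < lift u p
  · obtain ⟨p, hp, hup⟩ := hex
    right
    have h1 : ∀ z : LiftSpace n, 0 < inner ℝ (vert n) z → 0 < lift u z := fun z hz =>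
      pos_of_isPreconnected norm_vert hb hopen (isPreconnected_halfSpace _) (fun z hz => hz)
        (fun z hz => hsuper z hz) hp hup hz
    have h2 : ∀ z : LiftSpace n, 0 ≤ inner ℝ (vert n) z → 0 < lift u z := by
      intro z hz
      rcases hz.lt_or_eq with hz | hz
      · exact h1 z hz
      · exact pos_at_boundary norm_vert hb one_pos hz.symm hu.lift_contDiff.continuous.continuousOn
          fun w _ hw => ⟨h1 w hw, (hsuper w hw).2⟩
    refine ⟨hu.lift_contDiff, fun z => ?_, fun z hz => hu.wlap_lift (by rwa [inner_vert] at hz)⟩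
    -- The lift is even in `s`, so positivity on the closed half-space holds everywhere.
    have h3 := h2 (WithLp.toLp 2 (z.fst, |z.snd|)) (by rw [inner_vert]; exact abs_nonneg _)
    simpa [lift] using h3
  · left
    push Not at hex
    have h1 : ∀ z : LiftSpace n, 0 < inner ℝ (vert n) z → lift u z = 0 := fun z hz =>
      le_antisymm (hex z hz) (hu.lift_nonneg z)
    have h2 : ∀ z : LiftSpace n, 0 ≤ inner ℝ (vert n) z → lift u z = 0 := by
      intro z hz
      have hcl : IsClosed {w : LiftSpace n | lift u w = 0} :=
        isClosed_eq hu.lift_contDiff.continuous continuous_const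
      have hz' : z ∈ closure {w : LiftSpace n | lift u w = 0} := by
        refine mem_closure_of_tendsto (f := fun t : ℝ => z + t • vert n) (b := 𝓝[>] 0) ?_ ?_
        · have : Continuous fun t : ℝ => z + t • vert n := by fun_prop
          have h := this.tendsto 0
          rw [zero_smul, add_zero] at h
          exact h.mono_left nhdsWithin_le_nhds
        · filter_upwards [self_mem_nhdsWithin] with t ht
          have ht : 0 < t := ht
          refine h1 _ ?_
          rw [inner_line norm_vert]
          linarith
      rw [hcl.closure_eq] at hz'
      exact hz'
    rintro ⟨x, y⟩ hy
    have hy : 0 ≤ y := hy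
    rw [eq_lift (u := u) x hy]
    exact h2 _ (by rw [inner_vert]; simp)

theorem exists_eq_bubble (hn : 1 ≤ n) (ha : 1 < a) (hα : 1 < α)
    (hα2 : (n + 2 * a - 2) / 2 * α = (n + 2 * a - 2) / 2 + 2)
    (hu : IsPosSolution (vert n) (2 * a - 1) α (lift u)) :
    ∃ (t : ℝ) (x₀ : EuclideanSpace ℝ (Fin n)), 0 < t ∧
      ∀ p ∈ closedHalfSpace n, u p = bubble n a t x₀ p := by
  have hb : 1 < 2 * a - 1 := by linarith
  set m : ℝ := (n + 2 * a - 2) / 2 with hm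
  have hfin : (finrank ℝ (LiftSpace n) : ℝ) + (2 * a - 1) = 2 * m + 2 := by
    rw [finrank_liftSpace, hm]; push_cast; ring
  have hm0 : 0 < m := by have : (0 : ℝ) ≤ n := n.cast_nonneg; rw [hm]; linarith
  obtain ⟨x, d, c, hx, hd, hc, hcd, hq⟩ := hu.eq_of_critical norm_vert hb hfin
    (by rw [finrank_liftSpace]; omega) hα hα2
  rw [inner_vert] at hx
  refine ⟨√d, x.fst, Real.sqrt_pos.2 hd, ?_⟩
  rintro ⟨ξ, y⟩ hy
  have hy : 0 ≤ y := hy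
  have hnorm : ‖WithLp.toLp 2 (ξ, 2 * √y) - x‖ ^ 2 = ‖ξ - x.fst‖ ^ 2 + 4 * y := by
    rw [WithLp.prod_norm_sq_eq_of_L2]
    simp only [WithLp.sub_fst, WithLp.sub_snd, hx, sub_zero, Real.norm_eq_abs, sq_abs]
    have h1 : (2 * √y) ^ 2 = 4 * y := by rw [mul_pow, Real.sq_sqrt hy]; norm_num
    exact congrArg (‖ξ - x.fst‖ ^ 2 + ·) h1
  -- Here `n + 2a = 2m + 2` and `n + 2a - 2 = 2m`, so this is the normalisation `4(m + 1) m d c² =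
  -- 1`, with `t = √d`.
  have hcoef : √d * √((n + 2 * a) * (n + 2 * a - 2)) = 1 / c := by
    rw [← Real.sqrt_mul hd.le, Real.sqrt_eq_iff_mul_self_eq_of_pos (by positivity)]
    have h1 : (n + 2 * a) * (n + 2 * a - 2) = 4 * (m + 1) * m := by rw [hm]; ring
    rw [h1]
    field_simp
    linarith
  have hden : 0 < d + (‖ξ - x.fst‖ ^ 2 + 4 * y) := by positivity
  rw [eq_lift (u := u) ξ hy, hq _ (by rw [inner_vert]; simp), hnorm, bubble, hcoef, Real.sq_sqrt hd.le,
    ← hm, Real.rpow_neg (by positivity), ← Real.inv_rpow (by positivity)]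
  congr 1
  simp only []
  rw [show d + 4 * y + ‖ξ - x.fst‖ ^ 2 = d + (‖ξ - x.fst‖ ^ 2 + 4 * y) by ring]
  field_simp

end Coordinates

end DegenerateLiouville

end

theorem theorem1 (n : ℕ) (hn : 1 ≤ n) (a α : ℝ) (ha : 1 < a) (hα : 1 < α)
    (u : EuclideanSpace ℝ (Fin n) × ℝ → ℝ)
    (hu : DegenerateLiouville.IsSolution n a α u) :
    (α < DegenerateLiouville.criticalExponent n a →
      ∀ p ∈ DegenerateLiouville.closedHalfSpace n, u p = 0) ∧
    (α = DegenerateLiouville.criticalExponent n a →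
      (∀ p ∈ DegenerateLiouville.closedHalfSpace n, u p = 0) ∨
      ∃ (t : ℝ) (x₀ : EuclideanSpace ℝ (Fin n)), 0 < t ∧
        ∀ p ∈ DegenerateLiouville.closedHalfSpace n,
          u p = DegenerateLiouville.bubble n a t x₀ p) := by
  open DegenerateLiouville in
  have hn0 : (0 : ℝ) ≤ n := n.cast_nonneg
  have hden : 0 < n + 2 * a - 2 := by linarith
  rcases hu.eq_zero_or_isPosSolution ha with h0 | hpos
  · exact ⟨fun _ => h0, fun _ => Or.inl h0⟩
  · refine ⟨fun h => ?_, fun h => Or.inr ?_⟩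
    · rw [criticalExponent, lt_div_iff₀ hden] at h
      refine absurd hpos (not_isPosSolution_of_subcritical (m := (n + 2 * a - 2) / 2) norm_vert
        (by linarith) ?_ hα (by linarith))
      rw [finrank_liftSpace]
      push_cast
      ring
    · rw [criticalExponent, eq_div_iff hden.ne'] at h
      exact exists_eq_bubble hn ha hα (by linarith) hpos
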